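/- Let $\mathbb{K}$ be a field of characteristic $0$, and let $\mathbf{CDGA}_{\mathbb{K}}^{\le 0}$ be the category of commutative differential graded $\mathbb{K}$-algebras concentrated in non-positive (cohomological) degrees, with the projective model structure: weak equivalences are the quasi-isomorphisms, fibrations are the morphisms that are surjective in strictly negative degrees, and cofibrations are the retracts of semifree extensions. A morphism $A\to B$ in $\mathbf{CDGA}_{\mathbb{K}}^{\le 0}$ is called flat if the push-out functor $-\otimes_A B$, from algebras under $A$ to algebras under $B$, preserves pull-back squares of trivial fibrations. A cofibrant replacement of $A$ is a weak equivalence $R\to A$ with $R$ cofibrant. For $R\in\mathbf{CDGA}_{\mathbb{K}}^{\le 0}$, let $\Omega_R$ be the DG-module over $R$ of Kähler differentials of $R$ over $\mathbb{K}$. Let $f\colon A\to B$ be a flat morphism in $\mathbf{CDGA}_{\mathbb{K}}^{\le 0}$ such that the natural multiplication map $B\otimes_A B\to B$ is a weak equivalence, and consider a commutative diagram in $\mathbf{CDGA}_{\mathbb{K}}^{\le 0}$ $$\begin{array}{ccc} R & \xrightarrow{\ i\ } & S\\ \downarrow & & \downarrow\\ A & \xrightarrow{\ f\ } & B\end{array}$$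 whose vertical arrows $R\to A$ and $S\to B$ are cofibrant replacements. Then the morphism of DG-modules over $B$ $$\Omega_R\otimes_R B\longrightarrow \Omega_S\otimes_S B$$ induced by $i$ is a weak equivalence, that is, a quasi-isomorphism. -/

import Mathlib

open CategoryTheory TensorProduct DirectSum

universe u

/-! ### Complexes of vector spaces in non-positive degrees -/

/-- A complex of `K`-vector spaces concentrated in non-positive (cohomological) degrees.
Throughout, `gr n` is the homogeneous component of cohomological degree `-n`, so that the
differential, which raises the cohomological degree by one, maps `gr (n + 1)` to `gr n` and
vanishes on `gr 0`. -/
structure DGVect (K : Type u) [Field K] where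
  carrier : Type u
  [addCommGroup : AddCommGroup carrier]
  [module : Module K carrier]
  gr : ℕ → Submodule K carrier
  [decomposition : DirectSum.Decomposition gr]
  d : carrier →ₗ[K] carrier
  d_mem : ∀ {n : ℕ} {x : carrier}, x ∈ gr (n + 1) → d x ∈ gr n
  d_zero : ∀ {x : carrier}, x ∈ gr 0 → d x = 0
  d_d : ∀ x : carrier, d (d x) = 0

attribute [instance] DGVect.addCommGroup DGVect.module DGVect.decomposition

namespace DGVect

variable {K : Type u} [Field K]

/-- Morphisms of complexes: linear maps preserving degrees and commuting with differentials. -/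
structure Hom (V W : DGVect K) where
  toLin : V.carrier →ₗ[K] W.carrier
  map_gr : ∀ {n : ℕ} {x : V.carrier}, x ∈ V.gr n → toLin x ∈ W.gr n
  map_d : ∀ x : V.carrier, toLin (V.d x) = W.d (toLin x)

/-- The cocycles of cohomological degree `-n`. -/
def cocycles (V : DGVect K) (n : ℕ) : Submodule K V.carrier := V.gr n ⊓ LinearMap.ker V.d

/-- The coboundaries of cohomological degree `-n`. -/
def coboundaries (V : DGVect K) (n : ℕ) : Submodule K V.carrier := (V.gr (n + 1)).map V.d

/-- The cohomology `H^{-n}(V)`. -/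
abbrev Cohomology (V : DGVect K) (n : ℕ) : Type u :=
  V.cocycles n ⧸ (V.coboundaries n).submoduleOf (V.cocycles n)

/-- The map induced on cocycles by a morphism of complexes. -/
def Hom.cocyclesMap {V W : DGVect K} (f : Hom V W) (n : ℕ) : V.cocycles n →ₗ[K] W.cocycles n :=
  f.toLin.restrict (fun x hx => ⟨f.map_gr hx.1, by
    have h : V.d x = 0 := hx.2
    change W.d (f.toLin x) = 0
    rw [← f.map_d, h, map_zero]⟩)

/-- The map `H^{-n}(V) → H^{-n}(W)` induced by a morphism of complexes. -/
def Hom.cohomologyMap {V W : DGVect K} (f : Hom V W) (n : ℕ) :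
    V.Cohomology n →ₗ[K] W.Cohomology n :=
  Submodule.mapQ _ _ (f.cocyclesMap n) (by
    rintro ⟨x, hx⟩ ⟨y, hy, hxy⟩
    exact ⟨f.toLin y, f.map_gr hy, by rw [← f.map_d, hxy]; rfl⟩)

/-- Quasi-isomorphisms: morphisms of complexes inducing isomorphisms in cohomology. -/
def Hom.IsQuasiIso {V W : DGVect K} (f : Hom V W) : Prop :=
  ∀ n : ℕ, Function.Bijective (f.cohomologyMap n)

/-- The linear map acting as `(-1)^n` on elements of degree `±n`. -/
noncomputable def sign (V : DGVect K) : V.carrier →ₗ[K] V.carrier :=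
  (DirectSum.toModule K ℕ V.carrier fun n => (-1 : K) ^ n • (V.gr n).subtype) ∘ₗ
    (DirectSum.decomposeLinearEquiv V.gr).toLinearMap

theorem sign_of_mem (V : DGVect K) {n : ℕ} {x : V.carrier} (hx : x ∈ V.gr n) :
    V.sign x = (-1 : K) ^ n • x := by
  rw [sign, LinearMap.comp_apply, LinearEquiv.coe_coe, DirectSum.decomposeLinearEquiv_apply,
    DirectSum.decompose_of_mem _ hx, ← DirectSum.lof_eq_of K, DirectSum.toModule_lof]
  rfl

end DGVect

/-! ### Commutative differential graded algebras in non-positive degrees -/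

/-- A graded-commutative (associative, unital) `K`-algebra concentrated in non-positive degrees;
`gr n` is the component of degree `-n`. -/
structure GCAlg (K : Type u) [Field K] where
  carrier : Type u
  [ring : Ring carrier]
  [algebra : Algebra K carrier]
  gr : ℕ → Submodule K carrier
  [graded : GradedAlgebra gr]
  comm : ∀ {m n : ℕ} {x y : carrier}, x ∈ gr m → y ∈ gr n →
    x * y = (-1 : K) ^ (m * n) • (y * x)

attribute [instance] GCAlg.ring GCAlg.algebra GCAlg.graded

/-- Morphisms of graded algebras. -/
@[ext]
structure GCAlg.Hom {K : Type u} [Field K] (A B : GCAlg K) where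
  toAlgHom : A.carrier →ₐ[K] B.carrier
  map_gr : ∀ {n : ℕ} {x : A.carrier}, x ∈ A.gr n → toAlgHom x ∈ B.gr n

/-- A commutative differential graded `K`-algebra concentrated in non-positive degrees. -/
structure CDGA (K : Type u) [Field K] extends GCAlg K where
  d : carrier →ₗ[K] carrier
  d_mem : ∀ {n : ℕ} {x : carrier}, x ∈ gr (n + 1) → d x ∈ gr n
  d_zero : ∀ {x : carrier}, x ∈ gr 0 → d x = 0
  d_d : ∀ x : carrier, d (d x) = 0
  leibniz : ∀ {m : ℕ} {x : carrier} (y : carrier), x ∈ gr m →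
    d (x * y) = d x * y + (-1 : K) ^ m • (x * d y)

namespace CDGA

variable {K : Type u} [Field K]

/-- Morphisms of CDGAs: morphisms of graded algebras commuting with the differentials. -/
@[ext]
structure Hom (A B : CDGA K) extends GCAlg.Hom A.toGCAlg B.toGCAlg where
  map_d : ∀ x : A.carrier, toAlgHom (A.d x) = B.d (toAlgHom x)

instance : Category (CDGA K) where
  Hom A B := Hom A B
  id A := ⟨⟨AlgHom.id K A.carrier, fun h => h⟩, fun _ => rfl⟩
  comp f g := ⟨⟨g.toAlgHom.comp f.toAlgHom, fun h => g.map_gr (f.map_gr h)⟩, fun x => by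
    change g.toAlgHom (f.toAlgHom _) = _
    rw [f.map_d, g.map_d]; rfl⟩

/-- The underlying complex of a CDGA. -/
abbrev toDGVect (A : CDGA K) : DGVect K where
  carrier := A.carrier
  gr := A.gr
  d := A.d
  d_mem := A.d_mem
  d_zero := A.d_zero
  d_d := A.d_d

/-- The morphism of complexes underlying a morphism of CDGAs. -/
def Hom.toDGVectHom {A B : CDGA K} (f : Hom A B) : DGVect.Hom A.toDGVect B.toDGVect where
  toLin := f.toAlgHom.toLinearMap
  map_gr := f.map_gr
  map_d := f.map_d

/-- Weak equivalences of CDGAs are the quasi-isomorphisms. -/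
def IsWeakEquiv {A B : CDGA K} (f : A ⟶ B) : Prop := (Hom.toDGVectHom f).IsQuasiIso

/-- Fibrations are the morphisms that are surjective in strictly negative degrees. -/
def IsFibration {A B : CDGA K} (f : A ⟶ B) : Prop :=
  ∀ n : ℕ, 0 < n → ∀ y ∈ B.gr n, ∃ x ∈ A.gr n, f.toAlgHom x = y

/-- Trivial fibrations. -/
def IsTrivialFibration {A B : CDGA K} (f : A ⟶ B) : Prop := IsFibration f ∧ IsWeakEquiv f

/-- `f : A → B` is a semifree extension if, forgetting the differentials, `B` is the free
graded-commutative `A`-algebra `A[x i | i ∈ I]` on a family of homogeneous generators `x i`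
of non-positive degrees `-deg i`. (The usual filtration condition on the differential is automatic
in non-positive degrees, since `d (x i)` has degree `-(deg i - 1)`, so it involves only
generators `x j` with `deg j < deg i`.) -/
def IsSemifreeExtension {A B : CDGA K} (f : A ⟶ B) : Prop :=
  ∃ (I : Type u) (deg : I → ℕ) (x : I → B.carrier), (∀ i, x i ∈ B.gr (deg i)) ∧
    ∀ (C : GCAlg K) (φ : GCAlg.Hom A.toGCAlg C) (c : I → C.carrier), (∀ i, c i ∈ C.gr (deg i)) →
      ∃! ψ : GCAlg.Hom B.toGCAlg C,
        (∀ a : A.carrier, ψ.toAlgHom (f.toAlgHom a) = φ.toAlgHom a) ∧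
          ∀ i, ψ.toAlgHom (x i) = c i

/-- Cofibrations are the retracts (in the category of arrows) of semifree extensions. -/
def IsCofibration {A B : CDGA K} (f : A ⟶ B) : Prop :=
  ∃ (A' B' : CDGA K) (g : A' ⟶ B'), IsSemifreeExtension g ∧ Nonempty (RetractArrow f g)

/-- The grading of the base field, concentrated in degree zero. -/
def unitGr (K : Type u) [Field K] (n : ℕ) : Submodule K K := if n = 0 then ⊤ else ⊥

theorem mem_unitGr_zero (x : K) : x ∈ unitGr K 0 := by simp [unitGr]

theorem unitGr_eq_zero {n : ℕ} (hn : n ≠ 0) {x : K} (hx : x ∈ unitGr K n) : x = 0 := by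
  simpa [unitGr, hn] using hx

noncomputable instance : GradedAlgebra (unitGr K) where
  one_mem := mem_unitGr_zero 1
  mul_mem := by
    intro i j x y hx hy
    by_cases hi : i = 0
    · by_cases hj : j = 0
      · subst hi hj; exact mem_unitGr_zero _
      · rw [unitGr_eq_zero hj hy, mul_zero]; exact zero_mem _
    · rw [unitGr_eq_zero hi hx, zero_mul]; exact zero_mem _
  decompose' x := DirectSum.of (fun n => unitGr K n) 0 ⟨x, mem_unitGr_zero x⟩
  left_inv x := by simp
  right_inv x := by
    induction x using DirectSum.induction_on with
    | zero => exact map_zero (DirectSum.of (fun n => unitGr K n) 0)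
    | of i x =>
      by_cases hi : i = 0
      · subst hi; simp
      · obtain rfl : x = 0 := Subtype.ext (unitGr_eq_zero hi x.2)
        simp only [map_zero]
        exact map_zero (DirectSum.of (fun n => unitGr K n) 0)
    | add x y hx hy =>
      conv_rhs => rw [← hx, ← hy]
      simp only [map_add]
      rw [← map_add (DirectSum.of (fun n => unitGr K n) 0)]
      rfl

/-- The base field as a CDGA concentrated in degree zero: the initial CDGA. -/
noncomputable abbrev unit (K : Type u) [Field K] : CDGA K where
  carrier := K
  gr := unitGr K
  comm := by
    intro m n x y hx hy
    by_cases hm : m = 0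
    · subst hm; simp [mul_comm]
    · simp [unitGr_eq_zero hm hx]
  d := 0
  d_mem _ := zero_mem _
  d_zero _ := rfl
  d_d _ := rfl
  leibniz := by simp

/-- The structure morphism `K → A`. -/
noncomputable def fromUnit (A : CDGA K) : unit K ⟶ A where
  toAlgHom := Algebra.ofId K A.carrier
  map_gr := by
    intro n x hx
    by_cases hn : n = 0
    · subst hn
      change algebraMap K A.carrier x ∈ A.gr 0
      exact SetLike.algebraMap_mem_graded A.gr x
    · rw [unitGr_eq_zero hn hx, map_zero]; exact zero_mem _
  map_d x := by
    have h : A.d (algebraMap K A.carrier x) = 0 := A.d_zero (SetLike.algebraMap_mem_graded A.gr x)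
    exact (map_zero (algebraMap K A.carrier)).trans h.symm

/-- A CDGA is cofibrant if the morphism from the initial CDGA is a cofibration. -/
def IsCofibrant (A : CDGA K) : Prop := IsCofibration (fromUnit A)

/-- `p : R → A` is a cofibrant replacement: a weak equivalence with cofibrant source. -/
def IsCofibrantReplacement {R A : CDGA K} (p : R ⟶ A) : Prop := IsCofibrant R ∧ IsWeakEquiv p

/-- The action of the push-out functor `- ⨿_A B` on morphisms. Given push-outs `X'` and `Y'` of
`f : A → B` along `a : A → X` and `b : A → Y`, this is the morphism `X' → Y'` induced by a
morphism `u : X → Y` under `A`. -/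
noncomputable def pushoutMap {A B X X' Y Y' : CDGA K} {f : A ⟶ B} {a : A ⟶ X} {b : A ⟶ Y}
    {jX : X ⟶ X'} {kX : B ⟶ X'} {jY : Y ⟶ Y'} {kY : B ⟶ Y'}
    (hX : IsPushout a f jX kX) (hY : IsPushout b f jY kY) (v : X ⟶ Y) (hv : a ≫ v = b) :
    X' ⟶ Y' :=
  hX.desc (v ≫ jY) kY (by rw [← Category.assoc, hv, hY.w])

/-- `f : A → B` is flat if the push-out functor `- ⨿_A B` from CDGAs under `A` to CDGAs under `B`
preserves pull-back squares of trivial fibrations: it maps every pull-back square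
`P = X ×_Z Y` of CDGAs under `A` in which `g : X → Z` is a trivial fibration to
a pull-back square of the same kind. -/
def IsFlat {A B : CDGA K} (f : A ⟶ B) : Prop :=
  ∀ ⦃P X Y Z : CDGA K⦄ (fst : P ⟶ X) (snd : P ⟶ Y) (g : X ⟶ Z) (h : Y ⟶ Z),
    IsPullback fst snd g h → IsTrivialFibration g →
    ∀ (p : A ⟶ P) (x : A ⟶ X) (y : A ⟶ Y) (z : A ⟶ Z)
      (hpx : p ≫ fst = x) (hpy : p ≫ snd = y) (hxz : x ≫ g = z) (hyz : y ≫ h = z)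
      ⦃P' X' Y' Z' : CDGA K⦄
      (jP : P ⟶ P') (kP : B ⟶ P') (jX : X ⟶ X') (kX : B ⟶ X')
      (jY : Y ⟶ Y') (kY : B ⟶ Y') (jZ : Z ⟶ Z') (kZ : B ⟶ Z')
      (hP : IsPushout p f jP kP) (hX : IsPushout x f jX kX)
      (hY : IsPushout y f jY kY) (hZ : IsPushout z f jZ kZ),
      IsPullback (pushoutMap hP hX fst hpx) (pushoutMap hP hY snd hpy)
          (pushoutMap hX hZ g hxz) (pushoutMap hY hZ h hyz) ∧
        IsTrivialFibration (pushoutMap hX hZ g hxz)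

end CDGA

/-! ### Differential graded modules -/

/-- A (left) DG-module over a CDGA `B`, concentrated in non-positive degrees. (Over a
graded-commutative algebra left modules are the same as right modules, through
`x * b = (-1)^(|x||b|) b • x`.) -/
structure DGMod {K : Type u} [Field K] (B : CDGA K) extends DGVect K where
  [moduleB : Module B.carrier carrier]
  [isScalarTower : IsScalarTower K B.carrier carrier]
  smul_mem : ∀ {m n : ℕ} {b : B.carrier} {x : carrier},
    b ∈ B.gr m → x ∈ gr n → b • x ∈ gr (m + n)
  leibniz : ∀ {m : ℕ} {b : B.carrier} (x : carrier), b ∈ B.gr m →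
    d (b • x) = B.d b • x + (-1 : K) ^ m • (b • d x)

attribute [instance] DGMod.moduleB DGMod.isScalarTower

namespace DGMod

variable {K : Type u} [Field K]

/-- Morphisms of DG-modules: `B`-linear morphisms of complexes. -/
structure Hom {B : CDGA K} (M N : DGMod B) extends DGVect.Hom M.toDGVect N.toDGVect where
  map_smul : ∀ (b : B.carrier) (x : M.carrier), toLin (b • x) = b • toLin x

/-- Weak equivalences of DG-modules are the quasi-isomorphisms. -/
def Hom.IsWeakEquiv {B : CDGA K} {M N : DGMod B} (f : Hom M N) : Prop := f.toHom.IsQuasiIso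

/-! #### The free DG-module `B ⊗_K V` on a complex `V` -/

section Free

variable (B : CDGA K) (V : DGVect K)

/-- The total grading on `B ⊗_K V`. -/
def freeGr (n : ℕ) : Submodule K (B.carrier ⊗[K] V.carrier) :=
  Submodule.span K {t | ∃ i j : ℕ, i + j = n ∧ ∃ b ∈ B.gr i, ∃ v ∈ V.gr j, b ⊗ₜ[K] v = t}

variable {B V} in
theorem tmul_mem_freeGr {i j : ℕ} {b : B.carrier} {v : V.carrier} (hb : b ∈ B.gr i)
    (hv : v ∈ V.gr j) : b ⊗ₜ[K] v ∈ freeGr B V (i + j) :=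
  Submodule.subset_span ⟨i, j, rfl, b, hb, v, hv, rfl⟩

variable {B V} in
theorem free_induction {p : B.carrier ⊗[K] V.carrier → Prop} (h0 : p 0)
    (hadd : ∀ s t, p s → p t → p (s + t))
    (ht : ∀ (i j : ℕ) (b : B.carrier) (v : V.carrier), b ∈ B.gr i → v ∈ V.gr j → p (b ⊗ₜ v))
    (t : B.carrier ⊗[K] V.carrier) : p t := by
  induction t using TensorProduct.induction_on with
  | zero => exact h0
  | add s t hs ht => exact hadd s t hs ht
  | tmul b v =>
    induction b using DirectSum.Decomposition.inductionOn B.gr with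
    | zero => rw [TensorProduct.zero_tmul]; exact h0
    | add b b' h h' => rw [TensorProduct.add_tmul]; exact hadd _ _ h h'
    | @homogeneous i b =>
      induction v using DirectSum.Decomposition.inductionOn V.gr with
      | zero => rw [TensorProduct.tmul_zero]; exact h0
      | add b b' h h' => rw [TensorProduct.tmul_add]; exact hadd _ _ h h'
      | @homogeneous j v => exact ht i j b v b.2 v.2

/-- The decomposition of `B ⊗_K V` into its homogeneous components. -/
noncomputable def freeDecompose : B.carrier ⊗[K] V.carrier →ₗ[K] ⨁ n, freeGr B V n :=
  (DirectSum.toModule K (ℕ × ℕ) _ fun ij =>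
    (DirectSum.lof K ℕ (fun n => freeGr B V n) (ij.1 + ij.2)) ∘ₗ
      LinearMap.codRestrict _
        (TensorProduct.map (B.gr ij.1).subtype (V.gr ij.2).subtype) (fun t => by
          induction t using TensorProduct.induction_on with
          | zero => rw [map_zero]; exact zero_mem _
          | add s t hs ht => rw [map_add]; exact add_mem hs ht
          | tmul b v => exact tmul_mem_freeGr b.2 v.2)) ∘ₗ
  (TensorProduct.directSum K K (fun i => B.gr i) (fun j => V.gr j)).toLinearMap ∘ₗ
  TensorProduct.map (DirectSum.decomposeLinearEquiv B.gr).toLinearMap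
    (DirectSum.decomposeLinearEquiv V.gr).toLinearMap

theorem freeDecompose_tmul {i j : ℕ} {b : B.carrier} {v : V.carrier} (hb : b ∈ B.gr i)
    (hv : v ∈ V.gr j) : freeDecompose B V (b ⊗ₜ v) =
      DirectSum.lof K ℕ (fun n => freeGr B V n) (i + j) ⟨b ⊗ₜ v, tmul_mem_freeGr hb hv⟩ := by
  simp only [freeDecompose, LinearMap.comp_apply, TensorProduct.map_tmul,
    LinearEquiv.coe_coe, DirectSum.decomposeLinearEquiv_apply,
    DirectSum.decompose_of_mem _ hb, DirectSum.decompose_of_mem _ hv]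
  rw [← DirectSum.lof_eq_of K, ← DirectSum.lof_eq_of K, TensorProduct.directSum_lof_tmul_lof,
    DirectSum.toModule_lof]
  rfl

theorem freeDecompose_of_mem {n : ℕ} {t : B.carrier ⊗[K] V.carrier} (ht : t ∈ freeGr B V n) :
    freeDecompose B V t = DirectSum.lof K ℕ (fun n => freeGr B V n) n ⟨t, ht⟩ := by
  induction ht using Submodule.span_induction with
  | mem t h =>
    obtain ⟨i, j, rfl, b, hb, v, hv, rfl⟩ := h
    exact freeDecompose_tmul B V hb hv
  | zero => rw [map_zero]; exact (map_zero _).symm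
  | add s t hs ht h h' => rw [map_add, h, h', ← map_add]; rfl
  | smul a t ht h => rw [map_smul, h, ← map_smul]; rfl

noncomputable instance : DirectSum.Decomposition (freeGr B V) where
  decompose' := freeDecompose B V
  left_inv t := by
    induction t using free_induction with
    | h0 => simp
    | hadd s t hs ht => rw [map_add, map_add, hs, ht]
    | ht i j b v hb hv =>
      rw [freeDecompose_tmul B V hb hv, DirectSum.lof_eq_of, DirectSum.coeAddMonoidHom_of]
  right_inv x := by
    induction x using DirectSum.induction_on with
    | zero => simp
    | of n x =>
      rw [DirectSum.coeAddMonoidHom_of, freeDecompose_of_mem B V x.2]; rfl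
    | add x y hx hy => rw [map_add, map_add, hx, hy]

/-- The differential `d (b ⊗ v) = d b ⊗ v + (-1)^|b| b ⊗ d v`. -/
noncomputable def freeD : B.carrier ⊗[K] V.carrier →ₗ[K] B.carrier ⊗[K] V.carrier :=
  TensorProduct.map B.d LinearMap.id + TensorProduct.map B.toDGVect.sign V.d

theorem freeD_tmul {i : ℕ} {b : B.carrier} (hb : b ∈ B.gr i) (v : V.carrier) :
    freeD B V (b ⊗ₜ v) = B.d b ⊗ₜ v + (-1 : K) ^ i • (b ⊗ₜ V.d v) := by
  have h : B.toDGVect.sign b = (-1 : K) ^ i • b := B.toDGVect.sign_of_mem hb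
  simp only [freeD, LinearMap.add_apply, TensorProduct.map_tmul, LinearMap.id_apply]
  rw [h]
  rfl

/-- The DG-module `B ⊗_K V`. -/
noncomputable abbrev free : DGMod B where
  carrier := B.carrier ⊗[K] V.carrier
  gr := freeGr B V
  d := freeD B V
  d_mem := by
    intro n t ht
    induction ht using Submodule.span_induction with
    | mem t h =>
      obtain ⟨i, j, hij, b, hb, v, hv, rfl⟩ := h
      rw [freeD_tmul B V hb]
      refine add_mem ?_ (Submodule.smul_mem _ _ ?_)
      · rcases i with _ | i
        · rw [B.d_zero hb, TensorProduct.zero_tmul]; exact zero_mem _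
        · obtain rfl : i + j = n := by omega
          exact tmul_mem_freeGr (B.d_mem hb) hv
      · rcases j with _ | j
        · rw [V.d_zero hv, TensorProduct.tmul_zero]; exact zero_mem _
        · obtain rfl : i + j = n := by omega
          exact tmul_mem_freeGr hb (V.d_mem hv)
    | zero => rw [map_zero]; exact zero_mem _
    | add s t hs ht h h' => rw [map_add]; exact add_mem h h'
    | smul a t ht h => rw [map_smul]; exact Submodule.smul_mem _ _ h
  d_zero := by
    intro t ht
    induction ht using Submodule.span_induction with
    | mem t h =>
      obtain ⟨i, j, hij, b, hb, v, hv, rfl⟩ := h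
      obtain ⟨rfl, rfl⟩ : i = 0 ∧ j = 0 := by omega
      rw [freeD_tmul B V hb, B.d_zero hb, V.d_zero hv]
      simp
    | zero => rw [map_zero]
    | add s t hs ht h h' => rw [map_add, h, h', add_zero]
    | smul a t ht h => rw [map_smul, h, smul_zero]
  d_d := by
    intro t
    induction t using free_induction with
    | h0 => simp
    | hadd s t hs ht => rw [map_add, map_add, hs, ht, add_zero]
    | ht i j b v hb hv =>
      rw [freeD_tmul B V hb, map_add, map_smul, freeD_tmul B V hb, V.d_d]
      rcases i with _ | i
      · rw [B.d_zero hb]; simp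
      · rw [freeD_tmul B V (B.d_mem hb), B.d_d]
        simp only [TensorProduct.zero_tmul, zero_add, TensorProduct.tmul_zero, smul_zero,
          add_zero, pow_succ]
        rw [← add_smul]
        simp
  smul_mem := by
    intro m n c t hc ht
    induction ht using Submodule.span_induction with
    | mem t h =>
      obtain ⟨i, j, rfl, b, hb, v, hv, rfl⟩ := h
      rw [TensorProduct.smul_tmul', ← add_assoc]
      exact tmul_mem_freeGr (SetLike.GradedMul.mul_mem hc hb) hv
    | zero => rw [smul_zero]; exact zero_mem _
    | add s t hs ht h h' => rw [smul_add]; exact add_mem h h'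
    | smul a t ht h => rw [smul_comm]; exact Submodule.smul_mem _ _ h
  leibniz := by
    intro m c t hc
    induction t using free_induction with
    | h0 => simp
    | hadd s t hs ht =>
      simp only [smul_add, map_add, hs, ht]; abel
    | ht i j b v hb hv =>
      rw [TensorProduct.smul_tmul', smul_eq_mul,
        freeD_tmul B V (SetLike.GradedMul.mul_mem hc hb), freeD_tmul B V hb, B.leibniz b hc]
      simp only [TensorProduct.add_tmul, smul_add, TensorProduct.smul_tmul', smul_eq_mul,
        pow_add, mul_smul, mul_smul_comm]
      rw [add_assoc]

end Free

/-! #### Quotients of DG-modules by homogeneous relations -/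

section Quot

variable {B : CDGA K} (M : DGMod B) (rel : Set M.carrier)

/-- The relations are homogeneous and the submodule they generate is stable under `d`. -/
structure IsDGRel : Prop where
  homogeneous : ∀ r ∈ rel, ∃ n, r ∈ M.gr n
  d_mem : ∀ r ∈ rel, M.d r ∈ Submodule.span B.carrier rel

/-- The quotient map, as a `K`-linear map. -/
def quotMk : M.carrier →ₗ[K] M.carrier ⧸ Submodule.span B.carrier rel :=
  (Submodule.mkQ (Submodule.span B.carrier rel)).restrictScalars K

theorem quotMk_surjective : Function.Surjective (quotMk M rel) :=
  fun t => Submodule.Quotient.induction_on _ t fun x => ⟨x, rfl⟩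

theorem quotMk_eq_zero {x : M.carrier} :
    quotMk M rel x = 0 ↔ x ∈ Submodule.span B.carrier rel :=
  Submodule.Quotient.mk_eq_zero _

/-- The grading of the quotient. -/
def quotGr (n : ℕ) : Submodule K (M.carrier ⧸ Submodule.span B.carrier rel) :=
  (M.gr n).map (quotMk M rel)

variable {M rel}

theorem span_induction' (hr : IsDGRel M rel) {p : M.carrier → Prop} (h0 : p 0)
    (hadd : ∀ s t, p s → p t → p (s + t))
    (hs : ∀ (m n : ℕ) (b : B.carrier) (r : M.carrier), b ∈ B.gr m → r ∈ rel → r ∈ M.gr n →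
      p (b • r)) {x : M.carrier} (hx : x ∈ Submodule.span B.carrier rel) : p x := by
  induction hx using Submodule.closure_induction with
  | zero => exact h0
  | add x y _ _ hx hy => exact hadd x y hx hy
  | smul_mem b r hrr =>
    obtain ⟨n, hn⟩ := hr.homogeneous r hrr
    induction b using DirectSum.Decomposition.inductionOn B.gr with
    | zero => rw [zero_smul]; exact h0
    | add b b' h h' => rw [add_smul]; exact hadd _ _ h h'
    | @homogeneous i b => exact hs i n b r b.2 hrr hn

/-- The decomposition of the quotient into homogeneous components, before passing to the
quotient. -/
noncomputable def quotDecomposeAux (M : DGMod B) (rel : Set M.carrier) :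
    M.carrier →ₗ[K] ⨁ n, quotGr M rel n :=
  (DirectSum.toModule K ℕ _ fun n =>
    DirectSum.lof K ℕ (fun n => quotGr M rel n) n ∘ₗ
      LinearMap.restrict (quotMk M rel) (p := M.gr n) (q := quotGr M rel n)
        (fun _ hx => Submodule.mem_map_of_mem hx)) ∘ₗ
    (DirectSum.decomposeLinearEquiv M.gr).toLinearMap

theorem quotDecomposeAux_of_mem {n : ℕ} {x : M.carrier} (hx : x ∈ M.gr n) :
    quotDecomposeAux M rel x = DirectSum.lof K ℕ (fun n => quotGr M rel n) n
      ⟨quotMk M rel x, Submodule.mem_map_of_mem hx⟩ := by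
  simp only [quotDecomposeAux, LinearMap.comp_apply, LinearEquiv.coe_coe,
    DirectSum.decomposeLinearEquiv_apply, DirectSum.decompose_of_mem _ hx]
  rw [← DirectSum.lof_eq_of K, DirectSum.toModule_lof]
  rfl

theorem quotDecomposeAux_eq_zero (hr : IsDGRel M rel) {x : M.carrier}
    (hx : x ∈ Submodule.span B.carrier rel) : quotDecomposeAux M rel x = 0 := by
  refine span_induction' hr (p := fun x => quotDecomposeAux M rel x = 0) (map_zero _) ?_ ?_ hx
  · intro s t hs ht
    rw [map_add, hs, ht, add_zero]
  · intro m n b r hb hrr hn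
    rw [quotDecomposeAux_of_mem (M.smul_mem hb hn)]
    have h : quotMk M rel (b • r) = 0 :=
      (quotMk_eq_zero M rel).2 (Submodule.smul_mem _ _ (Submodule.subset_span hrr))
    have h' : (⟨quotMk M rel (b • r), Submodule.mem_map_of_mem (M.smul_mem hb hn)⟩ :
        quotGr M rel (m + n)) = 0 := Subtype.ext h
    rw [h', map_zero]

/-- The decomposition of the quotient into homogeneous components. -/
noncomputable def quotDecompose (hr : IsDGRel M rel) :
    (M.carrier ⧸ Submodule.span B.carrier rel) →+ ⨁ n, quotGr M rel n :=
  QuotientAddGroup.lift _ (quotDecomposeAux M rel).toAddMonoidHom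
    (fun _ hx => quotDecomposeAux_eq_zero hr hx)

theorem quotDecompose_mk (hr : IsDGRel M rel) (x : M.carrier) :
    quotDecompose hr (quotMk M rel x) = quotDecomposeAux M rel x := rfl

/-- The grading of the quotient is a direct sum decomposition. -/
@[reducible]
noncomputable def quotDecomposition (hr : IsDGRel M rel) :
    DirectSum.Decomposition (quotGr M rel) where
  decompose' := quotDecompose hr
  left_inv t := by
    obtain ⟨x, rfl⟩ := quotMk_surjective M rel t
    rw [quotDecompose_mk]
    induction x using DirectSum.Decomposition.inductionOn M.gr with
    | zero => simp
    | add s t hs ht => rw [map_add, map_add, map_add, hs, ht]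
    | @homogeneous n x =>
      rw [quotDecomposeAux_of_mem x.2, DirectSum.lof_eq_of, DirectSum.coeAddMonoidHom_of]
  right_inv x := by
    induction x using DirectSum.induction_on with
    | zero => simp
    | of n x =>
      obtain ⟨_, y, hy, rfl⟩ := x
      rw [DirectSum.coeAddMonoidHom_of, quotDecompose_mk, quotDecomposeAux_of_mem hy]; rfl
    | add x y hx hy => rw [map_add, map_add, hx, hy]

theorem d_mem_span (hr : IsDGRel M rel) {x : M.carrier}
    (hx : x ∈ Submodule.span B.carrier rel) : M.d x ∈ Submodule.span B.carrier rel := by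
  refine span_induction' hr (p := fun x => M.d x ∈ Submodule.span B.carrier rel) ?_ ?_ ?_ hx
  · rw [map_zero]; exact zero_mem _
  · intro s t hs ht
    rw [map_add]; exact add_mem hs ht
  · intro m n b r hb hrr hn
    rw [M.leibniz r hb]
    refine add_mem (Submodule.smul_mem _ _ (Submodule.subset_span hrr)) ?_
    rw [← algebraMap_smul B.carrier ((-1 : K) ^ m)]
    exact Submodule.smul_mem _ _ (Submodule.smul_mem _ _ (hr.d_mem r hrr))

/-- The differential of the quotient. -/
noncomputable def quotD (hr : IsDGRel M rel) :
    (M.carrier ⧸ Submodule.span B.carrier rel) →ₗ[K]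
      (M.carrier ⧸ Submodule.span B.carrier rel) where
  toFun := QuotientAddGroup.map _ _ M.d.toAddMonoidHom (fun _ hx => d_mem_span hr hx)
  map_add' := map_add _
  map_smul' a t := by
    obtain ⟨x, rfl⟩ := quotMk_surjective M rel t
    change quotMk M rel (M.d (a • x)) = a • quotMk M rel (M.d x)
    rw [map_smul, map_smul]

theorem quotD_mk (hr : IsDGRel M rel) (x : M.carrier) :
    quotD hr (quotMk M rel x) = quotMk M rel (M.d x) := rfl

/-- The quotient of a DG-module by the submodule generated by `rel`. -/
noncomputable def quot (hr : IsDGRel M rel) : DGMod B where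
  carrier := M.carrier ⧸ Submodule.span B.carrier rel
  gr := quotGr M rel
  decomposition := quotDecomposition hr
  d := quotD hr
  d_mem := by
    rintro n _ ⟨x, hx, rfl⟩
    rw [quotD_mk]
    exact Submodule.mem_map_of_mem (M.d_mem hx)
  d_zero := by
    rintro _ ⟨x, hx, rfl⟩
    rw [quotD_mk, M.d_zero hx, map_zero]
  d_d t := by
    obtain ⟨x, rfl⟩ := quotMk_surjective M rel t
    rw [quotD_mk, quotD_mk, M.d_d, map_zero]
  smul_mem := by
    rintro m n b _ hb ⟨x, hx, rfl⟩
    exact ⟨b • x, M.smul_mem hb hx, rfl⟩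
  leibniz := by
    intro m b t hb
    obtain ⟨x, rfl⟩ := quotMk_surjective M rel t
    change quotMk M rel (M.d (b • x)) = _
    rw [M.leibniz x hb, map_add, LinearMap.map_smul_of_tower (quotMk M rel) ((-1 : K) ^ m)]
    rfl

end Quot

/-! #### Kähler differentials -/

section Kaehler

variable (A : CDGA K)

/-- The relations `δ(ab) = a δ(b) + (-1)^(|a||b|) b δ(a)`, for `a`, `b` homogeneous, where
`c ⊗ a` stands for `c δ(a)`. -/
def kaehlerRel : Set (free A A.toDGVect).carrier :=
  {t | ∃ (m n : ℕ) (a b : A.carrier), a ∈ A.gr m ∧ b ∈ A.gr n ∧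
    t = (1 : A.carrier) ⊗ₜ[K] (a * b) - a ⊗ₜ[K] b - (-1 : K) ^ (m * n) • (b ⊗ₜ[K] a)}

theorem kaehlerRel_isDGRel : IsDGRel (free A A.toDGVect) (kaehlerRel A) where
  homogeneous := by
    rintro _ ⟨m, n, a, b, ha, hb, rfl⟩
    refine ⟨m + n, sub_mem (sub_mem ?_ ?_) (Submodule.smul_mem _ _ ?_)⟩
    · have := tmul_mem_freeGr (B := A) (V := A.toDGVect) (i := 0) (j := m + n)
        (SetLike.GradedOne.one_mem (A := A.gr)) (SetLike.GradedMul.mul_mem ha hb)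
      rwa [zero_add] at this
    · exact tmul_mem_freeGr (B := A) (V := A.toDGVect) ha hb
    · rw [add_comm]
      exact tmul_mem_freeGr (B := A) (V := A.toDGVect) hb ha
  d_mem := by
    rintro _ ⟨m, n, a, b, ha, hb, rfl⟩
    have h1 : (1 : A.carrier) ⊗ₜ[K] (A.d a * b) - A.d a ⊗ₜ[K] b
        - ((-1 : K) ^ (m * n) * (-1) ^ n) • (b ⊗ₜ[K] A.d a) ∈
        Submodule.span A.carrier (kaehlerRel A) := by
      rcases m with _ | m
      · rw [A.d_zero ha]; simp
      · refine Submodule.subset_span ⟨m, n, A.d a, b, A.d_mem ha, hb, ?_⟩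
        rw [add_mul, one_mul, pow_add, mul_assoc, ← pow_add, Even.neg_one_pow ⟨n, rfl⟩, mul_one]
    have h2 : (1 : A.carrier) ⊗ₜ[K] (a * A.d b) - a ⊗ₜ[K] A.d b
        - ((-1 : K) ^ (m * n) * (-1) ^ m) • (A.d b ⊗ₜ[K] a) ∈
        Submodule.span A.carrier (kaehlerRel A) := by
      rcases n with _ | n
      · rw [A.d_zero hb]; simp
      · refine Submodule.subset_span ⟨m, n, a, A.d b, ha, A.d_mem hb, ?_⟩
        rw [mul_add, mul_one, pow_add, mul_assoc, ← pow_add, Even.neg_one_pow ⟨m, rfl⟩, mul_one]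
    have h3 : freeD A A.toDGVect ((1 : A.carrier) ⊗ₜ[K] (a * b) - a ⊗ₜ[K] b
        - (-1 : K) ^ (m * n) • (b ⊗ₜ[K] a)) =
        ((1 : A.carrier) ⊗ₜ[K] (A.d a * b) - A.d a ⊗ₜ[K] b
          - ((-1 : K) ^ (m * n) * (-1) ^ n) • (b ⊗ₜ[K] A.d a)) +
        (-1 : K) ^ m • ((1 : A.carrier) ⊗ₜ[K] (a * A.d b) - a ⊗ₜ[K] A.d b
          - ((-1 : K) ^ (m * n) * (-1) ^ m) • (A.d b ⊗ₜ[K] a)) := by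
      have h1 : (1 : A.carrier) ∈ A.gr 0 := SetLike.GradedOne.one_mem
      have hs : (-1 : K) ^ m * ((-1 : K) ^ (m * n) * (-1) ^ m) = (-1 : K) ^ (m * n) := by
        rw [mul_left_comm, ← pow_add, Even.neg_one_pow ⟨m, rfl⟩, mul_one]
      rw [map_sub, map_sub, map_smul, freeD_tmul A _ h1, freeD_tmul A _ ha, freeD_tmul A _ hb,
        A.d_zero h1, A.leibniz b ha]
      simp only [TensorProduct.zero_tmul, pow_zero, one_smul, zero_add, TensorProduct.tmul_add,
        TensorProduct.tmul_smul, smul_add, smul_sub, smul_smul, hs, one_mul]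
      abel
    have h4 := Submodule.smul_mem (Submodule.span A.carrier (kaehlerRel A))
      (algebraMap K A.carrier ((-1 : K) ^ m)) h2
    rw [algebraMap_smul] at h4
    change freeD A A.toDGVect _ ∈ _
    rw [h3]
    exact add_mem h1 h4

/-- The DG-module `Ω_A` of Kähler differentials of `A` over `K`: the DG-module generated by symbols
`δ(a)`, linear in `a` and of the same degree as `a`, with `d (δ a) = δ (d a)` and the graded
Leibniz rule. The element `c δ(a)` is the class of `c ⊗ a`. -/
noncomputable def kaehler : DGMod A := quot (kaehlerRel_isDGRel A)

end Kaehler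

/-! #### Extension of scalars -/

section BaseChange

variable {R B : CDGA K} (f : R ⟶ B) (M : DGMod R)

/-- The relations `f(r) ⊗ x = 1 ⊗ r x`; together with `B`-linearity they give
`b f(r) ⊗ x = b ⊗ r x`. -/
def baseChangeRel : Set (free B M.toDGVect).carrier :=
  {t | ∃ (m n : ℕ) (r : R.carrier) (x : M.carrier), r ∈ R.gr m ∧ x ∈ M.gr n ∧
    t = f.toAlgHom r ⊗ₜ[K] x - (1 : B.carrier) ⊗ₜ[K] (r • x)}

theorem baseChangeRel_isDGRel : IsDGRel (free B M.toDGVect) (baseChangeRel f M) where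
  homogeneous := by
    rintro _ ⟨m, n, r, x, hr, hx, rfl⟩
    refine ⟨m + n, sub_mem (tmul_mem_freeGr (f.map_gr hr) hx) ?_⟩
    have := tmul_mem_freeGr (B := B) (V := M.toDGVect) (i := 0) (j := m + n)
      (SetLike.GradedOne.one_mem (A := B.gr)) (M.smul_mem hr hx)
    rwa [zero_add] at this
  d_mem := by
    rintro _ ⟨m, n, r, x, hr, hx, rfl⟩
    have h1 : f.toAlgHom (R.d r) ⊗ₜ[K] x - (1 : B.carrier) ⊗ₜ[K] (R.d r • x) ∈
        Submodule.span B.carrier (baseChangeRel f M) := by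
      rcases m with _ | m
      · rw [R.d_zero hr]; simp
      · exact Submodule.subset_span ⟨m, n, R.d r, x, R.d_mem hr, hx, rfl⟩
    have h2 : f.toAlgHom r ⊗ₜ[K] M.d x - (1 : B.carrier) ⊗ₜ[K] (r • M.d x) ∈
        Submodule.span B.carrier (baseChangeRel f M) := by
      rcases n with _ | n
      · rw [M.d_zero hx]; simp
      · exact Submodule.subset_span ⟨m, n, r, M.d x, hr, M.d_mem hx, rfl⟩
    have h3 : freeD B M.toDGVect (f.toAlgHom r ⊗ₜ[K] x - (1 : B.carrier) ⊗ₜ[K] (r • x)) =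
        (f.toAlgHom (R.d r) ⊗ₜ[K] x - (1 : B.carrier) ⊗ₜ[K] (R.d r • x)) +
        (-1 : K) ^ m •
          (f.toAlgHom r ⊗ₜ[K] M.d x - (1 : B.carrier) ⊗ₜ[K] (r • M.d x)) := by
      have h1 : (1 : B.carrier) ∈ B.gr 0 := SetLike.GradedOne.one_mem
      rw [map_sub, freeD_tmul B _ h1, freeD_tmul B _ (f.map_gr hr), B.d_zero h1,
        M.leibniz x hr, f.map_d]
      simp only [TensorProduct.zero_tmul, pow_zero, one_smul, zero_add, TensorProduct.tmul_add,
        TensorProduct.tmul_smul, smul_sub]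
      abel
    have h4 := Submodule.smul_mem (Submodule.span B.carrier (baseChangeRel f M))
      (algebraMap K B.carrier ((-1 : K) ^ m)) h2
    rw [algebraMap_smul] at h4
    change freeD B M.toDGVect _ ∈ _
    rw [h3]
    exact add_mem h1 h4

/-- The DG-module `B ⊗_R M` obtained from `M` by extension of scalars along `f : R → B`. It is
canonically isomorphic to `M ⊗_R B`, through `b ⊗ x ↦ (-1)^(|b||x|) x ⊗ b`. -/
noncomputable def baseChange : DGMod B := quot (baseChangeRel_isDGRel f M)

end BaseChange

/-! #### Functoriality -/

section Functoriality

/-- The map `a ⊗ a' ↦ i(a) ⊗ i(a')`. -/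
noncomputable def kaehlerFreeMap {R S : CDGA K} (i : R ⟶ S) :
    (free R R.toDGVect).carrier →ₗ[K] (free S S.toDGVect).carrier :=
  TensorProduct.map i.toAlgHom.toLinearMap i.toAlgHom.toLinearMap

theorem kaehlerFreeMap_smul {R S : CDGA K} (i : R ⟶ S) (r : R.carrier)
    (t : (free R R.toDGVect).carrier) :
    kaehlerFreeMap i (r • t) = i.toAlgHom r • kaehlerFreeMap i t := by
  induction t using TensorProduct.induction_on with
  | zero => rw [smul_zero, map_zero, smul_zero]
  | add s t hs ht => rw [smul_add, map_add, map_add, smul_add, hs, ht]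
  | tmul a b =>
    change (i.toAlgHom (r * a)) ⊗ₜ[K] (i.toAlgHom b) = (i.toAlgHom r * i.toAlgHom a) ⊗ₜ[K] _
    rw [map_mul]; rfl

theorem kaehlerFreeMap_mem {R S : CDGA K} (i : R ⟶ S) {t : (free R R.toDGVect).carrier}
    (ht : t ∈ Submodule.span R.carrier (kaehlerRel R)) :
    kaehlerFreeMap i t ∈ Submodule.span S.carrier (kaehlerRel S) := by
  refine Submodule.span_induction
    (p := fun t _ => kaehlerFreeMap i t ∈ Submodule.span S.carrier (kaehlerRel S)) ?_ ?_ ?_ ?_ ht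
  · rintro _ ⟨m, n, a, b, ha, hb, rfl⟩
    refine Submodule.subset_span ⟨m, n, i.toAlgHom a, i.toAlgHom b, i.map_gr ha, i.map_gr hb, ?_⟩
    rw [map_sub, map_sub, map_smul]
    change i.toAlgHom 1 ⊗ₜ[K] i.toAlgHom (a * b) - _ - _ = _
    rw [map_one, map_mul]; rfl
  · rw [map_zero]; exact zero_mem _
  · intro s t _ _ hs ht
    rw [map_add]; exact add_mem hs ht
  · intro r t _ ht
    rw [kaehlerFreeMap_smul]; exact Submodule.smul_mem _ _ ht

/-- The map `Ω_R → Ω_S`, `a δ(a') ↦ i(a) δ(i(a'))`, induced by `i : R → S`. -/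
noncomputable def kaehlerMap {R S : CDGA K} (i : R ⟶ S) :
    DGVect.Hom (kaehler R).toDGVect (kaehler S).toDGVect where
  toLin :=
    { toFun := QuotientAddGroup.map _ _ (kaehlerFreeMap i).toAddMonoidHom
        (fun _ ht => kaehlerFreeMap_mem i ht)
      map_add' := map_add _
      map_smul' := by
        intro a t
        obtain ⟨x, rfl⟩ := quotMk_surjective _ _ t
        change quotMk _ _ (kaehlerFreeMap i (a • x)) = a • quotMk _ _ (kaehlerFreeMap i x)
        rw [map_smul, map_smul] }
  map_gr := by
    rintro n _ ⟨t, ht, rfl⟩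
    refine ⟨kaehlerFreeMap i t, ?_, rfl⟩
    refine Submodule.span_induction
      (p := fun t _ => kaehlerFreeMap i t ∈ freeGr S S.toDGVect n) ?_ ?_ ?_ ?_ ht
    · rintro _ ⟨j, k, rfl, a, ha, b, hb, rfl⟩
      exact tmul_mem_freeGr (i.map_gr ha) (i.map_gr hb)
    · rw [map_zero]; exact zero_mem _
    · intro s t _ _ hs ht
      rw [map_add]; exact add_mem hs ht
    · intro r t _ ht
      rw [map_smul]; exact Submodule.smul_mem _ _ ht
  map_d := by
    intro t
    obtain ⟨t, rfl⟩ := quotMk_surjective _ _ t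
    change quotMk _ _ (kaehlerFreeMap i (freeD R R.toDGVect t)) =
      quotMk _ _ (freeD S S.toDGVect (kaehlerFreeMap i t))
    congr 1
    induction t using free_induction with
    | h0 => simp only [map_zero]
    | hadd s t hs ht => simp only [map_add, hs, ht]
    | ht j k a b ha hb =>
      rw [freeD_tmul R _ ha, map_add, map_smul]
      change i.toAlgHom (R.d a) ⊗ₜ[K] i.toAlgHom b +
        (-1 : K) ^ j • (i.toAlgHom a ⊗ₜ[K] i.toAlgHom (R.d b)) =
        freeD S S.toDGVect (i.toAlgHom a ⊗ₜ[K] i.toAlgHom b)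
      rw [freeD_tmul S _ (i.map_gr ha), i.map_d, i.map_d]

theorem kaehlerMap_smul {R S : CDGA K} (i : R ⟶ S) (r : R.carrier) (t : (kaehler R).carrier) :
    (kaehlerMap i).toLin (r • t) = i.toAlgHom r • (kaehlerMap i).toLin t := by
  obtain ⟨t, rfl⟩ := quotMk_surjective _ _ t
  change quotMk _ _ (kaehlerFreeMap i (r • t)) = _
  rw [kaehlerFreeMap_smul]; rfl

variable {R S B : CDGA K} {i : R ⟶ S} {q : S ⟶ B} {r : R ⟶ B}

/-- The `B`-linear map underlying `baseChangeMap`. -/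
noncomputable def baseChangeLin (h : i ≫ q = r) {M : DGMod R} {N : DGMod S}
    (φ : DGVect.Hom M.toDGVect N.toDGVect)
    (hφ : ∀ (a : R.carrier) (x : M.carrier), φ.toLin (a • x) = i.toAlgHom a • φ.toLin x) :
    (baseChange r M).carrier →ₗ[B.carrier] (baseChange q N).carrier :=
  Submodule.mapQ (Submodule.span B.carrier (baseChangeRel r M))
    (Submodule.span B.carrier (baseChangeRel q N))
    (TensorProduct.AlgebraTensorModule.map (LinearMap.id : B.carrier →ₗ[B.carrier] B.carrier)
      φ.toLin) (by
        rw [Submodule.span_le]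
        rintro _ ⟨m, n, a, x, ha, hx, rfl⟩
        subst h
        refine Submodule.subset_span ⟨m, n, i.toAlgHom a, φ.toLin x, i.map_gr ha, φ.map_gr hx, ?_⟩
        rw [map_sub]
        change _ ⊗ₜ[K] φ.toLin x - (1 : B.carrier) ⊗ₜ[K] φ.toLin (a • x) = _
        rw [hφ]; rfl)

/-- Given `φ : M → N` semilinear over `i : R → S`, and morphisms `q : S → B` and `r : R → B` with
`r = q ∘ i`, the map `B ⊗_R M → B ⊗_S N`, `b ⊗ x ↦ b ⊗ φ(x)`. -/
noncomputable def baseChangeMap (h : i ≫ q = r) {M : DGMod R} {N : DGMod S}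
    (φ : DGVect.Hom M.toDGVect N.toDGVect)
    (hφ : ∀ (a : R.carrier) (x : M.carrier), φ.toLin (a • x) = i.toAlgHom a • φ.toLin x) :
    Hom (baseChange r M) (baseChange q N) where
  toLin :=
    { toFun := baseChangeLin h φ hφ
      map_add' := map_add _
      map_smul' := by
        intro a t
        obtain ⟨t, rfl⟩ := quotMk_surjective _ _ t
        change quotMk (free B N.toDGVect) (baseChangeRel q N)
            (TensorProduct.map LinearMap.id φ.toLin (a • t)) =
          a • quotMk (free B N.toDGVect) (baseChangeRel q N)
            (TensorProduct.map LinearMap.id φ.toLin t)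
        rw [map_smul, map_smul] }
  map_gr := by
    rintro n _ ⟨t, ht, rfl⟩
    refine ⟨TensorProduct.map LinearMap.id φ.toLin t, ?_, rfl⟩
    refine Submodule.span_induction
      (p := fun t _ => TensorProduct.map LinearMap.id φ.toLin t ∈ freeGr B N.toDGVect n)
      ?_ ?_ ?_ ?_ ht
    · rintro _ ⟨j, k, rfl, b, hb, x, hx, rfl⟩
      exact tmul_mem_freeGr hb (φ.map_gr hx)
    · rw [map_zero]; exact zero_mem _
    · intro s t _ _ hs ht
      rw [map_add]; exact add_mem hs ht
    · intro r t _ ht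
      rw [map_smul]; exact Submodule.smul_mem _ _ ht
  map_d := by
    intro t
    obtain ⟨t, rfl⟩ := quotMk_surjective _ _ t
    change quotMk (free B N.toDGVect) (baseChangeRel q N)
        (TensorProduct.map LinearMap.id φ.toLin (freeD B M.toDGVect t)) =
      quotMk (free B N.toDGVect) (baseChangeRel q N) (freeD B N.toDGVect (TensorProduct.map LinearMap.id φ.toLin t))
    congr 1
    induction t using free_induction with
    | h0 => simp only [map_zero]
    | hadd s t hs ht => simp only [map_add, hs, ht]
    | ht j k b x hb hx =>
      rw [freeD_tmul B _ hb, map_add, map_smul]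
      change B.d b ⊗ₜ[K] φ.toLin x + (-1 : K) ^ j • (b ⊗ₜ[K] φ.toLin (M.d x)) =
        freeD B N.toDGVect (b ⊗ₜ[K] φ.toLin x)
      rw [freeD_tmul B _ hb, φ.map_d]
  map_smul b t := map_smul (baseChangeLin h φ hφ) b t

/-- The morphism of DG-modules over `B` `Ω_R ⊗_R B → Ω_S ⊗_S B` induced by a morphism `i : R → S`
of CDGAs over `B`: on elements, `b ⊗ a δ(a') ↦ b ⊗ i(a) δ(i(a'))`. -/
noncomputable def cotangentMap (h : i ≫ q = r) :
    Hom (baseChange r (kaehler R)) (baseChange q (kaehler S)) :=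
  baseChangeMap h (kaehlerMap i) (kaehlerMap_smul i)

end Functoriality

end DGMod

/-! The theorem says that the relative cotangent complex of `f` vanishes. The reason is that `B ⊗_A
B → B` being a weak equivalence makes `f` a homotopy epimorphism: a semifree model of `B` over `A`
becomes trivial after push-out along `f`, and a trivial extension of `B` has no relative
differentials up to homotopy.

Factor `i` as a semifree extension `R → D` followed by a trivial fibration `π : D → S`
(`CDGA.exists_trivialFibration_factorization`); the map in question is the composite of the two maps
induced on cotangent modules.

For `R → D`, set `E = A ⊗_R D`. Base change along a semifree extension preserves quasi-isomorphisms
(`Semifree.pushMap_isWeakEquiv`), so `E → B` is a weak equivalence. Flatness and the hypothesis on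
`B ⊗_A B` imply that `B → B ⊗_A E = B ⊗_R D` is a weak equivalence
(`Semifree.push_inclusion_isWeakEquiv`). It is also semifree, so it lifts against all fibrations
(`Semifree.liftsFibrations`).

This lifting property is then read in terms of derivations: a derivation of `D` with values in a
DG-module `M` over `B` is a morphism `D → B ⊕ M` over `B`. Derivations of `R` extend to `D` by zero
on the free generators, at least as graded maps, so `Ω_R ⊗_R B → Ω_D ⊗_D B` is injective
(`DGMod.cotangentMap_injective`). Its cokernel `C` classifies derivations vanishing on `R`, that is,
morphisms from `B ⊗_R D` to `B ⊕ M` that restrict to the zero section on `B`. Lifting the universal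
one along the fibration `B ⊕ Path C → B ⊕ C` produces a null-homotopy of the projection onto `C`, so
`C` is acyclic (`DGMod.coker_cotangentMap_acyclic`).

For `π`, both ends lift against trivial fibrations. A section of `π`, itself factored into an
acyclic semifree extension and a trivial fibration, reduces the claim to the semifree case and the
two-out-of-six property (`DGMod.cotangentMap_isWeakEquiv_of_isTrivialFibration`).

Characteristic zero enters through the acyclicity of extensions by pairs of generators `y`, `d y`:
there the Euler operator has eigenvalues that must be invertible
(`CDGA.isWeakEquiv_of_contraction`). -/

/-! ### Graded vector spaces -/

/-- A family of subspaces with compatible projections onto its members is a direct sum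
decomposition. -/
@[reducible]
noncomputable def decompositionOfProj {K V : Type*} [Field K] [AddCommGroup V] [Module K V]
    (gr : ℕ → Submodule K V) (pr : ℕ → V →ₗ[K] V) (hmem : ∀ n v, pr n v ∈ gr n)
    (hself : ∀ n, ∀ v ∈ gr n, pr n v = v) (hne : ∀ m n, m ≠ n → ∀ v ∈ gr m, pr n v = 0)
    (hsum : ∀ v, ∃ s : Finset ℕ, v = ∑ n ∈ s, pr n v) : DirectSum.Decomposition gr := by
  have hpr : ∀ (n : ℕ) (x : ⨁ n, gr n), pr n (DirectSum.coeAddMonoidHom gr x) = x n := by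
    intro n x
    induction x using DirectSum.induction_on with
    | zero => simp
    | of m x =>
      rw [DirectSum.coeAddMonoidHom_of]
      by_cases h : m = n
      · subst h; rw [hself _ _ x.2, DirectSum.of_eq_same]
      · rw [hne m n h _ x.2, DirectSum.of_eq_of_ne _ _ _ (Ne.symm h)]; rfl
    | add x y hx hy => rw [map_add, map_add, hx, hy]; rfl
  have h : DirectSum.IsInternal gr := by
    constructor
    · intro x y hxy
      refine DFinsupp.ext fun n => Subtype.ext ?_
      have := hpr n x
      rw [hxy, hpr n y] at this
      exact this.symm
    · intro v
      obtain ⟨s, hs⟩ := hsum v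
      refine ⟨∑ n ∈ s, DirectSum.of (fun n => gr n) n ⟨pr n v, hmem n v⟩, ?_⟩
      rw [map_sum]
      simp only [DirectSum.coeAddMonoidHom_of]
      exact hs.symm
  exact h.chooseDecomposition

section Component

variable {K V : Type*} [Field K] [AddCommGroup V] [Module K V] (gr : ℕ → Submodule K V)
  [DirectSum.Decomposition gr]

/-- The projection onto the homogeneous component of degree `n`. -/
noncomputable def component (n : ℕ) : V →ₗ[K] V :=
  (gr n).subtype ∘ₗ DirectSum.component K ℕ (fun n => gr n) n ∘ₗ
    (DirectSum.decomposeLinearEquiv gr).toLinearMap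

theorem component_mem (n : ℕ) (v : V) : component gr n v ∈ gr n := (DirectSum.decompose gr v n).2

variable {gr}

theorem component_of_mem {n : ℕ} {v : V} (hv : v ∈ gr n) : component gr n v = v :=
  DirectSum.decompose_of_mem_same gr hv

theorem component_of_mem_ne {m n : ℕ} {v : V} (hv : v ∈ gr m) (h : m ≠ n) :
    component gr n v = 0 :=
  DirectSum.decompose_of_mem_ne gr hv h

variable (gr) in
theorem sum_component (v : V) : ∃ s : Finset ℕ, v = ∑ n ∈ s, component gr n v := by
  classical
  exact ⟨(DirectSum.decompose gr v).support, (DirectSum.sum_support_decompose gr v).symm⟩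

theorem linearMap_ext_homogeneous {W : Type*} [AddCommGroup W] [Module K W] {f g : V →ₗ[K] W}
    (h : ∀ n, ∀ v ∈ gr n, f v = g v) : f = g := by
  ext v
  induction v using DirectSum.Decomposition.inductionOn gr with
  | zero => simp
  | homogeneous v => exact h _ _ v.2
  | add v w hv hw => rw [map_add, map_add, hv, hw]

end Component

section Generation

variable {K A : Type*} [Field K] [Ring A] [Algebra K A] {gr : ℕ → Submodule K A}
  [GradedAlgebra gr]

/-- Induction principle for homogeneous elements of a graded algebra generated by homogeneous
elements. -/
theorem graded_induction {s : Set A} (hs : Algebra.adjoin K s = ⊤) (L : ℕ → Submodule K A)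
    (one : (1 : A) ∈ L 0) (mul : ∀ m n, ∀ x ∈ gr m, ∀ y ∈ gr n, x ∈ L m → y ∈ L n →
      x * y ∈ L (m + n))
    (gen : ∀ x ∈ s, ∃ n, x ∈ gr n ∧ x ∈ L n) {n : ℕ} {x : A} (hx : x ∈ gr n) : x ∈ L n := by
  -- Sums of homogeneous elements that satisfy `L` form a subalgebra containing the generators,
  -- hence everything. Projecting such a sum onto degree `n` brings a homogeneous element back into
  -- `L n`.
  let T : Submodule K A := ⨆ k, gr k ⊓ L k
  have hT : ∀ k, gr k ⊓ L k ≤ T := fun k => le_iSup (fun k => gr k ⊓ L k) k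
  let S : Subalgebra K A := T.toSubalgebra (hT 0 ⟨SetLike.GradedOne.one_mem, one⟩) (by
    intro x y hx hy
    induction hx using Submodule.iSup_induction' with
    | zero => rw [zero_mul]; exact zero_mem _
    | add a b _ _ ha hb => rw [add_mul]; exact add_mem ha hb
    | mem m a ha =>
      induction hy using Submodule.iSup_induction' with
      | zero => rw [mul_zero]; exact zero_mem _
      | add b c _ _ hb hc => rw [mul_add]; exact add_mem hb hc
      | mem n b hb =>
        exact hT (m + n) ⟨SetLike.GradedMul.mul_mem ha.1 hb.1, mul m n a ha.1 b hb.1 ha.2 hb.2⟩)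
  have hS : S = ⊤ := by
    rw [eq_top_iff, ← hs, Algebra.adjoin_le_iff]
    intro x hx
    obtain ⟨n, h⟩ := gen x hx
    exact hT n h
  have h1 : x ∈ T := by
    have : x ∈ S := by rw [hS]; trivial
    exact this
  have h2 : T ≤ (L n).comap (component gr n) := by
    refine iSup_le fun k y hy => ?_
    rw [Submodule.mem_comap]
    by_cases hk : k = n
    · subst hk; rw [component_of_mem hy.1]; exact hy.2
    · rw [component_of_mem_ne hy.1 hk]; exact zero_mem _
  have h3 := h2 h1
  rwa [Submodule.mem_comap, component_of_mem hx] at h3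

end Generation

theorem neg_one_pow_mul_self' {K : Type*} [Field K] (n : ℕ) : (-1 : K) ^ n * (-1) ^ n = 1 := by
  rw [← pow_add, Even.neg_one_pow ⟨n, rfl⟩]

/-! ### The grading involution of a graded-commutative algebra -/

namespace GCAlg

variable {K : Type u} [Field K]

theorem one_mem (A : GCAlg K) : (1 : A.carrier) ∈ A.gr 0 := SetLike.GradedOne.one_mem

theorem mul_mem (A : GCAlg K) {m n : ℕ} {x y : A.carrier} (hx : x ∈ A.gr m) (hy : y ∈ A.gr n) :
    x * y ∈ A.gr (m + n) := SetLike.GradedMul.mul_mem hx hy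

/-- The grading involution, as a linear map. -/
noncomputable def signLin (A : GCAlg K) : A.carrier →ₗ[K] A.carrier :=
  (DirectSum.toModule K ℕ A.carrier fun n => (-1 : K) ^ n • (A.gr n).subtype) ∘ₗ
    (DirectSum.decomposeLinearEquiv A.gr).toLinearMap

theorem signLin_of_mem (A : GCAlg K) {n : ℕ} {x : A.carrier} (hx : x ∈ A.gr n) :
    A.signLin x = (-1 : K) ^ n • x := by
  rw [signLin, LinearMap.comp_apply, LinearEquiv.coe_coe, DirectSum.decomposeLinearEquiv_apply,
    DirectSum.decompose_of_mem _ hx, ← DirectSum.lof_eq_of K, DirectSum.toModule_lof]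
  rfl

/-- The grading involution. -/
noncomputable def sign (A : GCAlg K) : A.carrier →ₐ[K] A.carrier :=
  AlgHom.ofLinearMap A.signLin (by rw [A.signLin_of_mem A.one_mem, pow_zero, one_smul]) (by
    intro x y
    induction x using DirectSum.Decomposition.inductionOn A.gr with
    | zero => simp
    | add x x' h h' => rw [add_mul, map_add, map_add, h, h', add_mul]
    | @homogeneous m x =>
      induction y using DirectSum.Decomposition.inductionOn A.gr with
      | zero => simp
      | add x x' h h' => rw [mul_add, map_add, map_add, h, h', mul_add]
      | @homogeneous n y =>
        rw [A.signLin_of_mem (A.mul_mem x.2 y.2), A.signLin_of_mem x.2, A.signLin_of_mem y.2,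
          pow_add, smul_mul_smul_comm])

theorem sign_of_mem (A : GCAlg K) {n : ℕ} {x : A.carrier} (hx : x ∈ A.gr n) :
    A.sign x = (-1 : K) ^ n • x := A.signLin_of_mem hx

theorem sign_mem (A : GCAlg K) {n : ℕ} {x : A.carrier} (hx : x ∈ A.gr n) : A.sign x ∈ A.gr n := by
  rw [A.sign_of_mem hx]; exact Submodule.smul_mem _ _ hx

theorem sign_sign (A : GCAlg K) (x : A.carrier) : A.sign (A.sign x) = x := by
  have : (A.sign.toLinearMap ∘ₗ A.sign.toLinearMap) = LinearMap.id := by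
    refine linearMap_ext_homogeneous (gr := A.gr) fun n v hv => ?_
    change A.sign (A.sign v) = v
    rw [A.sign_of_mem hv, map_smul, A.sign_of_mem hv, smul_smul, neg_one_pow_mul_self', one_smul]
  exact LinearMap.congr_fun this x

theorem Hom.map_sign {A B : GCAlg K} (f : GCAlg.Hom A B) (x : A.carrier) :
    f.toAlgHom (A.sign x) = B.sign (f.toAlgHom x) := by
  have : (f.toAlgHom.toLinearMap ∘ₗ A.sign.toLinearMap) =
      (B.sign.toLinearMap ∘ₗ f.toAlgHom.toLinearMap) := by
    refine linearMap_ext_homogeneous (gr := A.gr) fun n v hv => ?_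
    change f.toAlgHom (A.sign v) = B.sign (f.toAlgHom v)
    rw [A.sign_of_mem hv, map_smul, B.sign_of_mem (f.map_gr hv)]
  exact LinearMap.congr_fun this x

/-- The identity morphism. -/
def Hom.id (A : GCAlg K) : GCAlg.Hom A A := ⟨AlgHom.id K A.carrier, fun h => h⟩

/-- The composition of morphisms. -/
def Hom.comp {A B C : GCAlg K} (g : GCAlg.Hom B C) (f : GCAlg.Hom A B) : GCAlg.Hom A C :=
  ⟨g.toAlgHom.comp f.toAlgHom, fun h => g.map_gr (f.map_gr h)⟩

end GCAlg

/-! ### Quasi-isomorphisms -/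

namespace DGVect

variable {K : Type u} [Field K]

/-- Injectivity and surjectivity on cohomology are unwound into statements about representatives, so
that chain-level constructions can be used without passing through quotients. -/
theorem Hom.isQuasiIso_iff {V W : DGVect K} (f : Hom V W) : f.IsQuasiIso ↔
    (∀ n, ∀ x ∈ V.gr n, V.d x = 0 → ∀ y ∈ W.gr (n + 1), W.d y = f.toLin x →
      ∃ z ∈ V.gr (n + 1), V.d z = x) ∧
    (∀ n, ∀ y ∈ W.gr n, W.d y = 0 → ∃ x ∈ V.gr n, V.d x = 0 ∧
      ∃ z ∈ W.gr (n + 1), f.toLin x = y + W.d z) := by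
  have hmk : ∀ n (x : V.cocycles n), f.cohomologyMap n (Submodule.Quotient.mk x) =
      Submodule.Quotient.mk (f.cocyclesMap n x) := fun n x => rfl
  constructor
  · intro h
    refine ⟨fun n x hx dx y hy hxy => ?_, fun n y hy dy => ?_⟩
    · have h0 : f.cohomologyMap n (Submodule.Quotient.mk ⟨x, hx, dx⟩) = 0 := by
        rw [hmk, Submodule.Quotient.mk_eq_zero]
        exact ⟨y, hy, hxy⟩
      have := (h n).1 (h0.trans (map_zero _).symm)
      rw [Submodule.Quotient.mk_eq_zero] at this
      obtain ⟨z, hz, hzx⟩ := this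
      exact ⟨z, hz, hzx⟩
    · obtain ⟨t, ht⟩ := (h n).2 (Submodule.Quotient.mk ⟨y, hy, dy⟩)
      induction t using Submodule.Quotient.induction_on with
      | _ x =>
      rw [hmk, Submodule.Quotient.eq] at ht
      obtain ⟨z, hz, hzx⟩ := ht
      refine ⟨x, x.2.1, x.2.2, z, hz, ?_⟩
      have h2 : W.d z = f.toLin x - y := hzx
      rw [h2]; abel
  · rintro ⟨h1, h2⟩ n
    constructor
    · rw [injective_iff_map_eq_zero]
      intro t ht
      induction t using Submodule.Quotient.induction_on with
      | _ x =>
      rw [hmk, Submodule.Quotient.mk_eq_zero] at ht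
      obtain ⟨y, hy, hyx⟩ := ht
      rw [Submodule.Quotient.mk_eq_zero]
      obtain ⟨z, hz, hzx⟩ := h1 n x x.2.1 x.2.2 y hy hyx
      exact ⟨z, hz, hzx⟩
    · intro t
      induction t using Submodule.Quotient.induction_on with
      | _ y =>
      obtain ⟨x, hx, dx, z, hz, h⟩ := h2 n y y.2.1 y.2.2
      refine ⟨Submodule.Quotient.mk ⟨x, hx, dx⟩, ?_⟩
      rw [hmk, Submodule.Quotient.eq]
      refine ⟨z, hz, ?_⟩
      change W.d z = f.toLin x - y
      rw [h]; abel

/-- The composition of morphisms of complexes. -/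
def Hom.comp {U V W : DGVect K} (g : Hom V W) (f : Hom U V) : Hom U W where
  toLin := g.toLin ∘ₗ f.toLin
  map_gr h := g.map_gr (f.map_gr h)
  map_d x := by
    change g.toLin (f.toLin _) = W.d (g.toLin (f.toLin x))
    rw [f.map_d, g.map_d]

theorem Hom.cohomologyMap_comp {U V W : DGVect K} (g : Hom V W) (f : Hom U V) (n : ℕ)
    (t : U.Cohomology n) :
    (g.comp f).cohomologyMap n t = g.cohomologyMap n (f.cohomologyMap n t) := by
  induction t using Submodule.Quotient.induction_on with
  | _ x => rfl

theorem Hom.cohomologyMap_of_toLin_eq {V W : DGVect K} {f g : Hom V W} (h : f.toLin = g.toLin) :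
    f = g := by
  cases f; cases g; cases h; rfl

theorem Hom.IsQuasiIso.comp {U V W : DGVect K} {g : Hom V W} {f : Hom U V} (hg : g.IsQuasiIso)
    (hf : f.IsQuasiIso) : (g.comp f).IsQuasiIso := fun n => by
  have : ⇑((g.comp f).cohomologyMap n) = g.cohomologyMap n ∘ f.cohomologyMap n :=
    funext (cohomologyMap_comp g f n)
  rw [this]
  exact (hg n).comp (hf n)

theorem Hom.IsQuasiIso.of_comp_right {U V W : DGVect K} {g : Hom V W} {f : Hom U V}
    (hf : f.IsQuasiIso) (h : (g.comp f).IsQuasiIso) : g.IsQuasiIso := fun n => by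
  have e : ⇑((g.comp f).cohomologyMap n) = g.cohomologyMap n ∘ f.cohomologyMap n :=
    funext (cohomologyMap_comp g f n)
  have := h n
  rw [e] at this
  exact (Function.Bijective.of_comp_iff _ (hf n)).1 this

theorem Hom.IsQuasiIso.of_comp_left {U V W : DGVect K} {g : Hom V W} {f : Hom U V}
    (hg : g.IsQuasiIso) (h : (g.comp f).IsQuasiIso) : f.IsQuasiIso := fun n => by
  have e : ⇑((g.comp f).cohomologyMap n) = g.cohomologyMap n ∘ f.cohomologyMap n :=
    funext (cohomologyMap_comp g f n)
  have := h n
  rw [e] at this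
  exact (Function.Bijective.of_comp_iff' (hg n) _).1 this

/-- The identity morphism. -/
def Hom.id (V : DGVect K) : Hom V V := ⟨LinearMap.id, fun h => h, fun _ => rfl⟩

theorem Hom.isQuasiIso_id (V : DGVect K) : (Hom.id V).IsQuasiIso := fun n => by
  have : ⇑((Hom.id V).cohomologyMap n) = _root_.id := by
    funext t
    induction t using Submodule.Quotient.induction_on with
    | _ x => rfl
  rw [this]
  exact Function.bijective_id

/-- If `g ∘ f` and `h ∘ g` are quasi-isomorphisms, so is `g`. -/
theorem Hom.IsQuasiIso.of_comp_of_comp {U V W X : DGVect K} {f : Hom U V} {g : Hom V W}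
    {h : Hom W X} (hgf : (g.comp f).IsQuasiIso) (hhg : (h.comp g).IsQuasiIso) :
    g.IsQuasiIso := fun n => by
  have e : ⇑((g.comp f).cohomologyMap n) = g.cohomologyMap n ∘ f.cohomologyMap n :=
    funext (cohomologyMap_comp g f n)
  have e' : ⇑((h.comp g).cohomologyMap n) = h.cohomologyMap n ∘ g.cohomologyMap n :=
    funext (cohomologyMap_comp h g n)
  have h1 := hgf n
  have h2 := hhg n
  rw [e] at h1
  rw [e'] at h2
  exact ⟨h2.1.of_comp, h1.2.of_comp⟩

/-- Retracts of quasi-isomorphisms are quasi-isomorphisms. -/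
theorem Hom.IsQuasiIso.of_retract {V W V' W' : DGVect K} {f : Hom V W} {g : Hom V' W'}
    (hg : g.IsQuasiIso) (a : Hom V V') (b : Hom W W') (r : Hom V' V) (s : Hom W' W)
    (hra : r.comp a = Hom.id V) (hsb : s.comp b = Hom.id W) (hab : b.comp f = g.comp a)
    (hrs : s.comp g = f.comp r) : f.IsQuasiIso := by
  intro n
  have k1 : ∀ t, r.cohomologyMap n (a.cohomologyMap n t) = t := by
    intro t
    rw [← cohomologyMap_comp, hra]
    induction t using Submodule.Quotient.induction_on with
    | _ x => rfl
  have k2 : ∀ t, s.cohomologyMap n (b.cohomologyMap n t) = t := by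
    intro t
    rw [← cohomologyMap_comp, hsb]
    induction t using Submodule.Quotient.induction_on with
    | _ x => rfl
  constructor
  · intro t t' h
    rw [← k1 t, ← k1 t']
    congr 1
    apply (hg n).1
    rw [← cohomologyMap_comp, ← hab, cohomologyMap_comp, h, ← cohomologyMap_comp, hab,
      cohomologyMap_comp]
  · intro t
    obtain ⟨x, hx⟩ := (hg n).2 (b.cohomologyMap n t)
    refine ⟨r.cohomologyMap n x, ?_⟩
    rw [← cohomologyMap_comp, ← hrs, cohomologyMap_comp, hx, k2]

end DGVect

/-! ### Weak equivalences of CDGAs and trivial fibrations -/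

namespace CDGA

variable {K : Type u} [Field K]

@[simp]
theorem comp_toAlgHom {A B C : CDGA K} (f : A ⟶ B) (g : B ⟶ C) (x : A.carrier) :
    (f ≫ g).toAlgHom x = g.toAlgHom (f.toAlgHom x) := rfl

theorem hom_ext {A B : CDGA K} {f g : A ⟶ B} (h : ∀ x, f.toAlgHom x = g.toAlgHom x) : f = g :=
  CDGA.Hom.ext (AlgHom.ext h)

theorem congr_toAlgHom {A B : CDGA K} {f g : A ⟶ B} (h : f = g) (x : A.carrier) :
    f.toAlgHom x = g.toAlgHom x := by rw [h]

theorem IsWeakEquiv.comp {A B C : CDGA K} {f : A ⟶ B} {g : B ⟶ C} (hf : IsWeakEquiv f)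
    (hg : IsWeakEquiv g) : IsWeakEquiv (f ≫ g) :=
  DGVect.Hom.IsQuasiIso.comp (g := g.toDGVectHom) (f := f.toDGVectHom) hg hf

theorem IsWeakEquiv.of_comp_right {A B C : CDGA K} {f : A ⟶ B} {g : B ⟶ C} (hf : IsWeakEquiv f)
    (h : IsWeakEquiv (f ≫ g)) : IsWeakEquiv g :=
  DGVect.Hom.IsQuasiIso.of_comp_right (g := g.toDGVectHom) (f := f.toDGVectHom) hf h

theorem IsWeakEquiv.of_comp_left {A B C : CDGA K} {f : A ⟶ B} {g : B ⟶ C} (hg : IsWeakEquiv g)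
    (h : IsWeakEquiv (f ≫ g)) : IsWeakEquiv f :=
  DGVect.Hom.IsQuasiIso.of_comp_left (g := g.toDGVectHom) (f := f.toDGVectHom) hg h

theorem isWeakEquiv_id (A : CDGA K) : IsWeakEquiv (𝟙 A) := DGVect.Hom.isQuasiIso_id _

theorem IsWeakEquiv.of_retract {A B A' B' : CDGA K} {f : A ⟶ B} {g : A' ⟶ B'}
    (hg : IsWeakEquiv g) (h : RetractArrow f g) : IsWeakEquiv f := by
  refine DGVect.Hom.IsQuasiIso.of_retract (f := f.toDGVectHom) (g := g.toDGVectHom) hg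
    (Hom.toDGVectHom h.left.i) (Hom.toDGVectHom h.right.i)
    (Hom.toDGVectHom h.left.r) (Hom.toDGVectHom h.right.r) ?_ ?_ ?_ ?_
  · exact congrArg Hom.toDGVectHom h.left.retract
  · exact congrArg Hom.toDGVectHom h.right.retract
  · exact congrArg Hom.toDGVectHom h.i_w.symm
  · exact congrArg Hom.toDGVectHom h.r_w.symm

/-- The lifting property of cycles that characterizes trivial fibrations. -/
theorem IsTrivialFibration.exists_lift {A B : CDGA K} {g : A ⟶ B} (hg : IsTrivialFibration g)
    {n : ℕ} {z : A.carrier} {b : B.carrier} (hz : z ∈ A.gr (n - 1)) (hz0 : n = 0 → z = 0)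
    (dz : A.d z = 0) (hb : b ∈ B.gr n) (hzb : g.toAlgHom z = B.d b) :
    ∃ x ∈ A.gr n, A.d x = z ∧ g.toAlgHom x = b := by
  obtain ⟨h1, h2⟩ := (DGVect.Hom.isQuasiIso_iff _).1 hg.2
  -- For `n = 0` the truncated `n - 1` puts `z` in `gr 0`, where nothing would force it to be a
  -- boundary; this is what `hz0` is for.
  have key : ∃ x ∈ A.gr n, A.d x = z := by
    rcases n with _ | n
    · exact ⟨0, zero_mem _, by rw [map_zero, hz0 rfl]⟩
    · exact h1 n z hz dz b hb hzb.symm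
  obtain ⟨x0, hx0, dx0⟩ := key
  -- A primitive `x0` of `z` hits `b` up to a cocycle. That cocycle is the image of a cocycle up to
  -- a boundary `B.d e`, and `e` can be lifted because its index `n + 1` is positive.
  have hd : B.d (b - g.toAlgHom x0) = 0 := by
    rw [map_sub, ← g.map_d, dx0, hzb, sub_self]
  obtain ⟨c, hc, dc, e, he, hce⟩ := h2 n (b - g.toAlgHom x0) (sub_mem hb (g.map_gr hx0)) hd
  obtain ⟨e', he', hee⟩ := hg.1 (n + 1) n.succ_pos e he
  have dc' : A.d c = 0 := dc
  have hce' : g.toAlgHom c = b - g.toAlgHom x0 + B.d e := hce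
  refine ⟨x0 + c - A.d e', sub_mem (add_mem hx0 hc) (A.d_mem he'), ?_, ?_⟩
  · rw [map_sub, map_add, dx0, dc', A.d_d]; simp
  · rw [map_sub, map_add, g.map_d, hee, hce']; abel

/-- The case `z = 0` lifts cocycles. Lifting `d b` as a cocycle and then `b` over it gives
surjectivity in negative degrees, and lifting a primitive of the image gives injectivity in
cohomology. -/
theorem isTrivialFibration_of_exists_lift {A B : CDGA K} {g : A ⟶ B}
    (h : ∀ (n : ℕ) (z : A.carrier) (b : B.carrier), z ∈ A.gr (n - 1) → (n = 0 → z = 0) →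
      A.d z = 0 → b ∈ B.gr n → g.toAlgHom z = B.d b →
      ∃ x ∈ A.gr n, A.d x = z ∧ g.toAlgHom x = b) : IsTrivialFibration g := by
  have h0 : ∀ n, ∀ b ∈ B.gr n, B.d b = 0 → ∃ x ∈ A.gr n, A.d x = 0 ∧ g.toAlgHom x = b :=
    fun n b hb db => h n 0 b (zero_mem _) (fun _ => rfl) (map_zero _) hb (by rw [db, map_zero])
  refine ⟨fun n hn b hb => ?_, (DGVect.Hom.isQuasiIso_iff _).2 ⟨?_, ?_⟩⟩
  · obtain ⟨n, rfl⟩ : ∃ m, n = m + 1 := ⟨n - 1, by omega⟩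
    obtain ⟨z, hz, dz, hzb⟩ := h0 n (B.d b) (B.d_mem hb) (B.d_d b)
    obtain ⟨x, hx, -, hxb⟩ := h (n + 1) z b hz (by omega) dz hb hzb
    exact ⟨x, hx, hxb⟩
  · intro n x hx dx y hy hxy
    obtain ⟨z, hz, dz, -⟩ := h (n + 1) x y hx (by omega) dx hy hxy.symm
    exact ⟨z, hz, dz⟩
  · intro n y hy dy
    obtain ⟨x, hx, dx, hxy⟩ := h0 n y hy dy
    refine ⟨x, hx, dx, 0, zero_mem _, ?_⟩
    rw [map_zero, add_zero]; exact hxy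

end CDGA

/-! ### Free graded-commutative algebras -/

/-- The relations of graded commutativity among generators of prescribed degrees. -/
inductive FreeGC.Rel (K : Type u) [Field K] {J : Type u} (deg : J → ℕ) :
    FreeAlgebra K J → FreeAlgebra K J → Prop
  | comm (i j : J) : FreeGC.Rel K deg (FreeAlgebra.ι K i * FreeAlgebra.ι K j)
      ((-1 : K) ^ (deg i * deg j) • (FreeAlgebra.ι K j * FreeAlgebra.ι K i))

/-- The free graded-commutative algebra on generators of prescribed degrees. -/
def FreeGC (K : Type u) [Field K] {J : Type u} (deg : J → ℕ) : Type u :=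
  RingQuot (FreeGC.Rel K deg)

namespace FreeGC

variable {K : Type u} [Field K] {J : Type u} (deg : J → ℕ)

noncomputable instance : Ring (FreeGC K deg) := inferInstanceAs (Ring (RingQuot (Rel K deg)))

noncomputable instance : Algebra K (FreeGC K deg) :=
  inferInstanceAs (Algebra K (RingQuot (Rel K deg)))

variable (K) in
/-- The generators. -/
noncomputable def gen (j : J) : FreeGC K deg := RingQuot.mkAlgHom K (Rel K deg) (FreeAlgebra.ι K j)

variable {deg}

theorem gen_mul_gen (i j : J) :
    gen K deg i * gen K deg j = (-1 : K) ^ (deg i * deg j) • (gen K deg j * gen K deg i) := by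
  have h := RingQuot.mkAlgHom_rel K (Rel.comm (K := K) (deg := deg) i j)
  rw [map_mul, map_smul, map_mul] at h
  exact h

section Lift

variable {C : Type*} [Ring C] [Algebra K C]

/-- The universal property of the free graded-commutative algebra. -/
noncomputable def lift (c : J → C)
    (hc : ∀ i j, c i * c j = (-1 : K) ^ (deg i * deg j) • (c j * c i)) : FreeGC K deg →ₐ[K] C :=
  RingQuot.liftAlgHom K ⟨FreeAlgebra.lift K c, by
    rintro _ _ ⟨i, j⟩
    rw [map_mul, map_smul, map_mul, FreeAlgebra.lift_ι_apply, FreeAlgebra.lift_ι_apply, hc]⟩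

@[simp]
theorem lift_gen (c : J → C)
    (hc : ∀ i j, c i * c j = (-1 : K) ^ (deg i * deg j) • (c j * c i)) (j : J) :
    lift c hc (gen K deg j) = c j := by
  have := RingQuot.liftAlgHom_mkAlgHom_apply K (FreeAlgebra.lift K c) (s := Rel K deg) (by
    rintro _ _ ⟨i, j⟩
    rw [map_mul, map_smul, map_mul, FreeAlgebra.lift_ι_apply, FreeAlgebra.lift_ι_apply, hc])
    (FreeAlgebra.ι K j)
  rw [FreeAlgebra.lift_ι_apply] at this
  exact this

theorem algHom_ext {f g : FreeGC K deg →ₐ[K] C} (h : ∀ j, f (gen K deg j) = g (gen K deg j)) :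
    f = g :=
  RingQuot.ringQuot_ext' _ _ _ (FreeAlgebra.hom_ext (funext h))

end Lift

theorem adjoin_gen : Algebra.adjoin K (Set.range (gen K deg)) = ⊤ := by
  rw [eq_top_iff]
  rintro x -
  let S := Algebra.adjoin K (Set.range (gen K deg))
  let f : FreeGC K deg →ₐ[K] S :=
    lift (fun j => ⟨gen K deg j, Algebra.subset_adjoin ⟨j, rfl⟩⟩)
      (fun i j => Subtype.ext (gen_mul_gen i j))
  have h : S.val.comp f = AlgHom.id K _ := algHom_ext fun j => by
    change ((f (gen K deg j) : S) : FreeGC K deg) = gen K deg j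
    rw [lift_gen]
  have h2 : ((f x : S) : FreeGC K deg) = x := AlgHom.congr_fun h x
  rw [← h2]
  exact (f x).2

theorem induction {p : FreeGC K deg → Prop} (hgen : ∀ j, p (gen K deg j))
    (halg : ∀ r : K, p (algebraMap K _ r)) (hadd : ∀ x y, p x → p y → p (x + y))
    (hmul : ∀ x y, p x → p y → p (x * y)) (x : FreeGC K deg) : p x := by
  have hx : x ∈ Algebra.adjoin K (Set.range (gen K deg)) := by rw [adjoin_gen]; trivial
  induction hx using Algebra.adjoin_induction with
  | mem x h => obtain ⟨j, rfl⟩ := h; exact hgen j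
  | algebraMap r => exact halg r
  | add x y _ _ hx hy => exact hadd x y hx hy
  | mul x y _ _ hx hy => exact hmul x y hx hy

variable (deg) in
/-- The coaction of the multiplicative group corresponding to the grading. -/
noncomputable def coaction : FreeGC K deg →ₐ[K] Polynomial (FreeGC K deg) :=
  lift (fun j => Polynomial.monomial (deg j) (gen K deg j)) (fun i j => by
    rw [Polynomial.monomial_mul_monomial, Polynomial.monomial_mul_monomial, gen_mul_gen,
      Polynomial.smul_monomial, add_comm])

theorem coaction_gen (j : J) :
    coaction deg (gen K deg j) = Polynomial.monomial (deg j) (gen K deg j) := lift_gen _ _ j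

/-- Coassociativity of the coaction, which propagates from generators by multiplicativity. It makes
the coefficient of `X ^ n` homogeneous of degree `n`, so the coefficient maps serve as the
projections of the grading. -/
theorem coaction_coeff (x : FreeGC K deg) (n : ℕ) : coaction deg ((coaction deg x).coeff n) =
    Polynomial.monomial n ((coaction deg x).coeff n) := by
  classical
  induction x using induction generalizing n with
  | hgen j =>
    rw [coaction_gen, Polynomial.coeff_monomial]
    split_ifs with h
    · rw [coaction_gen, h]
    · simp
  | halg r =>
    rw [AlgHom.commutes, Polynomial.algebraMap_apply, Polynomial.coeff_C]
    split_ifs with h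
    · rw [h, AlgHom.commutes, Polynomial.algebraMap_apply]; rfl
    · simp
  | hadd x y hx hy => rw [map_add, Polynomial.coeff_add, map_add, hx, hy, map_add]
  | hmul x y hx hy =>
    rw [map_mul, Polynomial.coeff_mul, map_sum, map_sum]
    refine Finset.sum_congr rfl fun p hp => ?_
    rw [map_mul, hx, hy, Polynomial.monomial_mul_monomial, Finset.HasAntidiagonal.mem_antidiagonal.1 hp]

/-- The counit law: an element is the sum of the coefficients of its coaction. This supplies the
spanning half of the decomposition. -/
theorem coaction_eval (x : FreeGC K deg) : Polynomial.eval 1 (coaction deg x) = x := by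
  induction x using induction with
  | hgen j => rw [coaction_gen, Polynomial.eval_monomial, one_pow, mul_one]
  | halg r => rw [AlgHom.commutes, Polynomial.algebraMap_apply, Polynomial.eval_C]
  | hadd x y hx hy => rw [map_add, Polynomial.eval_add, hx, hy]
  | hmul x y hx hy =>
    rw [map_mul]
    conv_rhs => rw [← hx, ← hy]
    exact Polynomial.eval₂_mul_noncomm _ _ (fun k => Commute.one_right _)

variable (K deg) in
/-- The grading by total degree. -/
def gr (n : ℕ) : Submodule K (FreeGC K deg) where
  carrier := {x | coaction deg x = Polynomial.monomial n x}
  zero_mem' := by simp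
  add_mem' {x y} hx hy := by
    simp only [Set.mem_ofPred_eq] at *
    rw [map_add, hx, hy, map_add]
  smul_mem' c x hx := by
    simp only [Set.mem_ofPred_eq] at *
    rw [map_smul, hx, Polynomial.smul_monomial]

theorem mem_gr {n : ℕ} {x : FreeGC K deg} :
    x ∈ gr K deg n ↔ coaction deg x = Polynomial.monomial n x := Iff.rfl

theorem gen_mem (j : J) : gen K deg j ∈ gr K deg (deg j) := coaction_gen j

theorem one_mem_gr : (1 : FreeGC K deg) ∈ gr K deg 0 := by rw [mem_gr, map_one]; rfl

theorem mul_mem_gr {m n : ℕ} {x y : FreeGC K deg} (hx : x ∈ gr K deg m) (hy : y ∈ gr K deg n) :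
    x * y ∈ gr K deg (m + n) := by
  rw [mem_gr] at *
  rw [map_mul, hx, hy, Polynomial.monomial_mul_monomial]

/-- The projection onto the component of degree `n`. -/
noncomputable def pr (n : ℕ) : FreeGC K deg →ₗ[K] FreeGC K deg where
  toFun x := (coaction deg x).coeff n
  map_add' x y := by rw [map_add, Polynomial.coeff_add]
  map_smul' c x := by rw [map_smul, Polynomial.coeff_smul]; rfl

noncomputable instance : DirectSum.Decomposition (gr K deg) :=
  decompositionOfProj _ pr (fun n x => coaction_coeff x n)
    (fun n x hx => by
      change (coaction deg x).coeff n = x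
      rw [mem_gr.1 hx, Polynomial.coeff_monomial_same])
    (fun m n h x hx => by
      change (coaction deg x).coeff n = 0
      rw [mem_gr.1 hx, Polynomial.coeff_monomial_of_ne _ (Ne.symm h)])
    (fun x => ⟨(coaction deg x).support, by
      conv_lhs => rw [← coaction_eval x, Polynomial.eval_eq_sum, Polynomial.sum]
      simp only [one_pow, mul_one]
      rfl⟩)

noncomputable instance : GradedAlgebra (gr K deg) where
  one_mem := one_mem_gr
  mul_mem _ _ _ _ hx hy := mul_mem_gr hx hy

/-- Induction principle for homogeneous elements. -/
theorem gr_induction (L : ℕ → Submodule K (FreeGC K deg)) (one : (1 : FreeGC K deg) ∈ L 0)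
    (mul : ∀ m n, ∀ x ∈ gr K deg m, ∀ y ∈ gr K deg n, x ∈ L m → y ∈ L n → x * y ∈ L (m + n))
    (hgen : ∀ j, gen K deg j ∈ L (deg j)) {n : ℕ} {x : FreeGC K deg} (hx : x ∈ gr K deg n) :
    x ∈ L n :=
  graded_induction (adjoin_gen (K := K) (deg := deg)) L one mul
    (by rintro _ ⟨j, rfl⟩; exact ⟨deg j, gen_mem j, hgen j⟩) hx

/-- Elements that commute with the generators up to sign do so with all homogeneous elements. -/
theorem comm_of_comm_gen {C : Type*} [Ring C] [Algebra K C] (g : FreeGC K deg →ₐ[K] C) {m : ℕ}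
    {a : C} (h : ∀ j, a * g (gen K deg j) = (-1 : K) ^ (m * deg j) • (g (gen K deg j) * a))
    {n : ℕ} {x : FreeGC K deg} (hx : x ∈ gr K deg n) :
    a * g x = (-1 : K) ^ (m * n) • (g x * a) := by
  have h' : x ∈ LinearMap.ker ((LinearMap.mulLeft K a ∘ₗ g.toLinearMap) -
      (-1 : K) ^ (m * n) • (LinearMap.mulRight K a ∘ₗ g.toLinearMap)) := by
    refine gr_induction (fun n => LinearMap.ker ((LinearMap.mulLeft K a ∘ₗ g.toLinearMap) -
      (-1 : K) ^ (m * n) • (LinearMap.mulRight K a ∘ₗ g.toLinearMap))) ?_ ?_ ?_ hx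
    · rw [LinearMap.mem_ker]; simp
    · intro k l x hx y hy h1 h2
      have h1' : a * g x = (-1 : K) ^ (m * k) • (g x * a) := sub_eq_zero.1 h1
      have h2' : a * g y = (-1 : K) ^ (m * l) • (g y * a) := sub_eq_zero.1 h2
      refine sub_eq_zero.2 ?_
      change a * g (x * y) = (-1 : K) ^ (m * (k + l)) • (g (x * y) * a)
      rw [map_mul, ← mul_assoc, h1', smul_mul_assoc, mul_assoc, h2', mul_smul_comm, smul_smul,
        mul_assoc, mul_add, pow_add]
    · exact fun j => sub_eq_zero.2 (h j)
  exact sub_eq_zero.1 h'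

/-- Commutation up to sign is multiplicative in each factor, so it extends from generators to one
argument and then to the other. -/
theorem gr_comm {m n : ℕ} {x y : FreeGC K deg} (hx : x ∈ gr K deg m) (hy : y ∈ gr K deg n) :
    x * y = (-1 : K) ^ (m * n) • (y * x) := by
  refine comm_of_comm_gen (AlgHom.id K _) (fun j => ?_) hy
  have := comm_of_comm_gen (AlgHom.id K _) (a := gen K deg j) (m := deg j)
    (fun i => gen_mul_gen j i) hx
  simp only [AlgHom.id_apply] at this ⊢
  rw [this, smul_smul, mul_comm m, neg_one_pow_mul_self', one_smul]

variable (K deg) in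
/-- The underlying graded vector space, as a complex with zero differential. -/
noncomputable abbrev toDGVect : DGVect K where
  carrier := FreeGC K deg
  gr := gr K deg
  d := 0
  d_mem _ := zero_mem _
  d_zero _ := rfl
  d_d _ := rfl

end FreeGC

theorem units_neg_one_pow_smul {K V : Type*} [Field K] [AddCommGroup V] [Module K V] (n : ℕ)
    (v : V) : ((-1 : ℤˣ) ^ n) • v = (-1 : K) ^ n • v := by
  rcases Nat.even_or_odd n with h | h
  · rw [h.neg_one_pow, h.neg_one_pow, one_smul, one_smul]
  · rw [h.neg_one_pow, h.neg_one_pow, neg_smul, one_smul, Units.smul_def]; simp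

theorem neg_one_pow_congr' {K : Type*} [Field K] {m n : ℕ} (h : m % 2 = n % 2) :
    (-1 : K) ^ m = (-1) ^ n := by
  rw [neg_one_pow_eq_pow_mod_two, h, ← neg_one_pow_eq_pow_mod_two]

/-- Transport of a decomposition along a linear equivalence. -/
@[reducible]
noncomputable def decompositionMap {K V W : Type*} [Field K] [AddCommGroup V] [Module K V]
    [AddCommGroup W] [Module K W] (g : ℕ → Submodule K V) [DirectSum.Decomposition g]
    (e : V ≃ₗ[K] W) : DirectSum.Decomposition (fun n => (g n).map e.toLinearMap) :=
  decompositionOfProj _ (fun n => e.toLinearMap ∘ₗ component g n ∘ₗ e.symm.toLinearMap)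
    (fun n t => Submodule.mem_map_of_mem (component_mem g n _))
    (by
      rintro n _ ⟨t, ht, rfl⟩
      simp [component_of_mem ht])
    (by
      rintro m n h _ ⟨t, ht, rfl⟩
      simp [component_of_mem_ne ht h])
    (fun t => by
      obtain ⟨s, hs⟩ := sum_component g (e.symm t)
      refine ⟨s, (e.apply_symm_apply t).symm.trans ((congrArg e hs).trans (map_sum e _ _))⟩)

/-- The decomposition of `B ⊗ V`. -/
@[reducible]
noncomputable def DGMod.freeGrDecomposition {K : Type u} [Field K] (B : CDGA K) (V : DGVect K) :
    DirectSum.Decomposition (DGMod.freeGr B V) := inferInstance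

namespace CDGA

variable {K : Type u} [Field K]

theorem d_mul (A : CDGA K) (x y : A.carrier) :
    A.d (x * y) = A.d x * y + A.sign x * A.d y := by
  induction x using DirectSum.Decomposition.inductionOn A.gr with
  | zero => simp
  | add x x' h h' =>
    rw [add_mul, map_add, h, h', map_add, map_add, add_mul, add_mul]; abel
  | @homogeneous m x => rw [A.leibniz y x.2, A.sign_of_mem x.2, smul_mul_assoc]

/-- In index 0 the differential vanishes and there is no index `m - 1`. Recording only the parity
avoids this case, and it lets index-lowering differentials and index-raising homotopies be handled
by one construction of odd derivations. -/
theorem d_parity (A : CDGA K) {m : ℕ} {x : A.carrier} (hx : x ∈ A.gr m) :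
    ∃ k, k % 2 = (m + 1) % 2 ∧ A.d x ∈ A.gr k := by
  rcases m with _ | m
  · exact ⟨1, rfl, by rw [A.d_zero hx]; exact zero_mem _⟩
  · exact ⟨m, by omega, A.d_mem hx⟩

theorem d_one (A : CDGA K) : A.d 1 = 0 := A.d_zero A.one_mem

end CDGA

/-! ### Polynomial extensions of graded algebras -/

section PolyExt

variable {K : Type u} [Field K] (X : CDGA K) {J : Type u} (deg : J → ℕ)

/-- The underlying type of the free extension of `X` on generators of prescribed degrees. -/
def PolyExt.Carrier : Type u := X.gr ᵍ⊗[K] (FreeGC.gr K deg)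

namespace PolyExt

noncomputable instance : Ring (Carrier X deg) :=
  inferInstanceAs (Ring (X.gr ᵍ⊗[K] (FreeGC.gr K deg)))

noncomputable instance : Algebra K (Carrier X deg) :=
  inferInstanceAs (Algebra K (X.gr ᵍ⊗[K] (FreeGC.gr K deg)))

/-- The underlying tensor product. -/
noncomputable def equiv : X.carrier ⊗[K] FreeGC K deg ≃ₗ[K] Carrier X deg where
  toFun t := GradedTensorProduct.of K X.gr (FreeGC.gr K deg) t
  invFun t := (GradedTensorProduct.of K X.gr (FreeGC.gr K deg)).symm t
  map_add' _ _ := rfl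
  map_smul' c t := by
    refine ((GradedTensorProduct.of K X.gr (FreeGC.gr K deg)).map_smul c t).trans ?_
    rfl
  left_inv _ := rfl
  right_inv _ := rfl

variable {X}

/-- The element `x ⊗ w`. -/
noncomputable def tm (x : X.carrier) (w : FreeGC K deg) : Carrier X deg := equiv X deg (x ⊗ₜ[K] w)

variable {deg}

theorem tm_mul_tm {i j : ℕ} (x : X.carrier) {w : FreeGC K deg} (hw : w ∈ FreeGC.gr K deg j)
    {x' : X.carrier} (hx : x' ∈ X.gr i) (w' : FreeGC K deg) :
    tm deg x w * tm deg x' w' = (-1 : K) ^ (j * i) • tm deg (x * x') (w * w') := by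
  have := GradedTensorProduct.tmul_coe_mul_coe_tmul (R := K) X.gr (FreeGC.gr K deg) x ⟨w, hw⟩
    ⟨x', hx⟩ w'
  rw [← units_neg_one_pow_smul]
  exact this

variable (X deg) in
/-- The inclusion of `X`. -/
noncomputable def incl : X.carrier →ₐ[K] Carrier X deg :=
  GradedTensorProduct.includeLeft X.gr (FreeGC.gr K deg)

variable (X deg) in
/-- The inclusion of the free algebra. -/
noncomputable def inclFree : FreeGC K deg →ₐ[K] Carrier X deg :=
  GradedTensorProduct.includeRight X.gr (FreeGC.gr K deg)

variable (X deg) in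
/-- The generators. -/
noncomputable def gen (j : J) : Carrier X deg := inclFree X deg (FreeGC.gen K deg j)

theorem incl_apply (x : X.carrier) : incl X deg x = tm deg x 1 := rfl

theorem inclFree_apply (w : FreeGC K deg) : inclFree X deg w = tm deg 1 w := rfl

theorem tm_eq (x : X.carrier) (w : FreeGC K deg) :
    tm deg x w = incl X deg x * inclFree X deg w :=
  (GradedTensorProduct.tmul_one_mul_one_tmul X.gr (FreeGC.gr K deg) x w).symm

theorem tm_smul_smul (a b : K) (x : X.carrier) (w : FreeGC K deg) :
    tm deg (a • x) (b • w) = (a * b) • tm deg x w := by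
  refine Eq.trans ?_ (map_smul (equiv X deg) _ _)
  exact congrArg _ (TensorProduct.smul_tmul_smul a b x w)

attribute [irreducible] incl inclFree

theorem tm_one_one : tm deg (1 : X.carrier) 1 = 1 := by
  rw [← incl_apply, map_one]

variable (X deg) in
/-- The total grading. -/
noncomputable def gr (n : ℕ) : Submodule K (Carrier X deg) :=
  (DGMod.freeGr X (FreeGC.toDGVect K deg) n).map
    (equiv X deg).toLinearMap

theorem tm_mem {i j : ℕ} {x : X.carrier} {w : FreeGC K deg} (hx : x ∈ X.gr i)
    (hw : w ∈ FreeGC.gr K deg j) : tm deg x w ∈ gr X deg (i + j) :=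
  Submodule.mem_map_of_mem
    (DGMod.tmul_mem_freeGr (B := X) (V := FreeGC.toDGVect K deg) hx hw)

theorem gr_induction {n : ℕ} {p : Carrier X deg → Prop} (h0 : p 0)
    (hadd : ∀ s t, p s → p t → p (s + t)) (hsmul : ∀ (c : K) s, p s → p (c • s))
    (ht : ∀ (i j : ℕ) (x : X.carrier) (w : FreeGC K deg), i + j = n → x ∈ X.gr i →
      w ∈ FreeGC.gr K deg j → p (tm deg x w)) {t : Carrier X deg} (h : t ∈ gr X deg n) : p t := by
  obtain ⟨t, h, rfl⟩ := h
  refine Submodule.span_induction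
    (p := fun t _ => p (equiv X deg t)) ?_ ?_ ?_ ?_ h
  · rintro _ ⟨i, j, hij, x, hx, w, hw, rfl⟩
    exact ht i j x w hij hx hw
  · rw [map_zero]; exact h0
  · intro s t _ _ hs ht
    rw [map_add]; exact hadd _ _ hs ht
  · intro c s _ hs
    rw [map_smul]; exact hsmul _ _ hs

/-- Both assertions reduce bilinearly to decomposable tensors. There the Koszul sign of the graded
tensor product combines with the commutation signs of the two factors, and the discrepancy in the
exponents is even. -/
theorem gr_comm_aux {m n : ℕ} {s t : Carrier X deg} (hs : s ∈ gr X deg m) (ht : t ∈ gr X deg n) :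
    s * t ∈ gr X deg (m + n) ∧ s * t = (-1 : K) ^ (m * n) • (t * s) := by
  refine gr_induction (p := fun s => s * t ∈ gr X deg (m + n) ∧
    s * t = (-1 : K) ^ (m * n) • (t * s)) ?_ ?_ ?_ ?_ hs
  · rw [zero_mul]; exact ⟨zero_mem _, by rw [mul_zero, smul_zero]⟩
  · intro a b ha hb
    rw [add_mul]
    exact ⟨add_mem ha.1 hb.1, by rw [ha.2, hb.2, mul_add, smul_add]⟩
  · intro c a ha
    rw [smul_mul_assoc]
    exact ⟨Submodule.smul_mem _ _ ha.1, by rw [ha.2, mul_smul_comm, smul_comm]⟩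
  · intro i j x w hij hx hw
    subst hij
    refine gr_induction (p := fun t => tm deg x w * t ∈ gr X deg (i + j + n) ∧
      tm deg x w * t = (-1 : K) ^ ((i + j) * n) • (t * tm deg x w)) ?_ ?_ ?_ ?_ ht
    · rw [mul_zero]; exact ⟨zero_mem _, by rw [zero_mul, smul_zero]⟩
    · intro a b ha hb
      rw [mul_add]
      exact ⟨add_mem ha.1 hb.1, by rw [ha.2, hb.2, ← smul_add, add_mul a b]⟩
    · intro c a ha
      rw [mul_smul_comm]
      exact ⟨Submodule.smul_mem _ _ ha.1, by rw [ha.2, smul_mul_assoc, smul_comm]⟩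
    · intro i' j' x' w' hij hx' hw'
      subst hij
      rw [tm_mul_tm x hw hx' w', tm_mul_tm x' hw' hx w]
      refine ⟨?_, ?_⟩
      · have h3 := tm_mem (X.mul_mem hx hx') (FreeGC.mul_mem_gr hw hw')
        rw [show i + i' + (j + j') = i + j + (i' + j') by ring] at h3
        exact Submodule.smul_mem _ _ h3
      · rw [X.comm hx hx', FreeGC.gr_comm hw hw']
        rw [tm_smul_smul, smul_smul, smul_smul]
        congr 1
        rw [← pow_add, ← pow_add, ← pow_add]
        apply neg_one_pow_congr'
        have : (i + j) * (i' + j') + j' * i = j * i' + (i * i' + j * j') + 2 * (i * j') := by ring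
        omega

noncomputable instance : DirectSum.Decomposition (gr X deg) :=
  @decompositionMap _ _ _ _ _ _ _ _ (DGMod.freeGr X (FreeGC.toDGVect K deg))
    (DGMod.freeGrDecomposition X (FreeGC.toDGVect K deg)) (equiv X deg)

theorem one_mem_gr : (1 : Carrier X deg) ∈ gr X deg 0 := by
  rw [← tm_one_one]
  exact tm_mem (i := 0) (j := 0) X.one_mem FreeGC.one_mem_gr

noncomputable instance : GradedAlgebra (gr X deg) where
  one_mem := one_mem_gr
  mul_mem _ _ _ _ hx hy := (gr_comm_aux hx hy).1

end PolyExt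

/-- The free extension of `X` on generators of prescribed degrees, as a graded algebra. -/
noncomputable abbrev PolyExt : GCAlg K where
  carrier := PolyExt.Carrier X deg
  gr := PolyExt.gr X deg
  comm hx hy := (PolyExt.gr_comm_aux hx hy).2

namespace PolyExt

variable {X deg}

theorem incl_mem {i : ℕ} {x : X.carrier} (hx : x ∈ X.gr i) :
    incl X deg x ∈ (PolyExt X deg).gr i := by
  rw [incl_apply]
  exact tm_mem (j := 0) hx FreeGC.one_mem_gr

theorem inclFree_mem {i : ℕ} {w : FreeGC K deg} (hw : w ∈ FreeGC.gr K deg i) :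
    inclFree X deg w ∈ (PolyExt X deg).gr i := by
  have := tm_mem (X := X) X.one_mem hw
  rwa [zero_add, ← inclFree_apply] at this

theorem gen_mem (j : J) : gen X deg j ∈ (PolyExt X deg).gr (deg j) :=
  inclFree_mem (FreeGC.gen_mem j)

variable (X deg) in
/-- The inclusion of `X`, as a morphism of graded algebras. -/
noncomputable def inclHom : GCAlg.Hom X.toGCAlg (PolyExt X deg) := ⟨incl X deg, incl_mem⟩

theorem induction_tm {p : Carrier X deg → Prop} (h0 : p 0) (hadd : ∀ s t, p s → p t → p (s + t))
    (ht : ∀ (i j : ℕ) (x : X.carrier) (w : FreeGC K deg), x ∈ X.gr i → w ∈ FreeGC.gr K deg j →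
      p (tm deg x w)) (t : Carrier X deg) : p t := by
  obtain ⟨t, rfl⟩ := (equiv X deg).surjective t
  refine DGMod.free_induction (B := X) (V := FreeGC.toDGVect K deg)
    (p := fun t => p (equiv X deg t)) ?_ ?_ ht t
  · rw [map_zero]; exact h0
  · intro s t hs ht
    rw [map_add]; exact hadd _ _ hs ht

variable (X deg) in
theorem adjoin_eq_top :
    Algebra.adjoin K (Set.range (incl X deg) ∪ Set.range (gen X deg)) = ⊤ := by
  rw [eq_top_iff]
  rintro t -
  induction t using induction_tm with
  | h0 => exact zero_mem _
  | hadd s t hs ht => exact add_mem hs ht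
  | ht i j x w hx hw =>
    rw [tm_eq]
    refine mul_mem (Algebra.subset_adjoin (Or.inl ⟨x, rfl⟩)) ?_
    clear hw
    induction w using FreeGC.induction with
    | hgen j => exact Algebra.subset_adjoin (Or.inr ⟨j, rfl⟩)
    | halg r => rw [AlgHom.commutes]; exact Subalgebra.algebraMap_mem _ _
    | hadd x y hx hy => rw [map_add]; exact add_mem hx hy
    | hmul x y hx hy => rw [map_mul]; exact mul_mem hx hy

/-- Induction along the generation of the extension by `X` and the generators. -/
theorem induction {p : Carrier X deg → Prop} (hincl : ∀ x, p (incl X deg x))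
    (hgen : ∀ j, p (gen X deg j)) (hadd : ∀ s t, p s → p t → p (s + t))
    (hmul : ∀ s t, p s → p t → p (s * t)) (t : Carrier X deg) : p t := by
  have ht : t ∈ Algebra.adjoin K (Set.range (incl X deg) ∪ Set.range (gen X deg)) := by
    rw [adjoin_eq_top]; trivial
  induction ht using Algebra.adjoin_induction with
  | mem x h =>
    rcases h with ⟨x, rfl⟩ | ⟨j, rfl⟩
    · exact hincl x
    · exact hgen j
  | algebraMap r => rw [← (incl X deg).commutes r]; exact hincl _
  | add x y _ _ hx hy => exact hadd x y hx hy
  | mul x y _ _ hx hy => exact hmul x y hx hy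

section Lift

variable {C : Type*} [Ring C] [Algebra K C]

theorem algHom_ext {f g : Carrier X deg →ₐ[K] C} (h : ∀ x, f (incl X deg x) = g (incl X deg x))
    (h' : ∀ j, f (gen X deg j) = g (gen X deg j)) : f = g := by
  ext t
  induction t using induction with
  | hincl x => exact h x
  | hgen j => exact h' j
  | hadd s t hs ht => rw [map_add, map_add, hs, ht]
  | hmul s t hs ht => rw [map_mul, map_mul, hs, ht]

/-- The universal property of the free extension, without gradings on the target. -/
noncomputable def lift (φ : X.carrier →ₐ[K] C) (c : J → C)
    (hc : ∀ i j, c i * c j = (-1 : K) ^ (deg i * deg j) • (c j * c i))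
    (hφ : ∀ m, ∀ a ∈ X.gr m, ∀ j, φ a * c j = (-1 : K) ^ (m * deg j) • (c j * φ a)) :
    Carrier X deg →ₐ[K] C :=
  GradedTensorProduct.lift X.gr (FreeGC.gr K deg) φ (FreeGC.lift c hc) (by
    rintro i j ⟨a, ha⟩ ⟨w, hw⟩
    have := FreeGC.comm_of_comm_gen (FreeGC.lift c hc) (a := φ a) (m := i)
      (fun k => by rw [FreeGC.lift_gen]; exact hφ i a ha k) hw
    rw [mul_comm j i]
    exact this.trans (units_neg_one_pow_smul _ _).symm)

theorem lift_tm (φ : X.carrier →ₐ[K] C) (c : J → C)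
    (hc : ∀ i j, c i * c j = (-1 : K) ^ (deg i * deg j) • (c j * c i))
    (hφ : ∀ m, ∀ a ∈ X.gr m, ∀ j, φ a * c j = (-1 : K) ^ (m * deg j) • (c j * φ a))
    (x : X.carrier) (w : FreeGC K deg) :
    lift φ c hc hφ (tm deg x w) = φ x * FreeGC.lift c hc w := rfl

theorem lift_incl (φ : X.carrier →ₐ[K] C) (c : J → C)
    (hc : ∀ i j, c i * c j = (-1 : K) ^ (deg i * deg j) • (c j * c i))
    (hφ : ∀ m, ∀ a ∈ X.gr m, ∀ j, φ a * c j = (-1 : K) ^ (m * deg j) • (c j * φ a))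
    (x : X.carrier) : lift φ c hc hφ (incl X deg x) = φ x := by
  rw [incl_apply, lift_tm, map_one, mul_one]

theorem lift_gen (φ : X.carrier →ₐ[K] C) (c : J → C)
    (hc : ∀ i j, c i * c j = (-1 : K) ^ (deg i * deg j) • (c j * c i))
    (hφ : ∀ m, ∀ a ∈ X.gr m, ∀ j, φ a * c j = (-1 : K) ^ (m * deg j) • (c j * φ a))
    (j : J) : lift φ c hc hφ (gen X deg j) = c j := by
  rw [gen, inclFree_apply, lift_tm, map_one, one_mul, FreeGC.lift_gen]

end Lift

section LiftHom

variable {C : GCAlg K}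

/-- Induction principle for homogeneous elements. -/
theorem homogeneous_induction (L : ℕ → Submodule K (Carrier X deg))
    (hincl : ∀ n, ∀ x ∈ X.gr n, incl X deg x ∈ L n) (hgen : ∀ j, gen X deg j ∈ L (deg j))
    (mul : ∀ m n, ∀ x ∈ gr X deg m, ∀ y ∈ gr X deg n, x ∈ L m → y ∈ L n → x * y ∈ L (m + n))
    {n : ℕ} {t : Carrier X deg} (ht : t ∈ gr X deg n) : t ∈ L n := by
  have hadj : Algebra.adjoin K ((⋃ n, incl X deg '' (X.gr n)) ∪ Set.range (gen X deg)) = ⊤ := by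
    rw [eq_top_iff, ← adjoin_eq_top, Algebra.adjoin_le_iff]
    rintro _ (⟨x, rfl⟩ | h)
    · change incl X deg x ∈ Algebra.adjoin K _
      induction x using DirectSum.Decomposition.inductionOn X.gr with
      | zero => rw [map_zero]; exact zero_mem _
      | @homogeneous i x =>
        exact Algebra.subset_adjoin (Or.inl (Set.mem_iUnion.2 ⟨i, x, x.2, rfl⟩))
      | add x y hx hy => rw [map_add]; exact add_mem hx hy
    · exact Algebra.subset_adjoin (Or.inr h)
  refine graded_induction hadj L ?_ mul ?_ ht
  · rw [← map_one (incl X deg)]; exact hincl 0 1 X.one_mem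
  · rintro _ (h | ⟨j, rfl⟩)
    · obtain ⟨n, x, hx, rfl⟩ := Set.mem_iUnion.1 h
      exact ⟨n, incl_mem hx, hincl n x hx⟩
    · exact ⟨deg j, gen_mem j, hgen j⟩

/-- The universal property of the free extension. -/
noncomputable def liftHom (φ : GCAlg.Hom X.toGCAlg C) (c : J → C.carrier)
    (hc : ∀ j, c j ∈ C.gr (deg j)) : GCAlg.Hom (PolyExt X deg) C where
  toAlgHom := lift φ.toAlgHom c (fun i j => C.comm (hc i) (hc j))
    (fun _ _ ha j => C.comm (φ.map_gr ha) (hc j))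
  map_gr {n x} hx := by
    refine homogeneous_induction (fun n => (C.gr n).comap (lift φ.toAlgHom c
      (fun i j => C.comm (hc i) (hc j))
      (fun _ _ ha j => C.comm (φ.map_gr ha) (hc j))).toLinearMap) ?_ ?_ ?_ hx
    · intro n x hx
      rw [Submodule.mem_comap, AlgHom.toLinearMap_apply, lift_incl]
      exact φ.map_gr hx
    · intro j
      rw [Submodule.mem_comap, AlgHom.toLinearMap_apply, lift_gen]
      exact hc j
    · intro m n x _ y _ hx hy
      rw [Submodule.mem_comap, AlgHom.toLinearMap_apply] at *
      rw [map_mul]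
      exact C.mul_mem hx hy

theorem liftHom_incl (φ : GCAlg.Hom X.toGCAlg C) (c : J → C.carrier)
    (hc : ∀ j, c j ∈ C.gr (deg j)) (x : X.carrier) :
    (liftHom φ c hc).toAlgHom (incl X deg x) = φ.toAlgHom x :=
  lift_incl φ.toAlgHom c (fun i j => C.comm (hc i) (hc j))
    (fun _ _ ha j => C.comm (φ.map_gr ha) (hc j)) x

theorem liftHom_gen (φ : GCAlg.Hom X.toGCAlg C) (c : J → C.carrier)
    (hc : ∀ j, c j ∈ C.gr (deg j)) (j : J) :
    (liftHom φ c hc).toAlgHom (gen X deg j) = c j :=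
  lift_gen φ.toAlgHom c (fun i j => C.comm (hc i) (hc j))
    (fun _ _ ha j => C.comm (φ.map_gr ha) (hc j)) j

theorem hom_ext {f g : GCAlg.Hom (PolyExt X deg) C}
    (h : ∀ x, f.toAlgHom (incl X deg x) = g.toAlgHom (incl X deg x))
    (h' : ∀ j, f.toAlgHom (gen X deg j) = g.toAlgHom (gen X deg j)) : f = g :=
  GCAlg.Hom.ext (algHom_ext h h')

end LiftHom

end PolyExt

end PolyExt

/-! ### Odd derivations of free extensions -/

section Twist

variable {K C : Type*} [Field K] [Ring C] [Algebra K C]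

/-- Upper triangular matrices through which odd derivations become algebra homomorphisms. -/
def twistMatrix (K : Type*) {C : Type*} [Field K] [Ring C] [Algebra K C] (m : ℕ) (a α : C) :
    Matrix (Fin 2) (Fin 2) C := !![(-1 : K) ^ m • a, α; 0, a]

/-- The sign on the upper left entry compensates for the off-diagonal entries having parity shifted
by one, so the matrices commute with the same sign as their diagonal entries. Hence they satisfy the
relations required by the universal property of a free extension. -/
theorem twistMatrix_comm {m n : ℕ} {a α b β : C} (h : a * b = (-1 : K) ^ (m * n) • (b * a))
    (h1 : a * β = (-1 : K) ^ (m * (n + 1)) • (β * a))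
    (h2 : α * b = (-1 : K) ^ ((m + 1) * n) • (b * α)) :
    twistMatrix K m a α * twistMatrix K n b β =
      (-1 : K) ^ (m * n) • (twistMatrix K n b β * twistMatrix K m a α) := by
  unfold twistMatrix
  have e1 : (-1 : K) ^ m * (-1) ^ (m * (n + 1)) = (-1) ^ (m * n) := by
    rw [← pow_add]
    apply neg_one_pow_congr'
    have : m + m * (n + 1) = m * n + 2 * m := by ring
    omega
  have e2 : (-1 : K) ^ ((m + 1) * n) = (-1) ^ (m * n) * (-1) ^ n := by
    rw [← pow_add]; congr 1; ring
  have h00 : ((-1 : K) ^ m • a) * ((-1 : K) ^ n • b) =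
      (-1 : K) ^ (m * n) • (((-1 : K) ^ n • b) * ((-1 : K) ^ m • a)) := by
    rw [smul_mul_smul_comm, smul_mul_smul_comm, h, smul_smul, smul_smul]
    congr 1
    ring
  have h01 : (-1 : K) ^ m • (a * β) + α * b =
      (-1 : K) ^ (m * n) • ((-1 : K) ^ n • (b * α) + β * a) := by
    rw [h1, h2, smul_smul, e1, e2, mul_smul, smul_add, add_comm]
  rw [Matrix.mul_fin_two, Matrix.mul_fin_two]
  ext i j
  fin_cases i <;> fin_cases j <;> simp [-smul_add, h00, h01, h]

end Twist

namespace PolyExt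

variable {K : Type u} [Field K] {X : CDGA K} {J : Type u} {deg : J → ℕ}

theorem comm_of_parity {A : GCAlg K} {m n k l : ℕ} {x y : A.carrier} (hx : x ∈ A.gr k)
    (hy : y ∈ A.gr l) (hk : k % 2 = m % 2) (hl : l % 2 = n % 2) :
    x * y = (-1 : K) ^ (m * n) • (y * x) := by
  rw [A.comm hx hy]
  congr 1
  exact neg_one_pow_congr' (by rw [Nat.mul_mod, hk, hl, ← Nat.mul_mod])

/-- Odd derivations of a free extension exist with prescribed values on the generators. -/
theorem exists_oddDerivation (δ : X.carrier →ₗ[K] X.carrier)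
    (hδ : ∀ x y, δ (x * y) = δ x * y + X.sign x * δ y)
    (hp : ∀ m, ∀ x ∈ X.gr m, ∃ k, k % 2 = (m + 1) % 2 ∧ δ x ∈ X.gr k)
    (η : J → Carrier X deg) (hη : ∀ j, ∃ k, k % 2 = (deg j + 1) % 2 ∧ η j ∈ gr X deg k) :
    ∃ D : Carrier X deg →ₗ[K] Carrier X deg,
      (∀ s t, D (s * t) = D s * t + (PolyExt X deg).sign s * D t) ∧
      (∀ x, D (incl X deg x) = incl X deg (δ x)) ∧ ∀ j, D (gen X deg j) = η j := by
  have δ1 : δ 1 = 0 := by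
    have := hδ 1 1
    rw [mul_one, map_one X.sign, mul_one, one_mul] at this
    exact left_eq_add.1 this
  -- A linear map `D` satisfies the odd Leibniz rule exactly when the matrix with diagonal `sign t`,
  -- `t` and upper right entry `D t` is multiplicative in `t`. Constructing `D` thus becomes an
  -- application of the universal property with values in 2×2 matrices.
  let φ : X.carrier →ₐ[K] Matrix (Fin 2) (Fin 2) (Carrier X deg) := AlgHom.ofLinearMap
    { toFun := fun x => !![incl X deg (X.sign x), incl X deg (δ x); 0, incl X deg x]
      map_add' := by
        intro x y
        ext i j; fin_cases i <;> fin_cases j <;> simp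
      map_smul' := by
        intro c x
        ext i j; fin_cases i <;> fin_cases j <;> simp }
    (by
      ext i j; fin_cases i <;> fin_cases j <;> simp [δ1])
    (by
      intro x y
      simp only [LinearMap.coe_mk, AddHom.coe_mk]
      rw [Matrix.mul_fin_two, map_mul, hδ]
      simp [add_comm])
  have hφ : ∀ m, ∀ x ∈ X.gr m, φ x = twistMatrix K m (incl X deg x) (incl X deg (δ x)) := by
    intro m x hx
    change !![incl X deg (X.sign x), incl X deg (δ x); 0, incl X deg x] = _
    rw [X.sign_of_mem hx, map_smul]; rfl
  let Θ := lift (deg := deg) φ (fun j => twistMatrix K (deg j) (gen X deg j) (η j))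
    (fun i j => twistMatrix_comm ((PolyExt X deg).comm (gen_mem i) (gen_mem j))
      (by
        obtain ⟨k, hk, h⟩ := hη j
        exact comm_of_parity (A := PolyExt X deg) (gen_mem i) h rfl hk)
      (by
        obtain ⟨k, hk, h⟩ := hη i
        exact comm_of_parity (A := PolyExt X deg) h (gen_mem j) hk rfl))
    (fun m a ha j => by
      rw [hφ m a ha]
      refine twistMatrix_comm ((PolyExt X deg).comm (incl_mem ha) (gen_mem j)) ?_ ?_
      · obtain ⟨k, hk, h⟩ := hη j
        exact comm_of_parity (A := PolyExt X deg) (incl_mem ha) h rfl hk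
      · obtain ⟨k, hk, h⟩ := hp m a ha
        exact comm_of_parity (A := PolyExt X deg) (incl_mem h) (gen_mem j) hk rfl)
  have Θi : ∀ x, Θ (incl X deg x) =
      !![incl X deg (X.sign x), incl X deg (δ x); 0, incl X deg x] := fun x => lift_incl _ _ _ _ x
  have Θg : ∀ j, Θ (gen X deg j) = twistMatrix K (deg j) (gen X deg j) (η j) :=
    fun j => lift_gen _ _ _ _ j
  -- The other three entries are as expected on `X` and on the generators, hence everywhere.
  -- Multiplicativity of `Θ` then is the Leibniz rule for its upper right entry.
  have key : ∀ t, Θ t 1 0 = 0 ∧ Θ t 1 1 = t ∧ Θ t 0 0 = (PolyExt X deg).sign t := by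
    intro t
    induction t using induction with
    | hincl x =>
      rw [Θi]
      exact ⟨rfl, rfl, (inclHom X deg).map_sign x⟩
    | hgen j =>
      rw [Θg]
      exact ⟨rfl, rfl, ((PolyExt X deg).sign_of_mem (gen_mem j)).symm⟩
    | hadd s t hs ht =>
      simp only [map_add, Matrix.add_apply, hs.1, hs.2.1, hs.2.2, ht.1, ht.2.1, ht.2.2, add_zero,
        and_self]
    | hmul s t hs ht =>
      simp only [map_mul, Matrix.mul_apply, Fin.sum_univ_two, hs.1, hs.2.1, hs.2.2, ht.1, ht.2.1,
        ht.2.2, zero_mul, mul_zero, zero_add, add_zero, and_self]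
  refine ⟨{ toFun := fun t => Θ t 0 1, map_add' := fun s t => by rw [map_add]; rfl,
            map_smul' := fun c t => by rw [map_smul]; rfl }, ?_, ?_, ?_⟩
  · intro s t
    change Θ (s * t) 0 1 = Θ s 0 1 * t + (PolyExt X deg).sign s * Θ t 0 1
    rw [map_mul, Matrix.mul_apply, Fin.sum_univ_two, (key s).2.2, (key t).2.1, add_comm]
  · intro x
    change Θ _ 0 1 = _
    rw [Θi]; rfl
  · intro j
    change Θ _ 0 1 = _
    rw [Θg]; rfl

/-- A morphism of graded algebras that intertwines odd derivations on generators does so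
everywhere. -/
theorem intertwine {C : GCAlg K} (ψ : GCAlg.Hom (PolyExt X deg) C)
    {D : Carrier X deg →ₗ[K] Carrier X deg} {E : C.carrier →ₗ[K] C.carrier}
    (hD : ∀ s t, D (s * t) = D s * t + (PolyExt X deg).sign s * D t)
    (hE : ∀ s t, E (s * t) = E s * t + C.sign s * E t)
    (hincl : ∀ x, ψ.toAlgHom (D (incl X deg x)) = E (ψ.toAlgHom (incl X deg x)))
    (hgen : ∀ j, ψ.toAlgHom (D (gen X deg j)) = E (ψ.toAlgHom (gen X deg j))) (t : Carrier X deg) :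
    ψ.toAlgHom (D t) = E (ψ.toAlgHom t) := by
  induction t using induction with
  | hincl x => exact hincl x
  | hgen j => exact hgen j
  | hadd s t hs ht => simp only [map_add, hs, ht]
  | hmul s t hs ht =>
    rw [hD, map_add, map_mul, map_mul, map_mul, hE, hs, ht, ψ.map_sign]

end PolyExt

/-! ### Semifree extensions -/

/-- Generators, of prescribed degrees, together with the differentials that they are to have in
a free extension of `X`. -/
structure PreSemifree {K : Type u} [Field K] (X : CDGA K) where
  J : Type u
  deg : J → ℕ
  bd : J → PolyExt.Carrier X deg
  bd_mem : ∀ j, bd j ∈ PolyExt.gr X deg (deg j - 1)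
  bd_zero : ∀ j, deg j = 0 → bd j = 0

namespace PreSemifree

variable {K : Type u} [Field K] {X : CDGA K} (D : PreSemifree X)

theorem exists_d : ∃ d : PolyExt.Carrier X D.deg →ₗ[K] PolyExt.Carrier X D.deg,
    (∀ s t, d (s * t) = d s * t + (PolyExt X D.deg).sign s * d t) ∧
      (∀ x, d (PolyExt.incl X D.deg x) = PolyExt.incl X D.deg (X.d x)) ∧
      ∀ j, d (PolyExt.gen X D.deg j) = D.bd j :=
  PolyExt.exists_oddDerivation X.d X.d_mul (fun _ _ hx => X.d_parity hx) D.bd (fun j => by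
    by_cases h : D.deg j = 0
    · exact ⟨1, by rw [h], by rw [D.bd_zero j h]; exact zero_mem _⟩
    · exact ⟨D.deg j - 1, by omega, D.bd_mem j⟩)

/-- The derivation extending the differential of `X` with the prescribed values on generators. -/
noncomputable def d : PolyExt.Carrier X D.deg →ₗ[K] PolyExt.Carrier X D.deg := D.exists_d.choose

theorem d_mul (s t : PolyExt.Carrier X D.deg) :
    D.d (s * t) = D.d s * t + (PolyExt X D.deg).sign s * D.d t := D.exists_d.choose_spec.1 s t

theorem d_incl (x : X.carrier) : D.d (PolyExt.incl X D.deg x) = PolyExt.incl X D.deg (X.d x) :=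
  D.exists_d.choose_spec.2.1 x

theorem d_gen (j : D.J) : D.d (PolyExt.gen X D.deg j) = D.bd j := D.exists_d.choose_spec.2.2 j

/-- The two claims need a joint induction: `n - 1` is truncated, so in a product with a factor of
index 0 the degree comes out right only because the differential of that factor is zero. -/
theorem d_mem_aux {n : ℕ} {t : PolyExt.Carrier X D.deg} (ht : t ∈ PolyExt.gr X D.deg n) :
    D.d t ∈ PolyExt.gr X D.deg (n - 1) ∧ (n = 0 → D.d t = 0) := by
  have hL : t ∈ (PolyExt.gr X D.deg (n - 1) ⊓ (if n = 0 then ⊥ else ⊤)).comap D.d := by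
    refine PolyExt.homogeneous_induction
      (fun n => (PolyExt.gr X D.deg (n - 1) ⊓ (if n = 0 then ⊥ else ⊤)).comap D.d) ?_ ?_ ?_ ht
    · intro n x hx
      rw [Submodule.mem_comap, d_incl]
      rcases n with _ | n
      · rw [X.d_zero hx, map_zero]; exact zero_mem _
      · exact ⟨PolyExt.incl_mem (X.d_mem hx), by simp⟩
    · intro j
      rw [Submodule.mem_comap, d_gen]
      refine ⟨D.bd_mem j, ?_⟩
      split_ifs with h
      · exact D.bd_zero j h
      · trivial
    · intro m n x hx y hy hx' hy'
      rw [Submodule.mem_comap] at *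
      rw [d_mul]
      have h1 : D.d x * y ∈ PolyExt.gr X D.deg (m + n - 1) ∧ (m = 0 → D.d x = 0) := by
        rcases m with _ | m
        · have : D.d x = 0 := by simpa using hx'.2
          rw [this, zero_mul]
          exact ⟨zero_mem _, fun _ => rfl⟩
        · refine ⟨?_, by simp⟩
          have := (PolyExt X D.deg).mul_mem hx'.1 hy
          rwa [show m + 1 - 1 + n = m + 1 + n - 1 by omega] at this
      have h2 : (PolyExt X D.deg).sign x * D.d y ∈ PolyExt.gr X D.deg (m + n - 1) ∧
          (n = 0 → D.d y = 0) := by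
        rcases n with _ | n
        · have : D.d y = 0 := by simpa using hy'.2
          rw [this, mul_zero]
          exact ⟨zero_mem _, fun _ => rfl⟩
        · refine ⟨?_, by simp⟩
          have := (PolyExt X D.deg).mul_mem ((PolyExt X D.deg).sign_mem hx) hy'.1
          rwa [show m + (n + 1 - 1) = m + (n + 1) - 1 by omega] at this
      refine ⟨add_mem h1.1 h2.1, ?_⟩
      split_ifs with h
      · rw [h1.2 (by omega), h2.2 (by omega)]; simp
      · trivial
  refine ⟨hL.1, fun h => ?_⟩
  have := hL.2
  rw [if_pos h] at this
  exact this

theorem d_mem {n : ℕ} {t : PolyExt.Carrier X D.deg} (ht : t ∈ PolyExt.gr X D.deg (n + 1)) :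
    D.d t ∈ PolyExt.gr X D.deg n := (D.d_mem_aux ht).1

theorem d_zero {t : PolyExt.Carrier X D.deg} (ht : t ∈ PolyExt.gr X D.deg 0) : D.d t = 0 :=
  (D.d_mem_aux ht).2 rfl

theorem d_sign (t : PolyExt.Carrier X D.deg) :
    D.d ((PolyExt X D.deg).sign t) = - (PolyExt X D.deg).sign (D.d t) := by
  have : D.d ∘ₗ (PolyExt X D.deg).sign.toLinearMap =
      - ((PolyExt X D.deg).sign.toLinearMap ∘ₗ D.d) := by
    refine linearMap_ext_homogeneous (gr := PolyExt.gr X D.deg) fun n t ht => ?_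
    change D.d ((PolyExt X D.deg).sign t) = - (PolyExt X D.deg).sign (D.d t)
    rw [(PolyExt X D.deg).sign_of_mem ht, map_smul]
    rcases n with _ | n
    · rw [D.d_zero ht]; simp
    · rw [(PolyExt X D.deg).sign_of_mem (D.d_mem ht), pow_succ, ← neg_smul]; simp
  exact LinearMap.congr_fun this t

/-- Since `d` anticommutes with the grading involution, the cross terms of `d (d (s * t))` cancel.
Hence `d ∘ d` vanishes on products as soon as it vanishes on the factors, and it is enough to test
it on `X` and on generators. -/
theorem d_d_of_bd (h : ∀ j, D.d (D.bd j) = 0) (t : PolyExt.Carrier X D.deg) : D.d (D.d t) = 0 := by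
  induction t using PolyExt.induction with
  | hincl x => rw [d_incl, d_incl, X.d_d, map_zero]
  | hgen j => rw [d_gen, h]
  | hadd s t hs ht => rw [map_add, map_add, hs, ht, add_zero]
  | hmul s t hs ht =>
    rw [d_mul, map_add, d_mul, d_mul, hs, ht, d_sign]; simp

end PreSemifree

/-- Generators with prescribed differentials that define a semifree extension of `X`. -/
structure Semifree {K : Type u} [Field K] (X : CDGA K) extends PreSemifree X where
  closed : ∀ j, toPreSemifree.d (bd j) = 0

namespace Semifree

open CDGA

variable {K : Type u} [Field K] {X : CDGA K} (D : Semifree X)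

/-- The semifree extension of `X`. -/
noncomputable abbrev ext : CDGA K where
  toGCAlg := PolyExt X D.deg
  d := D.d
  d_mem := D.d_mem
  d_zero := D.d_zero
  d_d := D.d_d_of_bd D.closed
  leibniz {m x} y hx := by
    rw [D.d_mul, (PolyExt X D.deg).sign_of_mem hx, smul_mul_assoc]

/-- The inclusion of `X` in a semifree extension. -/
noncomputable def inclusion : X ⟶ D.ext :=
  CDGA.Hom.mk (PolyExt.inclHom X D.deg) (fun x => (D.d_incl x).symm)

section Desc

variable {E : CDGA K} (v : X ⟶ E) (c : D.J → E.carrier) (hc : ∀ j, c j ∈ E.gr (D.deg j))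

/-- The graded morphism on a semifree extension with prescribed values on generators. -/
noncomputable abbrev gradedDesc : GCAlg.Hom (PolyExt X D.deg) E.toGCAlg :=
  PolyExt.liftHom (CDGA.Hom.toHom v) c hc

/-- The universal property of a semifree extension. -/
noncomputable def desc (hd : ∀ j, E.d (c j) = (D.gradedDesc v c hc).toAlgHom (D.bd j)) :
    D.ext ⟶ E :=
  CDGA.Hom.mk (D.gradedDesc v c hc) (fun t => by
    refine PolyExt.intertwine (D.gradedDesc v c hc) D.d_mul E.d_mul (fun x => ?_) (fun j => ?_) t
    · rw [D.d_incl, PolyExt.liftHom_incl, PolyExt.liftHom_incl]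
      exact v.map_d x
    · rw [D.d_gen, PolyExt.liftHom_gen, hd])

variable {v c hc}

theorem inclusion_desc (hd : ∀ j, E.d (c j) = (D.gradedDesc v c hc).toAlgHom (D.bd j)) :
    D.inclusion ≫ D.desc v c hc hd = v :=
  CDGA.hom_ext fun x => PolyExt.liftHom_incl _ c hc x

theorem desc_gen (hd : ∀ j, E.d (c j) = (D.gradedDesc v c hc).toAlgHom (D.bd j)) (j : D.J) :
    (D.desc v c hc hd).toAlgHom (PolyExt.gen X D.deg j) = c j := PolyExt.liftHom_gen _ c hc j

variable {D}

theorem hom_ext {f g : D.ext ⟶ E} (h : D.inclusion ≫ f = D.inclusion ≫ g)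
    (h' : ∀ j, f.toAlgHom (PolyExt.gen X D.deg j) = g.toAlgHom (PolyExt.gen X D.deg j)) :
    f = g :=
  CDGA.Hom.ext (PolyExt.algHom_ext (fun x => CDGA.congr_toAlgHom h x) h')

end Desc

section Push

variable {Y : CDGA K} (v : X ⟶ Y)

/-- Base change of free extensions. -/
noncomputable def pushHom {J : Type u} (deg : J → ℕ) :
    GCAlg.Hom (PolyExt X deg) (PolyExt Y deg) :=
  PolyExt.liftHom ((PolyExt.inclHom Y deg).comp (CDGA.Hom.toHom v)) (PolyExt.gen Y deg)
    PolyExt.gen_mem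

theorem pushHom_incl {J : Type u} (deg : J → ℕ) (x : X.carrier) :
    (pushHom v deg).toAlgHom (PolyExt.incl X deg x) = PolyExt.incl Y deg (v.toAlgHom x) :=
  PolyExt.liftHom_incl _ _ _ x

theorem pushHom_gen {J : Type u} (deg : J → ℕ) (j : J) :
    (pushHom v deg).toAlgHom (PolyExt.gen X deg j) = PolyExt.gen Y deg j :=
  PolyExt.liftHom_gen _ _ _ j

/-- Base change of the generators of a semifree extension. -/
noncomputable def prePush : PreSemifree Y where
  J := D.J
  deg := D.deg
  bd j := (pushHom v D.deg).toAlgHom (D.bd j)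
  bd_mem j := (pushHom v D.deg).map_gr (D.bd_mem j)
  bd_zero j hj := by rw [D.bd_zero j hj, map_zero]

theorem pushHom_d (t : PolyExt.Carrier X D.deg) :
    (pushHom v D.deg).toAlgHom (D.d t) = (D.prePush v).d ((pushHom v D.deg).toAlgHom t) := by
  refine PolyExt.intertwine (pushHom v D.deg) D.d_mul (D.prePush v).d_mul (fun x => ?_)
    (fun j => ?_) t
  · rw [D.d_incl, pushHom_incl, pushHom_incl]
    exact (congrArg _ (v.map_d x)).trans ((D.prePush v).d_incl _).symm
  · rw [D.d_gen, pushHom_gen]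
    exact ((D.prePush v).d_gen j).symm

/-- Base change of a semifree extension. -/
noncomputable def push : Semifree Y where
  toPreSemifree := D.prePush v
  closed j := (pushHom_d D v (D.bd j)).symm.trans
    ((congrArg (pushHom v D.deg).toAlgHom (D.closed j)).trans (map_zero _))

/-- The canonical morphism to the base change. -/
noncomputable def pushMap : D.ext ⟶ (D.push v).ext :=
  CDGA.Hom.mk (pushHom v D.deg) (pushHom_d D v)

theorem pushMap_gen (j : D.J) :
    (D.pushMap v).toAlgHom (PolyExt.gen X D.deg j) = PolyExt.gen Y D.deg j :=
  pushHom_gen v D.deg j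

theorem inclusion_pushMap : D.inclusion ≫ D.pushMap v = v ≫ (D.push v).inclusion :=
  CDGA.hom_ext fun x => pushHom_incl v D.deg x

/-- A morphism out of a semifree extension is a morphism on the base together with values on
generators subject to the boundary condition. The generators of the base change are those of `D`,
and their boundary conditions are inherited from the given morphism on `D.ext`. -/
theorem isPushout_push : IsPushout v D.inclusion (D.push v).inclusion (D.pushMap v) := by
  refine ⟨⟨(D.inclusion_pushMap v).symm⟩, ⟨Limits.PushoutCocone.IsColimit.mk _
    (fun s => (D.push v).desc s.inl (fun j => s.inr.toAlgHom (PolyExt.gen X D.deg j))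
      (fun j => s.inr.map_gr (PolyExt.gen_mem j)) ?_) ?_ ?_ ?_⟩⟩
  · intro j
    refine (s.inr.map_d _).symm.trans ?_
    refine (congrArg s.inr.toAlgHom (D.d_gen j)).trans ?_
    let c : (D.push v).J → s.pt.carrier := fun j => s.inr.toAlgHom (PolyExt.gen X D.deg j)
    have hc : ∀ j, c j ∈ s.pt.gr ((D.push v).deg j) := fun j => s.inr.map_gr (PolyExt.gen_mem j)
    let G := (D.push v).gradedDesc s.inl c hc
    -- The morphism `G` is only graded at this stage. Comparing it with `s.inr` on the whole
    -- extension evaluates it on the boundaries, which is the missing condition.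
    have : (CDGA.Hom.toHom s.inr) = G.comp (pushHom v D.deg) := by
      refine PolyExt.hom_ext (fun x => ?_) (fun j => ?_)
      · refine (CDGA.congr_toAlgHom s.condition x).symm.trans ?_
        refine Eq.trans ?_ (congrArg G.toAlgHom (pushHom_incl v D.deg x).symm)
        exact (PolyExt.liftHom_incl (CDGA.Hom.toHom s.inl) c hc _).symm
      · refine Eq.trans ?_ (congrArg G.toAlgHom (pushHom_gen v D.deg j).symm)
        exact (PolyExt.liftHom_gen (CDGA.Hom.toHom s.inl) c hc j).symm
    exact congrArg (fun f : GCAlg.Hom (PolyExt X D.deg) s.pt.toGCAlg => f.toAlgHom (D.bd j)) this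
  · intro s
    exact inclusion_desc _ _
  · intro s
    refine hom_ext ?_ fun j => ?_
    · rw [← Category.assoc, inclusion_pushMap, Category.assoc, inclusion_desc]
      exact s.condition
    · rw [comp_toAlgHom, pushMap_gen]
      exact desc_gen (D.push v) _ j
  · intro s m h1 h2
    refine hom_ext (D := D.push v) (h1.trans (inclusion_desc _ _).symm) fun j => ?_
    refine Eq.trans ?_ (desc_gen (D.push v) _ j).symm
    exact (congrArg m.toAlgHom (D.pushMap_gen v j)).symm.trans
      (CDGA.congr_toAlgHom h2 (PolyExt.gen X D.deg j))

end Push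

end Semifree

/-! ### Lifting semifree extensions and cofibrations against trivial fibrations -/

namespace PolyExt

variable {K : Type u} [Field K] {X : CDGA K} {J : Type u} {deg : J → ℕ}

/-- Induction principle for homogeneous elements of bounded degree. -/
theorem homogeneous_induction_le (m : ℕ) (L : ℕ → Submodule K (Carrier X deg))
    (hincl : ∀ n, ∀ x ∈ X.gr n, incl X deg x ∈ L n) (hgen : ∀ j, deg j ≤ m → gen X deg j ∈ L (deg j))
    (mul : ∀ k l, ∀ x ∈ gr X deg k, ∀ y ∈ gr X deg l, x ∈ L k → y ∈ L l → x * y ∈ L (k + l))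
    {n : ℕ} (hn : n ≤ m) {t : Carrier X deg} (ht : t ∈ gr X deg n) : t ∈ L n := by
  -- No condition is imposed above index `m`. As indices are natural numbers and add up, a product
  -- of index at most `m` has both factors of index at most `m`.
  have h := homogeneous_induction (fun n => if n ≤ m then L n else ⊤) ?_ ?_ ?_ ht
  · simpa [hn] using h
  · intro n x hx
    split_ifs
    · exact hincl n x hx
    · trivial
  · intro j
    split_ifs with h
    · exact hgen j h
    · trivial
  · intro k l x hx y hy h1 h2
    split_ifs with h
    · rw [if_pos (by omega)] at h1 h2
      exact mul k l x hx y hy h1 h2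
    · trivial

/-- Morphisms of graded algebras that agree on generators of low degree agree in low degrees. -/
theorem hom_congr_le {C : GCAlg K} {f g : GCAlg.Hom (PolyExt X deg) C} (m : ℕ)
    (h : ∀ x, f.toAlgHom (incl X deg x) = g.toAlgHom (incl X deg x))
    (h' : ∀ j, deg j ≤ m → f.toAlgHom (gen X deg j) = g.toAlgHom (gen X deg j))
    {n : ℕ} (hn : n ≤ m) {t : Carrier X deg} (ht : t ∈ gr X deg n) :
    f.toAlgHom t = g.toAlgHom t := by
  refine homogeneous_induction_le m
    (fun _ => LinearMap.eqLocus f.toAlgHom.toLinearMap g.toAlgHom.toLinearMap) ?_ ?_ ?_ hn ht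
  · exact fun n x _ => h x
  · exact fun j hj => h' j hj
  · intro k l x _ y _ hx hy
    change f.toAlgHom (x * y) = g.toAlgHom (x * y)
    have hx : f.toAlgHom x = g.toAlgHom x := hx
    have hy : f.toAlgHom y = g.toAlgHom y := hy
    rw [map_mul, map_mul, hx, hy]

end PolyExt

open CDGA

namespace Semifree

variable {K : Type u} [Field K] {X : CDGA K} (D : Semifree X)

section Lift

variable {E F : CDGA K} (p : E ⟶ F) (v : X ⟶ E) (w : D.ext ⟶ F)

/-- One step of the construction of a lift: the value on the generator `j`. -/
noncomputable def liftStep (j : D.J) (c : ∀ k, E.gr (D.deg k)) : E.gr (D.deg j) :=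
  open Classical in
  if h : ∃ x : E.gr (D.deg j), E.d x =
      (D.gradedDesc v (fun k => (c k : E.carrier)) (fun k => (c k).2)).toAlgHom (D.bd j) ∧
      p.toAlgHom x = w.toAlgHom (PolyExt.gen X D.deg j) then h.choose else 0

/-- The values of a lift on generators. -/
noncomputable def liftGen (j : D.J) : E.gr (D.deg j) :=
  WellFounded.fix (measure D.deg).wf (C := fun j => E.gr (D.deg j))
    (fun j r => D.liftStep p v w j
      (fun k => if h : D.deg k < D.deg j then r k h else 0)) j

theorem liftGen_eq (j : D.J) : D.liftGen p v w j = D.liftStep p v w j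
    (fun k => if D.deg k < D.deg j then D.liftGen p v w k else 0) := by
  rw [liftGen, WellFounded.fix_eq]
  rfl

variable {p v w}

/-- Strong induction on the degree of the generator. Its boundary involves only generators of lower
degree, on which the values chosen so far already commute with `d` and with `p`; so the boundary
goes to a cocycle over the differential of the prescribed image, and `exists_lift` supplies the next
value. The default value 0 in `liftStep` is therefore never used. -/
theorem liftGen_spec (hp : IsTrivialFibration p) (hw : D.inclusion ≫ w = v ≫ p) (j : D.J) :
    E.d (D.liftGen p v w j) =
      (D.gradedDesc v (fun k => (D.liftGen p v w k : E.carrier))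
        (fun k => (D.liftGen p v w k).2)).toAlgHom (D.bd j) ∧
      p.toAlgHom (D.liftGen p v w j) = w.toAlgHom (PolyExt.gen X D.deg j) := by
  suffices H : ∀ n j, D.deg j = n → E.d (D.liftGen p v w j) =
      (D.gradedDesc v (fun k => (D.liftGen p v w k : E.carrier))
        (fun k => (D.liftGen p v w k).2)).toAlgHom (D.bd j) ∧
      p.toAlgHom (D.liftGen p v w j) = w.toAlgHom (PolyExt.gen X D.deg j) from H _ j rfl
  clear j
  intro n
  induction n using Nat.strong_induction_on with
  | _ n ih =>
  intro j hj
  set c := D.liftGen p v w with hc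
  set ψ := D.gradedDesc v (fun k => (c k : E.carrier)) (fun k => (c k).2) with hψ
  have hincl : ∀ x, ψ.toAlgHom (PolyExt.incl X D.deg x) = v.toAlgHom x :=
    PolyExt.liftHom_incl _ _ _
  have hgen : ∀ k, ψ.toAlgHom (PolyExt.gen X D.deg k) = c k := PolyExt.liftHom_gen _ _ _
  -- compatibility with `p` in degrees below `n`
  have h1 : ∀ m, m < n → ∀ t ∈ PolyExt.gr X D.deg m, p.toAlgHom (ψ.toAlgHom t) = w.toAlgHom t := by
    intro m hm t ht
    refine PolyExt.hom_congr_le (f := GCAlg.Hom.comp (CDGA.Hom.toHom p) ψ) (g := CDGA.Hom.toHom w)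
      m ?_ ?_ le_rfl ht
    · intro x
      refine (congrArg p.toAlgHom (hincl x)).trans ?_
      exact (CDGA.congr_toAlgHom hw x).symm
    · intro k hk
      refine (congrArg p.toAlgHom (hgen k)).trans ?_
      exact (ih (D.deg k) (by omega) k rfl).2
  have h2 : ∀ m, m < n → ∀ t ∈ PolyExt.gr X D.deg m, ψ.toAlgHom (D.d t) = E.d (ψ.toAlgHom t) := by
    intro m hm t ht
    refine PolyExt.homogeneous_induction_le m (fun _ => LinearMap.eqLocus
      (ψ.toAlgHom.toLinearMap ∘ₗ D.d) (E.d ∘ₗ ψ.toAlgHom.toLinearMap)) ?_ ?_ ?_ le_rfl ht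
    · intro _ x _
      change ψ.toAlgHom (D.d _) = E.d (ψ.toAlgHom _)
      rw [D.d_incl, hincl, hincl]; exact v.map_d x
    · intro k hk
      change ψ.toAlgHom (D.d _) = E.d (ψ.toAlgHom _)
      rw [D.d_gen, hgen]
      exact (ih (D.deg k) (by omega) k rfl).1.symm
    · intro k l x _ y _ hx hy
      change ψ.toAlgHom (D.d _) = E.d (ψ.toAlgHom _)
      have hx : ψ.toAlgHom (D.d x) = E.d (ψ.toAlgHom x) := hx
      have hy : ψ.toAlgHom (D.d y) = E.d (ψ.toAlgHom y) := hy
      rw [D.d_mul, map_add, map_mul, map_mul, map_mul, E.d_mul, hx, hy, ψ.map_sign]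
  -- The recursion only sees generators of degree below `deg j`, the others being replaced by 0.
  -- This does not affect the boundary, which has index `deg j - 1`.
  have h3 : ψ.toAlgHom (D.bd j) = (D.gradedDesc v
      (fun k => ((if D.deg k < D.deg j then c k else 0 : E.gr (D.deg k)) : E.carrier))
        (fun k => (if D.deg k < D.deg j then c k else 0).2)).toAlgHom (D.bd j) := by
    by_cases h0 : D.deg j = 0
    · rw [D.bd_zero j h0, map_zero, map_zero]
    · refine PolyExt.hom_congr_le (D.deg j - 1) ?_ ?_ le_rfl (D.bd_mem j)
      · intro x; rw [hincl, PolyExt.liftHom_incl]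
      · intro k hk
        rw [hgen, PolyExt.liftHom_gen, if_pos (by omega)]
  have hex : ∃ x : E.gr (D.deg j), E.d x = (D.gradedDesc v
      (fun k => ((if D.deg k < D.deg j then c k else 0 : E.gr (D.deg k)) : E.carrier))
        (fun k => (if D.deg k < D.deg j then c k else 0).2)).toAlgHom (D.bd j) ∧
      p.toAlgHom x = w.toAlgHom (PolyExt.gen X D.deg j) := by
    rw [← h3]
    have hcl : E.d (ψ.toAlgHom (D.bd j)) = 0 ∧
        p.toAlgHom (ψ.toAlgHom (D.bd j)) = w.toAlgHom (D.bd j) := by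
      by_cases h0 : D.deg j = 0
      · rw [D.bd_zero j h0]; simp
      · refine ⟨?_, h1 (D.deg j - 1) (by omega) _ (D.bd_mem j)⟩
        rw [← h2 (D.deg j - 1) (by omega) _ (D.bd_mem j), D.closed, map_zero]
    obtain ⟨x, hx, hdx, hpx⟩ := hp.exists_lift (n := D.deg j) (z := ψ.toAlgHom (D.bd j))
      (b := w.toAlgHom (PolyExt.gen X D.deg j)) (ψ.map_gr (D.bd_mem j))
      (fun h0 => by rw [D.bd_zero j h0, map_zero]) hcl.1 (w.map_gr (PolyExt.gen_mem j)) (by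
        rw [hcl.2]
        refine Eq.trans ?_ (w.map_d _)
        exact congrArg w.toAlgHom (D.d_gen j).symm)
    exact ⟨⟨x, hx⟩, hdx, hpx⟩
  have h4 : c j = hex.choose := (D.liftGen_eq p v w j).trans (dif_pos hex)
  rw [h3, h4]
  exact hex.choose_spec

end Lift

/-- Semifree extensions have the left lifting property with respect to trivial fibrations. -/
theorem hasLiftingProperty {E F : CDGA K} {p : E ⟶ F} (hp : IsTrivialFibration p) :
    HasLiftingProperty D.inclusion p where
  sq_hasLift {v w} sq := by
    have h := D.liftGen_spec hp sq.w.symm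
    refine ⟨⟨⟨D.desc v (fun j => (D.liftGen p v w j : E.carrier)) (fun j => (D.liftGen p v w j).2)
      (fun j => (h j).1), inclusion_desc D _, ?_⟩⟩⟩
    refine hom_ext ?_ fun j => ?_
    · rw [← Category.assoc, inclusion_desc, sq.w]
    · rw [comp_toAlgHom, desc_gen]
      exact (h j).2

end Semifree

namespace CDGA

variable {K : Type u} [Field K]

/-- Every semifree extension is isomorphic to a standard one. -/
theorem IsSemifreeExtension.exists_semifree {A B : CDGA K} {f : A ⟶ B}
    (hf : IsSemifreeExtension f) : ∃ (D : Semifree A) (e : D.ext ⟶ B) (e' : B ⟶ D.ext),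
      D.inclusion ≫ e = f ∧ f ≫ e' = D.inclusion ∧ e' ≫ e = 𝟙 B := by
  obtain ⟨I, deg, x, hx, huniv⟩ := hf
  let Φ : GCAlg.Hom (PolyExt A deg) B.toGCAlg := PolyExt.liftHom (CDGA.Hom.toHom f) x hx
  have Φi : ∀ a, Φ.toAlgHom (PolyExt.incl A deg a) = f.toAlgHom a := PolyExt.liftHom_incl _ _ _
  have Φg : ∀ i, Φ.toAlgHom (PolyExt.gen A deg i) = x i := PolyExt.liftHom_gen _ _ _
  -- Both algebras are free over `A` on the same generators, so `Φ` and `Ψ` are inverse graded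
  -- isomorphisms. The differential of `B` is transported along `Ψ` to define the boundaries of the
  -- standard extension.
  obtain ⟨Ψ, ⟨hΨ1, hΨ2⟩, -⟩ := huniv (PolyExt A deg) (PolyExt.inclHom A deg) (PolyExt.gen A deg)
    PolyExt.gen_mem
  have hΦΨ : ∀ b, Φ.toAlgHom (Ψ.toAlgHom b) = b := by
    obtain ⟨θ, -, hθ⟩ := huniv B.toGCAlg (CDGA.Hom.toHom f) x hx
    have h1 := hθ (Φ.comp Ψ) ⟨fun a => (congrArg Φ.toAlgHom (hΨ1 a)).trans (Φi a),
      fun i => (congrArg Φ.toAlgHom (hΨ2 i)).trans (Φg i)⟩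
    have h2 := hθ (GCAlg.Hom.id _) ⟨fun a => rfl, fun i => rfl⟩
    exact fun b => congrArg (fun g : GCAlg.Hom B.toGCAlg B.toGCAlg => g.toAlgHom b)
      (h1.trans h2.symm)
  have hΨΦ : ∀ t, Ψ.toAlgHom (Φ.toAlgHom t) = t := by
    have : Ψ.comp Φ = GCAlg.Hom.id (PolyExt A deg) := PolyExt.hom_ext
      (fun a => (congrArg Ψ.toAlgHom (Φi a)).trans (hΨ1 a))
      (fun i => (congrArg Ψ.toAlgHom (Φg i)).trans (hΨ2 i))
    exact fun t => congrArg (fun g : GCAlg.Hom (PolyExt A deg) (PolyExt A deg) => g.toAlgHom t) this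
  let P : PreSemifree A :=
    { J := I, deg := deg, bd := fun i => Ψ.toAlgHom (B.d (x i))
      bd_mem := fun i => Ψ.map_gr (by
        rcases h : deg i with _ | n
        · rw [B.d_zero (h ▸ hx i)]; exact zero_mem _
        · exact B.d_mem (h ▸ hx i))
      bd_zero := fun i h => by rw [B.d_zero (h ▸ hx i), map_zero] }
  have hd : ∀ t, Φ.toAlgHom (P.d t) = B.d (Φ.toAlgHom t) :=
    PolyExt.intertwine Φ P.d_mul B.d_mul
      (fun a => by
        rw [Φi, ← f.map_d, ← Φi]
        exact congrArg Φ.toAlgHom (P.d_incl a))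
      (fun i => by
        rw [Φg]
        exact (congrArg Φ.toAlgHom (P.d_gen i)).trans (hΦΨ _))
  let D : Semifree A :=
    { toPreSemifree := P
      closed := fun i => by
        rw [← hΨΦ (P.d (P.bd i)), hd]
        have : Φ.toAlgHom (P.bd i) = B.d (x i) := hΦΨ _
        rw [this, B.d_d, map_zero] }
  refine ⟨D, CDGA.Hom.mk Φ hd, CDGA.Hom.mk Ψ (fun b => ?_), hom_ext Φi, hom_ext hΨ1, hom_ext hΦΨ⟩
  change Ψ.toAlgHom (B.d b) = P.d (Ψ.toAlgHom b)
  conv_lhs => rw [← hΦΨ b, ← hd, hΨΦ]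

/-- Cofibrations have the left lifting property with respect to trivial fibrations. -/
theorem IsCofibration.hasLiftingProperty {A B E F : CDGA K} {f : A ⟶ B} (hf : IsCofibration f)
    {p : E ⟶ F} (hp : IsTrivialFibration p) : HasLiftingProperty f p := by
  obtain ⟨A', B', g, hg, ⟨r⟩⟩ := hf
  obtain ⟨D, e, e', h1, h2, h3⟩ := hg.exists_semifree
  have := D.hasLiftingProperty hp
  let r' : RetractArrow g D.inclusion :=
    { i := Arrow.homMk (u := 𝟙 A') (v := e') (by simpa using h2.symm)
      r := Arrow.homMk (u := 𝟙 A') (v := e) (by simpa using h1.symm)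
      retract := by
        ext1
        · exact Category.comp_id _
        · exact h3 }
  have hg' : HasLiftingProperty g p := r'.leftLiftingProperty p
  exact r.leftLiftingProperty p

end CDGA

/-! ### Contractions and extensions by acyclic pairs of generators -/

open CDGA

namespace CDGA

theorem d_sign {K : Type u} [Field K] (A : CDGA K) (t : A.carrier) :
    A.d (A.sign t) = - A.sign (A.d t) := by
  have : A.d ∘ₗ A.sign.toLinearMap = - (A.sign.toLinearMap ∘ₗ A.d) := by
    refine linearMap_ext_homogeneous (gr := A.gr) fun n t ht => ?_
    change A.d (A.sign t) = - A.sign (A.d t)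
    rw [A.sign_of_mem ht, map_smul]
    rcases n with _ | n
    · rw [A.d_zero ht]; simp
    · rw [A.sign_of_mem (A.d_mem ht), pow_succ, ← neg_smul]; simp
  exact LinearMap.congr_fun this t

end CDGA

namespace CDGA

/-- The inclusion in an extension generated by pairs `y i`, `z i = d (y i)` is a
quasi-isomorphism, in the presence of a derivation mapping `z i` to `y i`. -/
theorem isWeakEquiv_of_contraction {K : Type u} [Field K] [CharZero K] {X Y : CDGA K} {ι : X ⟶ Y}
    {r : Y ⟶ X} (r_incl : ∀ x, r.toAlgHom (ι.toAlgHom x) = x) (s : Y.carrier →ₗ[K] Y.carrier)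
    (s_mul : ∀ a b, s (a * b) = s a * b + Y.sign a * s b)
    (s_incl : ∀ x, s (ι.toAlgHom x) = 0) (s_mem : ∀ n, ∀ t ∈ Y.gr n, s t ∈ Y.gr (n + 1))
    {I : Type*} {y z : I → Y.carrier}
    (ind : ∀ {p : Y.carrier → Prop}, (∀ x, p (ι.toAlgHom x)) → (∀ i, p (y i)) → (∀ i, p (z i)) →
      (∀ a b, p a → p b → p (a + b)) → (∀ a b, p a → p b → p (a * b)) → ∀ t, p t)
    (dy : ∀ i, Y.d (y i) = z i) (s_y : ∀ i, s (y i) = 0) (s_z : ∀ i, s (z i) = y i)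
    (r_y : ∀ i, r.toAlgHom (y i) = 0) : IsWeakEquiv ι := by
  have dz : ∀ i, Y.d (z i) = 0 := fun i => by rw [← dy, Y.d_d]
  have s_sign : ∀ t, s (Y.sign t) = - Y.sign (s t) := by
    intro t
    have : s ∘ₗ Y.sign.toLinearMap = - (Y.sign.toLinearMap ∘ₗ s) := by
      refine linearMap_ext_homogeneous (gr := Y.gr) fun n t ht => ?_
      change s (Y.sign t) = - Y.sign (s t)
      rw [Y.sign_of_mem ht, map_smul, Y.sign_of_mem (s_mem n t ht), pow_succ, ← neg_smul]; simp
    exact LinearMap.congr_fun this t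
  have d_sign : ∀ t, Y.d (Y.sign t) = - Y.sign (Y.d t) := Y.d_sign
  -- The operator `d s + s d` is an even derivation that vanishes on `X` and fixes every `y i` and
  -- `z i`: it is the Euler operator counting the added generators.
  let N : Module.End K Y.carrier := Y.d ∘ₗ s + s ∘ₗ Y.d
  have N_def : ∀ t, N t = Y.d (s t) + s (Y.d t) := fun _ => rfl
  have N_mul : ∀ a b, N (a * b) = N a * b + a * N b := by
    intro a b
    rw [N_def, s_mul, Y.d_mul, map_add, map_add, Y.d_mul, Y.d_mul, s_mul, s_mul, d_sign, s_sign,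
      Y.sign_sign, N_def, N_def]
    simp only [neg_mul, add_mul, mul_add]
    abel
  have N_incl : ∀ x, N (ι.toAlgHom x) = 0 := by
    intro x
    rw [N_def, s_incl, ← ι.map_d, s_incl]; simp
  have N_y : ∀ i, N (y i) = y i := by
    intro i
    rw [N_def, dy, s_y, s_z, map_zero, zero_add]
  have N_z : ∀ i, N (z i) = z i := by
    intro i
    rw [N_def, dz, s_z, map_zero, add_zero]; exact dy i
  have N_d : ∀ t, Y.d (N t) = N (Y.d t) := by
    intro t
    rw [N_def, N_def, map_add, Y.d_d, Y.d_d, map_zero, add_zero, zero_add]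
  have N_mem : ∀ n, ∀ t ∈ Y.gr n, N t ∈ Y.gr n := by
    intro n t ht
    refine add_mem (Y.d_mem (s_mem n t ht)) ?_
    rcases n with _ | n
    · rw [LinearMap.comp_apply, Y.d_zero ht, map_zero]; exact zero_mem _
    · exact s_mem n _ (Y.d_mem ht)
  have r_z : ∀ i, r.toAlgHom (z i) = 0 := fun i => by rw [← dy, r.map_d, r_y, map_zero]
  let E : ℕ → Submodule K Y.carrier := fun k => LinearMap.ker (N - (k : K) • LinearMap.id)
  have hE : ∀ k u, u ∈ E k ↔ N u = (k : K) • u := fun k u => by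
    rw [LinearMap.mem_ker, LinearMap.sub_apply, sub_eq_zero]; rfl
  -- `U` is the sum of the eigenspaces for positive integers. It is closed under products and under
  -- multiplication by `X`, so every element is one of `X` plus one of `U`.
  let U : Submodule K Y.carrier := ⨆ k, E (k + 1)
  have hU : ∀ k, E (k + 1) ≤ U := fun k => le_iSup (fun k => E (k + 1)) k
  have split : ∀ t, ∃ x, t - ι.toAlgHom x ∈ U := by
    have incl_U : ∀ x, ∀ u ∈ U, ι.toAlgHom x * u ∈ U ∧ u * ι.toAlgHom x ∈ U := by
      intro x u hu
      induction hu using Submodule.iSup_induction' with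
      | zero => rw [zero_mul, mul_zero]; exact ⟨zero_mem _, zero_mem _⟩
      | add a b _ _ ha hb =>
        rw [mul_add, add_mul]; exact ⟨add_mem ha.1 hb.1, add_mem ha.2 hb.2⟩
      | mem k u hu =>
        rw [hE] at hu
        refine ⟨hU k ((hE _ _).2 ?_), hU k ((hE _ _).2 ?_)⟩
        · rw [N_mul, N_incl, zero_mul, zero_add, hu, mul_smul_comm]
        · rw [N_mul, N_incl, mul_zero, add_zero, hu, smul_mul_assoc]
    have U_U : ∀ u ∈ U, ∀ v ∈ U, u * v ∈ U := by
      intro u hu v hv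
      induction hu using Submodule.iSup_induction' with
      | zero => rw [zero_mul]; exact zero_mem _
      | add a b _ _ ha hb => rw [add_mul]; exact add_mem ha hb
      | mem k u hu =>
        induction hv using Submodule.iSup_induction' with
        | zero => rw [mul_zero]; exact zero_mem _
        | add a b _ _ ha hb => rw [mul_add]; exact add_mem ha hb
        | mem l v hv =>
          rw [hE] at hu hv
          refine hU (k + 1 + l) ((hE _ _).2 ?_)
          rw [N_mul, hu, hv, smul_mul_assoc, mul_smul_comm, ← add_smul]
          push_cast
          congr 1
          ring
    intro t
    refine ind (p := fun t => ∃ x, t - ι.toAlgHom x ∈ U) ?_ ?_ ?_ ?_ ?_ t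
    · exact fun x => ⟨x, by rw [sub_self]; exact zero_mem _⟩
    · exact fun i => ⟨0, hU 0 ((hE _ _).2 (by rw [map_zero, sub_zero, N_y]; simp))⟩
    · exact fun i => ⟨0, hU 0 ((hE _ _).2 (by rw [map_zero, sub_zero, N_z]; simp))⟩
    · rintro a b ⟨x, hx⟩ ⟨x', hx'⟩
      refine ⟨x + x', ?_⟩
      rw [map_add, add_sub_add_comm]
      exact add_mem hx hx'
    · rintro a b ⟨x, hx⟩ ⟨x', hx'⟩
      refine ⟨x * x', ?_⟩
      have e : a * b - ι.toAlgHom (x * x') = (a - ι.toAlgHom x) * (b - ι.toAlgHom x') +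
          (ι.toAlgHom x * (b - ι.toAlgHom x') + (a - ι.toAlgHom x) * ι.toAlgHom x') := by
        rw [map_mul]; noncomm_ring
      rw [e]
      exact add_mem (U_U _ hx _ hx') (add_mem (incl_U _ _ hx').1 (incl_U _ _ hx).2)
  have r_N : ∀ t, r.toAlgHom (N t) = 0 := by
    refine ind ?_ ?_ ?_ ?_ ?_
    · intro x; rw [N_incl, map_zero]
    · intro i; rw [N_y, r_y]
    · intro i; rw [N_z, r_z]
    · intro a b ha hb; rw [map_add, map_add, ha, hb, add_zero]
    · intro a b ha hb; rw [N_mul, map_add, map_mul, map_mul, ha, hb, zero_mul, mul_zero, add_zero]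
  -- The retraction kills the image of `N`, and on `U` the eigenvalues are nonzero in `K` by
  -- characteristic zero. So the complement of `X` found above is exactly what `r` discards.
  have r_U : ∀ u ∈ U, r.toAlgHom u = 0 := by
    intro u hu
    induction hu using Submodule.iSup_induction' with
    | zero => exact map_zero _
    | add a b _ _ ha hb => rw [map_add, ha, hb, add_zero]
    | mem k u hu =>
      rw [hE] at hu
      have h := r_N u
      rw [hu, map_smul] at h
      exact (smul_eq_zero.1 h).resolve_left (Nat.cast_ne_zero.2 k.succ_ne_zero)
  have split' : ∀ t, t - ι.toAlgHom (r.toAlgHom t) ∈ U := by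
    intro t
    obtain ⟨x, hx⟩ := split t
    have h := r_U _ hx
    rw [map_sub, r_incl, sub_eq_zero] at h
    rwa [h]
  -- A product of factors `X - (k + 1)` annihilates `u` and does not vanish at 0. This makes `N`
  -- invertible on `U` by polynomials in `N`, without separating the eigencomponents of `u`.
  have poly : ∀ u ∈ U, ∃ p : Polynomial K, p.eval 0 ≠ 0 ∧ Polynomial.aeval N p u = 0 := by
    intro u hu
    induction hu using Submodule.iSup_induction' with
    | zero => exact ⟨1, by simp, map_zero _⟩
    | add a b _ _ ha hb =>
      obtain ⟨p, hp, hpa⟩ := ha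
      obtain ⟨q, hq, hqb⟩ := hb
      refine ⟨p * q, by rw [Polynomial.eval_mul]; exact mul_ne_zero hp hq, ?_⟩
      have h1 : Polynomial.aeval N (p * q) a = 0 := by
        rw [mul_comm, map_mul, Module.End.mul_apply, hpa, map_zero]
      have h2 : Polynomial.aeval N (p * q) b = 0 := by
        rw [map_mul, Module.End.mul_apply, hqb, map_zero]
      rw [map_add, h1, h2, add_zero]
    | mem k u hu =>
      rw [hE] at hu
      refine ⟨Polynomial.X - Polynomial.C ((k + 1 : ℕ) : K), ?_, ?_⟩
      · rw [Polynomial.eval_sub, Polynomial.eval_X, Polynomial.eval_C, zero_sub]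
        exact neg_ne_zero.2 (Nat.cast_ne_zero.2 k.succ_ne_zero)
      · rw [map_sub, Polynomial.aeval_X, Polynomial.aeval_C, LinearMap.sub_apply, hu,
          Module.algebraMap_end_apply, sub_self]
  have p_mem : ∀ (q : Polynomial K) n, ∀ t ∈ Y.gr n, Polynomial.aeval N q t ∈ Y.gr n := by
    intro q n t ht
    induction q using Polynomial.induction_on' with
    | add p q hp hq => rw [map_add]; exact add_mem hp hq
    | monomial k c =>
      rw [Polynomial.aeval_monomial, Module.End.mul_apply, Module.algebraMap_end_apply]
      refine Submodule.smul_mem _ _ ?_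
      induction k with
      | zero => exact ht
      | succ k ih => rw [pow_succ', Module.End.mul_apply]; exact N_mem _ _ ih
  have p_d : ∀ (q : Polynomial K) t, Y.d (Polynomial.aeval N q t) =
      Polynomial.aeval N q (Y.d t) := by
    intro q t
    induction q using Polynomial.induction_on' with
    | add p q hp hq => simp only [map_add, LinearMap.add_apply, hp, hq]
    | monomial k c =>
      rw [Polynomial.aeval_monomial, Module.End.mul_apply, Module.algebraMap_end_apply,
        Module.End.mul_apply, Module.algebraMap_end_apply, map_smul]
      congr 1
      induction k with
      | zero => rfl
      | succ k ih => rw [pow_succ', Module.End.mul_apply, Module.End.mul_apply, N_d, ih]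
  have exact' : ∀ n, ∀ u ∈ Y.gr n, u ∈ U → Y.d u = 0 → ∃ h ∈ Y.gr (n + 1), Y.d h = u := by
    intro n u hn hu du
    obtain ⟨p, hp, hpu⟩ := poly u hu
    have e : Polynomial.X * p.divX + Polynomial.C (p.eval 0) = p := by
      rw [mul_comm, ← Polynomial.coeff_zero_eq_eval_zero]
      exact Polynomial.divX_mul_X_add p
    rw [← e, map_add, map_mul, Polynomial.aeval_X, Polynomial.aeval_C, LinearMap.add_apply,
      Module.algebraMap_end_apply, Module.End.mul_apply] at hpu
    -- Writing `p = X * p.divX + p(0)`, the relation `p(N) u = 0` becomes `N v = u`. Since `N`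
    -- commutes with `d`, `v` is a cocycle, and so `N v = d (s v)`.
    let v := -(p.eval 0)⁻¹ • Polynomial.aeval N p.divX u
    have hv : v ∈ Y.gr n := Submodule.smul_mem _ _ (p_mem _ _ _ hn)
    have dv : Y.d v = 0 := by rw [map_smul, p_d, du, map_zero, smul_zero]
    refine ⟨s v, s_mem _ _ hv, ?_⟩
    have h1 : N v = Y.d (s v) := by rw [N_def, dv, map_zero, add_zero]
    rw [← h1, map_smul, eq_neg_of_add_eq_zero_left hpu, neg_smul, smul_neg, neg_neg, smul_smul,
      inv_mul_cancel₀ hp, one_smul]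
  refine (DGVect.Hom.isQuasiIso_iff _).2 ⟨?_, ?_⟩
  · intro n x hx dx u hu hux
    refine ⟨r.toAlgHom u, r.map_gr hu, ?_⟩
    have : r.toAlgHom (Y.d u) = r.toAlgHom (ι.toAlgHom x) := congrArg r.toAlgHom hux
    rw [r_incl] at this
    rw [← this]
    exact (r.map_d u).symm
  · intro n u hu du
    have du' : Y.d u = 0 := du
    have hr : X.d (r.toAlgHom u) = 0 := by rw [← r.map_d, du', map_zero]
    obtain ⟨h, hh, dh⟩ := exact' n (u - ι.toAlgHom (r.toAlgHom u))
      (sub_mem hu (ι.map_gr (r.map_gr hu))) (split' u)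
      (by rw [map_sub, du', ← ι.map_d, hr, map_zero, sub_zero])
    refine ⟨r.toAlgHom u, r.map_gr hu, hr, -h, neg_mem hh, ?_⟩
    change ι.toAlgHom (r.toAlgHom u) = u + Y.d (-h)
    rw [map_neg, dh]; abel

end CDGA

namespace Semifree

variable {K : Type u} [Field K] (X : CDGA K) {I : Type u} (dg : I → ℕ)

/-- Degrees of the generators `y i`, `z i` of `X[y i, z i | d (y i) = z i]`. -/
def diskDeg : I ⊕ I → ℕ := Sum.elim (fun i => dg i + 1) dg

/-- The semifree extension `X[y i, z i | d (y i) = z i]`. -/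
noncomputable def preDisk : PreSemifree X where
  J := I ⊕ I
  deg := diskDeg dg
  bd := Sum.elim (fun i => PolyExt.gen X (diskDeg dg) (Sum.inr i)) (fun _ => 0)
  bd_mem := by
    rintro (i | i)
    · exact PolyExt.gen_mem (X := X) (deg := diskDeg dg) (Sum.inr i)
    · exact zero_mem _
  bd_zero := by
    rintro (i | i) h
    · exact absurd h (Nat.succ_ne_zero _)
    · rfl

/-- The semifree extension `X[y i, z i | d (y i) = z i]`. -/
noncomputable def disk : Semifree X where
  toPreSemifree := preDisk X dg
  closed := by
    rintro (i | i)
    · exact (preDisk X dg).d_gen (Sum.inr i)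
    · exact map_zero _

variable {X}

variable (X) in
/-- The generators `y i`. -/
noncomputable def diskY (i : I) : (disk X dg).ext.carrier :=
  PolyExt.gen X (diskDeg dg) (Sum.inl i)

variable (X) in
/-- The generators `z i`. -/
noncomputable def diskZ (i : I) : (disk X dg).ext.carrier :=
  PolyExt.gen X (diskDeg dg) (Sum.inr i)

theorem diskY_mem (i : I) : diskY X dg i ∈ (disk X dg).ext.gr (dg i + 1) :=
  PolyExt.gen_mem (X := X) (deg := diskDeg dg) (Sum.inl i)

theorem d_diskY (i : I) : (disk X dg).ext.d (diskY X dg i) = diskZ X dg i :=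
  (disk X dg).d_gen (Sum.inl i)

theorem disk_induction {p : (disk X dg).ext.carrier → Prop}
    (h1 : ∀ x, p ((disk X dg).inclusion.toAlgHom x)) (h2 : ∀ i, p (diskY X dg i))
    (h3 : ∀ i, p (diskZ X dg i)) (h4 : ∀ a b, p a → p b → p (a + b))
    (h5 : ∀ a b, p a → p b → p (a * b)) (t) : p t :=
  PolyExt.induction h1 (by rintro (i | i); exacts [h2 i, h3 i]) h4 h5 t

variable {dg}

section Desc

variable {E : CDGA K} (v : X ⟶ E) (y : I → E.carrier) (hy : ∀ i, y i ∈ E.gr (dg i + 1))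

theorem diskDesc_aux {E : CDGA K} (y : I → E.carrier) (hy : ∀ i, y i ∈ E.gr (dg i + 1)) (j : I ⊕ I) :
    Sum.elim y (fun i => E.d (y i)) j ∈ E.gr (diskDeg dg j) := by
  rcases j with i | i
  · exact hy i
  · exact E.d_mem (hy i)

/-- The universal property of `X[y i, z i | d (y i) = z i]`. -/
noncomputable def diskDesc : (disk X dg).ext ⟶ E :=
  (disk X dg).desc v (Sum.elim y (fun i => E.d (y i))) (diskDesc_aux y hy)
    (by
      rintro (i | i)
      · exact (PolyExt.liftHom_gen (CDGA.Hom.toHom v) (Sum.elim y (fun i => E.d (y i)))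
          (diskDesc_aux y hy) (Sum.inr i)).symm
      · exact (E.d_d _).trans (map_zero _).symm)

theorem inclusion_diskDesc : (disk X dg).inclusion ≫ diskDesc v y hy = v := inclusion_desc _ _

theorem diskDesc_diskY (i : I) : (diskDesc v y hy).toAlgHom (diskY X dg i) = y i :=
  desc_gen (disk X dg) _ (Sum.inl i)

variable {v y hy}

theorem disk_hom_ext {f g : (disk X dg).ext ⟶ E}
    (h : (disk X dg).inclusion ≫ f = (disk X dg).inclusion ≫ g)
    (h' : ∀ i, f.toAlgHom (diskY X dg i) = g.toAlgHom (diskY X dg i)) : f = g := by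
  refine hom_ext h ?_
  rintro (i | i)
  · exact h' i
  · change f.toAlgHom (diskZ X dg i) = g.toAlgHom (diskZ X dg i)
    rw [← d_diskY, f.map_d, g.map_d, h' i]

end Desc

variable (X dg) in
-- Morphisms out of the extension are free on the `y i`, which have strictly negative degree. A lift
-- needs only preimages of their images, and these exist because `p` is a fibration.
theorem disk_hasLiftingProperty {E F : CDGA K} {p : E ⟶ F} (hp : IsFibration p) :
    HasLiftingProperty (disk X dg).inclusion p where
  sq_hasLift {v w} sq := by
    have h : ∀ i, ∃ x ∈ E.gr (dg i + 1), p.toAlgHom x = w.toAlgHom (diskY X dg i) := fun i =>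
      hp _ (Nat.succ_pos _) _ (w.map_gr (diskY_mem dg i))
    choose y hy hpy using h
    refine ⟨⟨⟨diskDesc v y hy, inclusion_diskDesc v y hy, ?_⟩⟩⟩
    refine disk_hom_ext ?_ fun i => ?_
    · rw [← Category.assoc, inclusion_diskDesc, sq.w]
    · rw [comp_toAlgHom, diskDesc_diskY, hpy]

variable (X dg) in
-- The homotopy sending `z i` back to `y i` is an odd derivation, so it exists by
-- `exists_oddDerivation`. That construction controls only parities; the exact shift by one is
-- recovered by checking it on generators.
theorem exists_contraction : ∃ s : (disk X dg).ext.carrier →ₗ[K] (disk X dg).ext.carrier,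
    (∀ a b, s (a * b) = s a * b + (disk X dg).ext.sign a * s b) ∧
      (∀ x, s ((disk X dg).inclusion.toAlgHom x) = 0) ∧
      (∀ i, s (diskY X dg i) = 0) ∧ (∀ i, s (diskZ X dg i) = diskY X dg i) ∧
      ∀ n, ∀ t ∈ (disk X dg).ext.gr n, s t ∈ (disk X dg).ext.gr (n + 1) := by
  obtain ⟨s, h1, h2, h3⟩ := PolyExt.exists_oddDerivation (X := X) (deg := diskDeg dg) 0
    (fun _ _ => by simp) (fun m _ _ => ⟨m + 1, rfl, zero_mem _⟩)
    (Sum.elim (fun _ => 0) (fun i => diskY X dg i)) (by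
      rintro (i | i)
      · exact ⟨_, rfl, zero_mem _⟩
      · exact ⟨_, rfl, PolyExt.gen_mem (X := X) (deg := diskDeg dg) (Sum.inl i)⟩)
  refine ⟨s, h1, fun x => (h2 x).trans (map_zero _), fun i => h3 (Sum.inl i),
    fun i => h3 (Sum.inr i), fun n t ht => ?_⟩
  refine PolyExt.homogeneous_induction (X := X) (deg := diskDeg dg)
    (fun n => ((PolyExt X (diskDeg dg)).gr (n + 1)).comap s) ?_ ?_ ?_ ht
  · intro n x _
    rw [Submodule.mem_comap, h2, LinearMap.zero_apply, map_zero]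
    exact zero_mem _
  · rintro (i | i)
    · rw [Submodule.mem_comap, h3]; exact zero_mem _
    · rw [Submodule.mem_comap, h3]
      exact diskY_mem dg i
  · intro k l a ha b hb hka hlb
    rw [Submodule.mem_comap] at *
    rw [h1]
    refine add_mem ?_ ?_
    · have := (PolyExt X (diskDeg dg)).mul_mem hka hb
      rwa [show k + 1 + l = k + l + 1 by ring] at this
    · have := (PolyExt X (diskDeg dg)).mul_mem ((PolyExt X (diskDeg dg)).sign_mem ha) hlb
      rwa [← add_assoc] at this

variable (X dg) in
theorem disk_isWeakEquiv [CharZero K] : IsWeakEquiv (disk X dg).inclusion := by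
  obtain ⟨s, s_mul, s_incl, s_y, s_z, s_mem⟩ := exists_contraction X dg
  have h0 : ∀ i, (0 : X.carrier) ∈ X.gr (dg i + 1) := fun _ => zero_mem _
  exact isWeakEquiv_of_contraction (r := diskDesc (𝟙 X) (fun _ => 0) h0)
    (CDGA.congr_toAlgHom (inclusion_diskDesc _ _ h0)) s s_mul s_incl s_mem
    (disk_induction dg) (d_diskY dg) s_y s_z (diskDesc_diskY _ _ h0)

/-- Every morphism factors as an inclusion in a disk extension followed by a fibration. -/
theorem exists_fibration_factorization {Y : CDGA K} (f : X ⟶ Y) :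
    ∃ (I : Type u) (dg : I → ℕ) (q : (disk X dg).ext ⟶ Y),
      (disk X dg).inclusion ≫ q = f ∧ IsFibration q := by
  -- One pair of generators for each homogeneous element of strictly negative degree, with `y`
  -- mapped to that element.
  let I := Σ n, Y.gr (n + 1)
  let dg : I → ℕ := fun i => i.1
  let y : I → Y.carrier := fun i => i.2
  have hy : ∀ i, y i ∈ Y.gr (dg i + 1) := fun i => i.2.2
  refine ⟨I, dg, diskDesc f y hy, inclusion_diskDesc f y hy, fun n hn t ht => ?_⟩
  obtain ⟨n, rfl⟩ : ∃ m, n = m + 1 := ⟨n - 1, by omega⟩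
  let i : I := ⟨n, t, ht⟩
  exact ⟨diskY X dg i, diskY_mem dg i, diskDesc_diskY f y hy i⟩

end Semifree

/-! ### Acyclic semifree extensions and lifting against fibrations -/

namespace CDGA

variable {K : Type u} [Field K]

/-- The left lifting property with respect to all fibrations. -/
def LiftsFibrations {X Y : CDGA K} (f : X ⟶ Y) : Prop :=
  ∀ ⦃E F : CDGA K⦄ (p : E ⟶ F), IsFibration p → HasLiftingProperty f p

/-- The retract argument: a lift against the fibration in the factorization of `f` exhibits `f` as a
retract of the inclusion in a disk extension, which is a quasi-isomorphism. -/
theorem LiftsFibrations.isWeakEquiv [CharZero K] {X Y : CDGA K} {f : X ⟶ Y}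
    (hf : LiftsFibrations f) : IsWeakEquiv f := by
  obtain ⟨I, dg, q, hq, hfib⟩ := Semifree.exists_fibration_factorization f
  have := hf q hfib
  have sq : CommSq (Semifree.disk X dg).inclusion f q (𝟙 Y) := ⟨by rw [hq, Category.comp_id]⟩
  exact (Semifree.disk_isWeakEquiv X dg).of_retract
    { i := Arrow.homMk (u := 𝟙 X) (v := sq.lift) (by simp)
      r := Arrow.homMk (u := 𝟙 X) (v := q) (by simpa using hq.symm)
      retract := by
        ext1
        · exact Category.comp_id _
        · exact sq.fac_right }

end CDGA

/-- Semifree extensions that are quasi-isomorphisms lift against fibrations. -/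
theorem Semifree.liftsFibrations {K : Type u} [Field K] [CharZero K] {X : CDGA K}
    (D : Semifree X) (h : IsWeakEquiv D.inclusion) : LiftsFibrations D.inclusion := by
  intro E F p hp
  obtain ⟨I, dg, q, hq, hfib⟩ := exists_fibration_factorization D.inclusion
  -- By two out of three the fibration is trivial, so the semifree inclusion lifts against it. It is
  -- thereby a retract of the disk inclusion and inherits the lifting property of the latter.
  have hq' : IsTrivialFibration q :=
    ⟨hfib, (disk_isWeakEquiv X dg).of_comp_right (by rwa [hq])⟩
  have := D.hasLiftingProperty hq'
  have sq : CommSq (disk X dg).inclusion D.inclusion q (𝟙 D.ext) :=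
    ⟨by rw [hq, Category.comp_id]⟩
  let r : RetractArrow D.inclusion (disk X dg).inclusion :=
    { i := Arrow.homMk (u := 𝟙 X) (v := sq.lift) (by simp)
      r := Arrow.homMk (u := 𝟙 X) (v := q) (by simpa using hq.symm)
      retract := by
        ext1
        · exact Category.comp_id _
        · exact sq.fac_right }
  have := disk_hasLiftingProperty X dg hp
  exact r.leftLiftingProperty p

/-! ### Factorization into a semifree extension and a trivial fibration -/

/-- Formal polynomial expressions over `R` in generators attached to an expression `z`, the
intended differential, and an element `b` of `B`, the intended image. -/
inductive CycleTerm {K : Type u} [Field K] (R B : CDGA K) : Type u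
  | base (r : R.carrier) : CycleTerm R B
  | gen (n : ℕ) (z : CycleTerm R B) (b : B.carrier) : CycleTerm R B
  | add (s t : CycleTerm R B) : CycleTerm R B
  | mul (s t : CycleTerm R B) : CycleTerm R B

namespace CycleTerm

variable {K : Type u} [Field K] {R B : CDGA K}

variable (R B) in
/-- The degrees of the generators. -/
def deg (j : ℕ × CycleTerm R B × B.carrier) : ℕ := j.1

/-- The value of a formal expression. -/
noncomputable def eval : CycleTerm R B → PolyExt.Carrier R (deg R B)
  | base r => PolyExt.incl R (deg R B) r
  | gen n z b => PolyExt.gen R (deg R B) (n, z, b)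
  | add s t => eval s + eval t
  | mul s t => eval s * eval t

variable (R B) in
/-- The intended differentials of all generators. -/
noncomputable def preSemifree : PreSemifree R where
  J := ℕ × CycleTerm R B × B.carrier
  deg := deg R B
  -- The projection makes the boundary homogeneous for arbitrary labels. No closedness is asked
  -- here, so the resulting derivation need not square to zero; only the good generators below have
  -- closed boundaries.
  bd j := if j.1 = 0 then 0 else component (PolyExt.gr R (deg R B)) (j.1 - 1) (eval j.2.1)
  bd_mem j := by
    split_ifs
    · exact zero_mem _
    · exact component_mem _ _ _
  bd_zero j hj := if_pos hj

variable (g : R ⟶ B)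

/-- The intended map to `B`. -/
noncomputable def aug : GCAlg.Hom (PolyExt R (deg R B)) B.toGCAlg :=
  PolyExt.liftHom (CDGA.Hom.toHom g) (fun j => component B.gr j.1 j.2.2)
    (fun _ => component_mem _ _ _)

theorem aug_incl (r : R.carrier) :
    (aug g).toAlgHom (PolyExt.incl R (deg R B) r) = g.toAlgHom r :=
  PolyExt.liftHom_incl _ _ _ r

theorem aug_gen (j : ℕ × CycleTerm R B × B.carrier) :
    (aug g).toAlgHom (PolyExt.gen R (deg R B) j) = component B.gr j.1 j.2.2 :=
  PolyExt.liftHom_gen _ _ _ j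

/-- The expressions all of whose generators are attached to cycles with a null-homotopy of their
image. -/
inductive Good : CycleTerm R B → Prop
  | base (r : R.carrier) : Good (base r)
  | gen (n : ℕ) (z : CycleTerm R B) (b : B.carrier) (hz : Good z)
      (z_mem : eval z ∈ PolyExt.gr R (deg R B) (n - 1)) (z_zero : n = 0 → eval z = 0)
      (dz : (preSemifree R B).d (eval z) = 0) (hb : b ∈ B.gr n)
      (hzb : (aug g).toAlgHom (eval z) = B.d b) : Good (gen n z b)
  | add (s t : CycleTerm R B) : Good s → Good t → Good (add s t)
  | mul (s t : CycleTerm R B) : Good s → Good t → Good (mul s t)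

/-- The good generators. -/
def GoodGen : Type u := {j : ℕ × CycleTerm R B × B.carrier // Good g (gen j.1 j.2.1 j.2.2)}

/-- The degrees of the good generators. -/
def goodDeg (j : GoodGen g) : ℕ := j.1.1

/-- The extension by the good generators maps to the extension by all generators. -/
noncomputable def goodIncl : GCAlg.Hom (PolyExt R (goodDeg g)) (PolyExt R (deg R B)) :=
  PolyExt.liftHom (PolyExt.inclHom R (deg R B)) (fun j => PolyExt.gen R (deg R B) j.1)
    (fun j => PolyExt.gen_mem (X := R) (deg := deg R B) j.1)

theorem goodIncl_incl (r : R.carrier) : (goodIncl g).toAlgHom (PolyExt.incl R (goodDeg g) r) =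
    PolyExt.incl R (deg R B) r := PolyExt.liftHom_incl _ _ _ r

theorem goodIncl_gen (j : GoodGen g) : (goodIncl g).toAlgHom (PolyExt.gen R (goodDeg g) j) =
    PolyExt.gen R (deg R B) j.1 := PolyExt.liftHom_gen _ _ _ j

open Classical in
/-- The retraction that kills the other generators. -/
noncomputable def goodRetr : GCAlg.Hom (PolyExt R (deg R B)) (PolyExt R (goodDeg g)) :=
  PolyExt.liftHom (PolyExt.inclHom R (goodDeg g))
    (fun j => if h : Good g (gen j.1 j.2.1 j.2.2) then PolyExt.gen R (goodDeg g) ⟨j, h⟩ else 0)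
    (fun j => by
      by_cases h : Good g (gen j.1 j.2.1 j.2.2)
      · rw [dif_pos h]
        exact PolyExt.gen_mem (X := R) (deg := goodDeg g) ⟨j, h⟩
      · rw [dif_neg h]
        exact zero_mem _)

theorem goodRetr_incl (r : R.carrier) : (goodRetr g).toAlgHom (PolyExt.incl R (deg R B) r) =
    PolyExt.incl R (goodDeg g) r := PolyExt.liftHom_incl _ _ _ r

theorem goodRetr_gen (j : GoodGen g) : (goodRetr g).toAlgHom (PolyExt.gen R (deg R B) j.1) =
    PolyExt.gen R (goodDeg g) j := (PolyExt.liftHom_gen _ _ _ j.1).trans (dif_pos j.2)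

theorem goodRetr_goodIncl (t : PolyExt.Carrier R (goodDeg g)) :
    (goodRetr g).toAlgHom ((goodIncl g).toAlgHom t) = t := by
  have : (goodRetr g).comp (goodIncl g) = GCAlg.Hom.id _ := PolyExt.hom_ext
    (fun r => (congrArg (goodRetr g).toAlgHom (goodIncl_incl g r)).trans (goodRetr_incl g r))
    (fun j => (congrArg (goodRetr g).toAlgHom (goodIncl_gen g j)).trans (goodRetr_gen g j))
  exact congrArg (fun f : GCAlg.Hom (PolyExt R (goodDeg g)) (PolyExt R (goodDeg g)) =>
    f.toAlgHom t) this

theorem goodIncl_injective : Function.Injective (goodIncl g).toAlgHom :=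
  Function.LeftInverse.injective (goodRetr_goodIncl g)

variable {g}

/-- A good expression involves good generators only, so its value survives killing the others. This
is why boundaries of good generators stay within the extension that these generate. -/
theorem Good.goodIncl_goodRetr {z : CycleTerm R B} (hz : Good g z) :
    (goodIncl g).toAlgHom ((goodRetr g).toAlgHom (eval z)) = eval z := by
  induction hz with
  | base r => rw [eval, goodRetr_incl, goodIncl_incl]
  | add s t _ _ hs ht => rw [eval, map_add, map_add, hs, ht]
  | mul s t _ _ hs ht => rw [eval, map_mul, map_mul, hs, ht]
  | gen n z b hz z_mem z_zero dz hb hzb =>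
    let j : GoodGen g := ⟨(n, z, b), .gen n z b hz z_mem z_zero dz hb hzb⟩
    rw [eval]
    exact (congrArg _ (goodRetr_gen g j)).trans (goodIncl_gen g j)

/-- Good expressions are closed under sums and products, so every element of the good extension has
a name. Any cycle can therefore label a further generator of the same extension, and a single
inductive type replaces the iterated attachment of cells. -/
theorem exists_good (t : PolyExt.Carrier R (goodDeg g)) :
    ∃ z, Good g z ∧ eval z = (goodIncl g).toAlgHom t := by
  induction t using PolyExt.induction with
  | hincl r => exact ⟨base r, .base r, (goodIncl_incl g r).symm⟩
  | hgen j => exact ⟨gen j.1.1 j.1.2.1 j.1.2.2, j.2, (goodIncl_gen g j).symm⟩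
  | hadd s t hs ht =>
    obtain ⟨x, hx, hx'⟩ := hs
    obtain ⟨y, hy, hy'⟩ := ht
    exact ⟨add x y, hx.add _ _ hy, by rw [eval, hx', hy', map_add]⟩
  | hmul s t hs ht =>
    obtain ⟨x, hx, hx'⟩ := hs
    obtain ⟨y, hy, hy'⟩ := ht
    exact ⟨mul x y, hx.mul _ _ hy, by rw [eval, hx', hy', map_mul]⟩

/-- The homogeneity conditions in the constructor turn the projections in `preSemifree` and `aug`
into identities on good labels. -/
theorem good_bd {n : ℕ} {z : CycleTerm R B} {b : B.carrier} (h : Good g (gen n z b)) :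
    (preSemifree R B).bd (n, z, b) = eval z ∧
      (goodIncl g).toAlgHom ((goodRetr g).toAlgHom (eval z)) = eval z ∧
      (preSemifree R B).d (eval z) = 0 ∧ (aug g).toAlgHom (eval z) = B.d (component B.gr n b) := by
  cases h with
  | gen n z b hz z_mem z_zero dz hb hzb =>
  refine ⟨?_, hz.goodIncl_goodRetr, dz, by rw [component_of_mem hb, hzb]⟩
  change (if n = 0 then 0 else component (PolyExt.gr R (deg R B)) (n - 1) (eval z)) = eval z
  split_ifs with h
  · exact (z_zero h).symm
  · exact component_of_mem z_mem

variable (g) in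
/-- The differentials of the good generators. -/
noncomputable def goodPre : PreSemifree R where
  J := GoodGen g
  deg := goodDeg g
  bd j := (goodRetr g).toAlgHom ((preSemifree R B).bd j.1)
  bd_mem j := (goodRetr g).map_gr ((preSemifree R B).bd_mem j.1)
  bd_zero j hj := (congrArg (goodRetr g).toAlgHom ((preSemifree R B).bd_zero j.1 hj)).trans
    (map_zero (goodRetr g).toAlgHom)

theorem goodIncl_bd (j : GoodGen g) :
    (goodIncl g).toAlgHom ((goodPre g).bd j) = (preSemifree R B).bd j.1 := by
  obtain ⟨h1, h2, -, -⟩ := good_bd j.2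
  exact ((congrArg (fun t => (goodIncl g).toAlgHom ((goodRetr g).toAlgHom t)) h1).trans h2).trans
    h1.symm

theorem goodIncl_d (t : PolyExt.Carrier R (goodDeg g)) :
    (goodIncl g).toAlgHom ((goodPre g).d t) = (preSemifree R B).d ((goodIncl g).toAlgHom t) :=
  PolyExt.intertwine (goodIncl g) (goodPre g).d_mul (preSemifree R B).d_mul
    (fun r => (congrArg _ ((goodPre g).d_incl r)).trans ((goodIncl_incl g _).trans
      (((congrArg _ (goodIncl_incl g r)).trans ((preSemifree R B).d_incl r)).symm)))
    (fun j => (congrArg _ ((goodPre g).d_gen j)).trans ((goodIncl_bd j).trans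
      (((congrArg _ (goodIncl_gen g j)).trans ((preSemifree R B).d_gen j.1)).symm))) t

variable (g) in
/-- The semifree extension by the good generators. -/
noncomputable def goodSemifree : Semifree R where
  toPreSemifree := goodPre g
  closed j := by
    obtain ⟨h1, h2, h3, -⟩ := good_bd j.2
    apply goodIncl_injective g
    refine (goodIncl_d _).trans ?_
    refine (congrArg (preSemifree R B).d ((goodIncl_bd j).trans h1)).trans (h3.trans ?_)
    exact (map_zero (goodIncl g).toAlgHom).symm

variable (g) in
/-- The resolution of `g` by the good generators. -/
noncomputable def goodMap : (goodSemifree g).ext ⟶ B :=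
  CDGA.Hom.mk ((aug g).comp (goodIncl g)) (fun t => by
    refine PolyExt.intertwine ((aug g).comp (goodIncl g)) (goodPre g).d_mul B.d_mul ?_ ?_ t
    · intro r
      have h : ∀ r, ((aug g).comp (goodIncl g)).toAlgHom (PolyExt.incl R (goodDeg g) r) =
        g.toAlgHom r := fun r => (congrArg _ (goodIncl_incl g r)).trans (aug_incl g r)
      refine (congrArg _ ((goodPre g).d_incl r)).trans ?_
      refine (h _).trans ((g.map_d r).trans (congrArg B.d (h r).symm))
    · intro j
      obtain ⟨h1, h2, h3, h4⟩ := good_bd j.2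
      refine (congrArg _ ((goodPre g).d_gen j)).trans ?_
      refine (congrArg (aug g).toAlgHom (goodIncl_bd j)).trans ?_
      refine (congrArg (aug g).toAlgHom h1).trans (h4.trans (congrArg B.d ?_))
      exact ((congrArg (aug g).toAlgHom (goodIncl_gen g j)).trans (aug_gen g j.1)).symm)

end CycleTerm

open CDGA CycleTerm in
/-- Every morphism factors as a semifree extension followed by a trivial fibration. -/
theorem CDGA.exists_trivialFibration_factorization {K : Type u} [Field K] {R B : CDGA K}
    (g : R ⟶ B) : ∃ (D : Semifree R) (q : D.ext ⟶ B), D.inclusion ≫ q = g ∧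
      IsTrivialFibration q := by
  refine ⟨goodSemifree g, goodMap g, CDGA.hom_ext fun r => ?_,
    isTrivialFibration_of_exists_lift fun n t b ht ht0 dt hb htb => ?_⟩
  · exact (congrArg (aug g).toAlgHom (goodIncl_incl g r)).trans (aug_incl g r)
  · obtain ⟨z, hz, hzt⟩ := exists_good (g := g) t
    -- The lifting problem `(t, b)` is itself a label, once `t` is named by `z`. The generator
    -- carrying this label has boundary `t` and image `b`, so it is the solution.
    have hz' : Good g (gen n z b) := .gen n z b hz (by rw [hzt]; exact (goodIncl g).map_gr ht)
      (fun h => hzt.trans ((congrArg (goodIncl g).toAlgHom (ht0 h)).trans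
        (map_zero (goodIncl g).toAlgHom)))
      (by
        rw [hzt]
        exact (goodIncl_d t).symm.trans ((congrArg (goodIncl g).toAlgHom dt).trans (map_zero _)))
      hb (by rw [hzt]; exact htb)
    let j : GoodGen g := ⟨(n, z, b), hz'⟩
    refine ⟨PolyExt.gen R (goodDeg g) j, PolyExt.gen_mem (X := R) (deg := goodDeg g) j, ?_, ?_⟩
    · refine ((goodPre g).d_gen j).trans (goodIncl_injective g ?_)
      exact (goodIncl_bd j).trans ((good_bd hz').1.trans hzt)
    · refine (congrArg (aug g).toAlgHom (goodIncl_gen g j)).trans ((aug_gen g j.1).trans ?_)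
      exact component_of_mem hb

/-! ### Mapping cones and base change of quasi-isomorphisms along semifree extensions -/

section Graded

variable {K : Type*} [Field K]

theorem exists_sum_range_component {V : Type*} [AddCommGroup V] [Module K V]
    (gr : ℕ → Submodule K V) [DirectSum.Decomposition gr] (v : V) :
    ∃ N, ∀ M, N ≤ M → v = ∑ n ∈ Finset.range M, component gr n v := by
  induction v using DirectSum.Decomposition.inductionOn gr with
  | zero => exact ⟨0, fun M _ => by simp⟩
  | @homogeneous m v =>
    refine ⟨m + 1, fun M hM => ?_⟩
    rw [Finset.sum_eq_single m (fun n _ h => component_of_mem_ne v.2 h.symm)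
      (fun h => absurd (Finset.mem_range.2 (by omega)) h), component_of_mem v.2]
  | add v w hv hw =>
    obtain ⟨N, hN⟩ := hv
    obtain ⟨N', hN'⟩ := hw
    refine ⟨max N N', fun M hM => ?_⟩
    simp only [map_add, Finset.sum_add_distrib]
    rw [← hN M (by omega), ← hN' M (by omega)]

/-- Graded vector spaces have homogeneous bases. -/
theorem exists_homogeneous_basis {V : Type u} [AddCommGroup V] [Module K V]
    (gr : ℕ → Submodule K V) [DirectSum.Decomposition gr] :
    ∃ (ι : Type u) (b : Module.Basis ι K V) (wt : ι → ℕ),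
      (∀ i, b i ∈ gr (wt i)) ∧ ∀ n, ∀ v ∈ gr n, ∀ i, wt i ≠ n → b.repr v i = 0 := by
  classical
  have h : DirectSum.IsInternal gr := DirectSum.Decomposition.isInternal gr
  let α : ℕ → Type u := fun n => Module.Basis.ofVectorSpaceIndex K (gr n)
  let v : ∀ n, Module.Basis (α n) K (gr n) := fun n => Module.Basis.ofVectorSpace K (gr n)
  refine ⟨Σ n, α n, h.collectedBasis v, fun i => i.1, ?_, ?_⟩
  · intro i
    exact h.collectedBasis_mem v i
  · rintro n x hx ⟨m, i⟩ hi
    exact h.collectedBasis_repr_of_mem_ne v (Ne.symm hi) hx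

end Graded

namespace DGVect

variable {K : Type u} [Field K]

theorem component_d (V : DGVect K) (n : ℕ) (x : V.carrier) :
    component V.gr n (V.d x) = V.d (component V.gr (n + 1) x) := by
  have : component V.gr n ∘ₗ V.d = V.d ∘ₗ component V.gr (n + 1) := by
    refine linearMap_ext_homogeneous (gr := V.gr) fun m t ht => ?_
    change component V.gr n (V.d t) = V.d (component V.gr (n + 1) t)
    rcases m with _ | m
    · rw [V.d_zero ht, map_zero, component_of_mem_ne ht (by omega), map_zero]
    · by_cases h : m = n
      · subst h
        rw [component_of_mem ht, component_of_mem (V.d_mem ht)]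
      · rw [component_of_mem_ne ht (by omega), component_of_mem_ne (V.d_mem ht) h, map_zero]
  exact LinearMap.congr_fun this x

theorem Hom.map_component {V W : DGVect K} (f : Hom V W) (n : ℕ) (x : V.carrier) :
    f.toLin (component V.gr n x) = component W.gr n (f.toLin x) := by
  have : f.toLin ∘ₗ component V.gr n = component W.gr n ∘ₗ f.toLin := by
    refine linearMap_ext_homogeneous (gr := V.gr) fun m v hv => ?_
    change f.toLin (component V.gr n v) = component W.gr n (f.toLin v)
    by_cases h : m = n
    · subst h; rw [component_of_mem hv, component_of_mem (f.map_gr hv)]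
    · rw [component_of_mem_ne hv h, component_of_mem_ne (f.map_gr hv) h, map_zero]
  exact LinearMap.congr_fun this x

/-- A morphism is a quasi-isomorphism if and only if its mapping cone is acyclic. -/
theorem Hom.isQuasiIso_iff_cone {V W : DGVect K} (f : Hom V W) : f.IsQuasiIso ↔
    ∀ z w, V.d z = 0 → f.toLin z = W.d w → ∃ x y, V.d x = z ∧ f.toLin x = w + W.d y := by
  rw [isQuasiIso_iff]
  constructor
  · rintro ⟨h1, h2⟩ z w dz hzw
    have h0 : ∀ n, ∀ w ∈ W.gr n, W.d w = 0 → ∃ x y, V.d x = 0 ∧ f.toLin x = w + W.d y := by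
      intro n w hw dw
      obtain ⟨x, -, dx, y, -, h⟩ := h2 n w hw dw
      exact ⟨x, y, dx, h⟩
    have key : ∀ n, ∃ x y, V.d x = component V.gr n z ∧
        f.toLin x = component W.gr (n + 1) w + W.d y := by
      intro n
      have hdz : V.d (component V.gr n z) = 0 := by
        rcases n with _ | n
        · exact V.d_zero (component_mem _ _ _)
        · rw [← component_d, dz, map_zero]
      have hz : f.toLin (component V.gr n z) = W.d (component W.gr (n + 1) w) := by
        rw [f.map_component, hzw, component_d]
      obtain ⟨x, hx, dx⟩ := h1 n _ (component_mem V.gr n z) hdz _ (component_mem W.gr (n + 1) w)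
        hz.symm
      obtain ⟨x', y, dx', hy⟩ := h0 (n + 1) (component W.gr (n + 1) w - f.toLin x)
        (sub_mem (component_mem _ _ _) (f.map_gr hx)) (by rw [map_sub, ← hz, ← f.map_d, dx, sub_self])
      refine ⟨x + x', y, by rw [map_add, dx, dx', add_zero], ?_⟩
      rw [map_add, hy]; abel
    choose x y hx hy using key
    -- The component of `z` of index `n` is paired with that of `w` of index `n + 1`. The component
    -- of `w` of index 0 has no partner and is treated separately, as a cocycle.
    obtain ⟨x0, y0, hx0, hy0⟩ := h0 0 (component W.gr 0 w) (component_mem _ _ _)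
      (W.d_zero (component_mem _ _ _))
    obtain ⟨N, hN⟩ := exists_sum_range_component V.gr z
    obtain ⟨N', hN'⟩ := exists_sum_range_component W.gr w
    refine ⟨x0 + ∑ n ∈ Finset.range (max N N'), x n, y0 + ∑ n ∈ Finset.range (max N N'), y n, ?_, ?_⟩
    · rw [map_add, map_sum, hx0, zero_add]
      conv_rhs => rw [hN (max N N') (le_max_left _ _)]
      exact Finset.sum_congr rfl fun n _ => hx n
    · rw [map_add, map_sum, map_add, map_sum, hy0]
      conv_rhs => rw [hN' (max N N' + 1) (by omega), Finset.sum_range_succ']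
      rw [Finset.sum_congr rfl fun n _ => hy n, Finset.sum_add_distrib]
      abel
  · intro h
    refine ⟨fun n x hx dx y hy hxy => ?_, fun n y hy dy => ?_⟩
    · obtain ⟨z, -, hz, -⟩ := h x y dx hxy.symm
      refine ⟨component V.gr (n + 1) z, component_mem _ _ _, ?_⟩
      rw [← component_d, hz, component_of_mem hx]
    · obtain ⟨x, z, dx, hx⟩ := h 0 y (map_zero _) (by rw [map_zero, dy])
      refine ⟨component V.gr n x, component_mem _ _ _, ?_, component W.gr (n + 1) z,
        component_mem _ _ _, ?_⟩
      · rcases n with _ | n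
        · exact V.d_zero (component_mem _ _ _)
        · rw [← component_d, dx, map_zero]
      · rw [f.map_component, hx, map_add, component_of_mem hy, component_d]

end DGVect

namespace PolyExt

variable {K : Type u} [Field K] {X Y : CDGA K} {J : Type u} {deg : J → ℕ} {ι : Type u}
  (b : Module.Basis ι K (FreeGC K deg))

variable (X) in
open Classical in
/-- The coefficients of an element of the free extension in a basis of the free algebra. -/
noncomputable def coef : Carrier X deg →ₗ[K] (ι →₀ X.carrier) :=
  (TensorProduct.equivFinsuppOfBasisRight b).toLinearMap ∘ₗ (equiv X deg).symm.toLinearMap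

theorem coef_tm (x : X.carrier) (w : FreeGC K deg) (i : ι) :
    coef X b (tm deg x w) i = b.repr w i • x := by
  classical
  rw [coef, LinearMap.comp_apply, tm]
  simp only [LinearEquiv.coe_coe, LinearEquiv.symm_apply_apply]
  exact TensorProduct.equivFinsuppOfBasisRight_apply_tmul_apply b x w i

theorem sum_coef (t : Carrier X deg) : t = (coef X b t).sum fun i x => tm deg x (b i) := by
  classical
  have h := TensorProduct.equivFinsuppOfBasisRight_symm_apply b (coef X b t)
  have h1 : (TensorProduct.equivFinsuppOfBasisRight b).symm (coef X b t) =
    (equiv X deg).symm t := (TensorProduct.equivFinsuppOfBasisRight b).symm_apply_apply _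
  rw [h1] at h
  have h2 := congrArg (equiv X deg) h
  rw [LinearEquiv.apply_symm_apply] at h2
  refine h2.trans ?_
  rw [Finsupp.sum, Finsupp.sum, map_sum]
  rfl

theorem coef_incl_mul (x : X.carrier) (t : Carrier X deg) (i : ι) :
    coef X b (incl X deg x * t) i = x * coef X b t i := by
  induction t using induction_tm with
  | h0 => simp
  | hadd s t hs ht => rw [mul_add, map_add, map_add, Finsupp.add_apply, Finsupp.add_apply, hs, ht,
      mul_add]
  | ht k l x' w hx' hw =>
    rw [tm_eq, ← mul_assoc, ← map_mul, ← tm_eq, ← tm_eq, coef_tm, coef_tm, mul_smul_comm]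

theorem coef_sum_tm (s : Finset ι) (c : ι → X.carrier) (i : ι) [Decidable (i ∈ s)] :
    coef X b (∑ k ∈ s, tm deg (c k) (b k)) i = if i ∈ s then c i else 0 := by
  classical
  rw [map_sum, Finsupp.finsetSum_apply]
  simp only [coef_tm, Module.Basis.repr_self, Finsupp.single_apply, ite_smul, one_smul, zero_smul]
  rw [Finset.sum_ite_eq' s i c]
  congr

/-- The factor from `X` has nonnegative index, so in total index `n` the factor from the free
algebra has weight at most `n`. -/
theorem coef_eq_zero {b : Module.Basis ι K (FreeGC K deg)} {wt : ι → ℕ}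
    (hb : ∀ n, ∀ w ∈ FreeGC.gr K deg n, ∀ i, wt i ≠ n → b.repr w i = 0) {n : ℕ} {t : Carrier X deg} (ht : t ∈ gr X deg n) {i : ι} (hi : n < wt i) :
    coef X b t i = 0 := by
  refine gr_induction (p := fun t => coef X b t i = 0) ?_ ?_ ?_ ?_ ht
  · simp
  · intro s t hs ht; rw [map_add, Finsupp.add_apply, hs, ht, add_zero]
  · intro c s hs; rw [map_smul, Finsupp.smul_apply, hs, smul_zero]
  · intro k l x w hkl _ hw
    rw [coef_tm, hb l w hw i (by omega), zero_smul]

/-- The top coefficients of the differential. -/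
theorem coef_d {D : PreSemifree X} {b : Module.Basis ι K (FreeGC K D.deg)} {wt : ι → ℕ}
    (hwt : ∀ i, b i ∈ FreeGC.gr K D.deg (wt i))
    (hb : ∀ n, ∀ w ∈ FreeGC.gr K D.deg n, ∀ i, wt i ≠ n → b.repr w i = 0) {k : ℕ} {t : Carrier X D.deg} (ht : ∀ i, k < wt i → coef X b t i = 0) {i : ι}
    (hi : k ≤ wt i) : coef X b (D.d t) i = X.d (coef X b t i) := by
  have key : ∀ x j, wt j ≤ k → coef X b (D.d (tm D.deg x (b j))) i =
      X.d (coef X b (tm D.deg x (b j)) i) := by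
    intro x j hj
    have hw : inclFree X D.deg (b j) ∈ gr X D.deg (wt j) := inclFree_mem (hwt j)
    -- The differential of a basis element of weight `wt j` has smaller total index, hence no
    -- coefficient at a weight `≥ wt j`. In the top weights only the differential of the
    -- coefficients remains.
    have h0 : coef X b (D.d (inclFree X D.deg (b j))) i = 0 := by
      rcases h : wt j with _ | l
      · rw [h] at hw
        rw [D.d_zero hw]; simp
      · rw [h] at hw
        exact coef_eq_zero hb (D.d_mem hw) (by omega)
    have hs : (PolyExt X D.deg).sign (incl X D.deg x) = incl X D.deg (X.sign x) :=
      ((inclHom X D.deg).map_sign x).symm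
    rw [tm_eq, D.d_mul, D.d_incl, hs, map_add, Finsupp.add_apply, coef_incl_mul b (X.sign x), h0, mul_zero,
      add_zero, ← tm_eq, ← tm_eq, coef_tm, coef_tm, map_smul]
  conv_lhs => rw [sum_coef b t]
  conv_rhs => rw [sum_coef b t]
  rw [Finsupp.sum, map_sum, map_sum, map_sum, Finsupp.finsetSum_apply, Finsupp.finsetSum_apply,
    map_sum]
  refine Finset.sum_congr rfl fun j hj => key _ j ?_
  by_contra h
  exact Finsupp.mem_support_iff.1 hj (ht j (by omega))

theorem coef_pushHom (v : X ⟶ Y) (b : Module.Basis ι K (FreeGC K deg)) (t : Carrier X deg) (i : ι) :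
    coef Y b ((Semifree.pushHom v deg).toAlgHom t) i = v.toAlgHom (coef X b t i) := by
  have hfree : ∀ w, (Semifree.pushHom v deg).toAlgHom (inclFree X deg w) = inclFree Y deg w := by
    intro w
    have : (Semifree.pushHom v deg).toAlgHom.comp (inclFree X deg) = inclFree Y deg :=
      FreeGC.algHom_ext fun j => Semifree.pushHom_gen v deg j
    exact congrArg (fun f : FreeGC K deg →ₐ[K] Carrier Y deg => f w) this
  induction t using induction_tm with
  | h0 => simp
  | hadd s t hs ht => simp only [map_add, Finsupp.add_apply, hs, ht]
  | ht k l x w hx hw =>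
    rw [coef_tm, tm_eq, map_mul, Semifree.pushHom_incl, hfree, ← tm_eq, coef_tm, map_smul]

end PolyExt

namespace Semifree

open CDGA PolyExt

variable {K : Type u} [Field K] {X Y : CDGA K} (D : Semifree X)

/-- Base change of a quasi-isomorphism along a semifree extension is a quasi-isomorphism. -/
theorem pushMap_isWeakEquiv {v : X ⟶ Y} (hv : IsWeakEquiv v) : IsWeakEquiv (D.pushMap v) := by
  classical
  obtain ⟨ι, b, wt, hwt, hb⟩ := exists_homogeneous_basis (FreeGC.gr K D.deg)
  have hv' := (DGVect.Hom.isQuasiIso_iff_cone _).1 hv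
  have cone : ∀ a c, X.d a = 0 → v.toAlgHom a = Y.d c → ∃ x y, X.d x = a ∧
    v.toAlgHom x = c + Y.d y := hv'
  refine (DGVect.Hom.isQuasiIso_iff_cone _).2 ?_
  let dX : Carrier X D.deg →ₗ[K] Carrier X D.deg := D.d
  let dY : Carrier Y D.deg →ₗ[K] Carrier Y D.deg := (D.prePush v).d
  let g : Carrier X D.deg →ₐ[K] Carrier Y D.deg := (pushHom v D.deg).toAlgHom
  have hg : ∀ t, g (dX t) = dY (g t) := pushHom_d D v
  have coefX : ∀ k t, (∀ i, k < wt i → coef X b t i = 0) → ∀ i, k ≤ wt i →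
      coef X b (dX t) i = X.d (coef X b t i) := fun k t ht i hi => coef_d hwt hb ht hi
  have coefY : ∀ k t, (∀ i, k < wt i → coef Y b t i = 0) → ∀ i, k ≤ wt i →
      coef Y b (dY t) i = Y.d (coef Y b t i) :=
    fun k t ht i hi => coef_d (D := D.prePush v) hwt hb ht hi
  have coefg : ∀ t i, coef Y b (g t) i = v.toAlgHom (coef X b t i) := fun t i =>
    coef_pushHom v b t i
  have dX_dX : ∀ t, dX (dX t) = 0 := D.d_d_of_bd D.closed
  have dY_dY : ∀ t, dY (dY t) = 0 := (D.prePush v).d_d_of_bd (D.push v).closed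
  -- Induction on a strict bound for the weights that occur in a cocycle `(z, w)` of the cone. In
  -- the top weight the differential acts coefficientwise, so acyclicity of the cone of `v` applies
  -- to each coefficient.
  have main : ∀ k z w, (∀ i, k ≤ wt i → coef X b z i = 0) → (∀ i, k ≤ wt i → coef Y b w i = 0) →
      dX z = 0 → g z = dY w → ∃ x y, dX x = z ∧ g x = w + dY y := by
    intro k
    induction k with
    | zero =>
      intro z w hz hw _ _
      have hz0 : z = 0 := by
        rw [sum_coef b z, Finsupp.sum]
        exact Finset.sum_eq_zero fun i hi => absurd (hz i (Nat.zero_le _))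
          (Finsupp.mem_support_iff.1 hi)
      have hw0 : w = 0 := by
        rw [sum_coef b w, Finsupp.sum]
        exact Finset.sum_eq_zero fun i hi => absurd (hw i (Nat.zero_le _))
          (Finsupp.mem_support_iff.1 hi)
      exact ⟨0, 0, by rw [hz0, map_zero], by rw [hw0, map_zero, map_zero, add_zero]⟩
    | succ k ih =>
      intro z w hz hw dz hzw
      have h1 : ∀ i, k ≤ wt i → X.d (coef X b z i) = 0 := by
        intro i hi
        rw [← coefX k z (fun i hi => hz i hi) i hi, dz]; simp
      have h2 : ∀ i, k ≤ wt i → v.toAlgHom (coef X b z i) = Y.d (coef Y b w i) := by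
        intro i hi
        rw [← coefY k w (fun i hi => hw i hi) i hi, ← hzw, coefg]
      have h3 : ∀ i, ∃ x y, k ≤ wt i → X.d x = coef X b z i ∧
          v.toAlgHom x = coef Y b w i + Y.d y := by
        intro i
        by_cases hi : k ≤ wt i
        · obtain ⟨x, y, h⟩ := cone _ _ (h1 i hi) (h2 i hi)
          exact ⟨x, y, fun _ => h⟩
        · exact ⟨0, 0, fun h => absurd h hi⟩
      choose x y hxy using h3
      let s : Finset ι := ((coef X b z).support ∪ (coef Y b w).support).filter (fun i => k ≤ wt i)
      let x' : Carrier X D.deg := ∑ i ∈ s, tm D.deg (x i) (b i)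
      let y' : Carrier Y D.deg := ∑ i ∈ s, tm D.deg (y i) (b i)
      have cx : ∀ i, coef X b x' i = if i ∈ s then x i else 0 := fun i => coef_sum_tm b s x i
      have cy : ∀ i, coef Y b y' i = if i ∈ s then y i else 0 := fun i => coef_sum_tm b s y i
      have ns : ∀ i, k ≤ wt i → i ∉ s → coef X b z i = 0 ∧ coef Y b w i = 0 := by
        intro i hi h
        by_contra h'
        rw [not_and_or] at h'
        exact h (Finset.mem_filter.2 ⟨Finset.mem_union.2 (h'.imp Finsupp.mem_support_iff.2
          Finsupp.mem_support_iff.2), hi⟩)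
      have ns' : ∀ i, k < wt i → i ∉ s := by
        intro i hi h
        rcases Finset.mem_union.1 (Finset.mem_filter.1 h).1 with h | h
        · exact Finsupp.mem_support_iff.1 h (hz i hi)
        · exact Finsupp.mem_support_iff.1 h (hw i hi)
      have tx : ∀ i, k < wt i → coef X b x' i = 0 := fun i hi => by rw [cx, if_neg (ns' i hi)]
      have ty : ∀ i, k < wt i → coef Y b y' i = 0 := fun i hi => by rw [cy, if_neg (ns' i hi)]
      -- Subtracting the boundary built from the top coefficients removes all weights from `k` on,
      -- and it leaves a cocycle of the cone because `g` commutes with the differentials.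
      obtain ⟨x₁, y₁, hx₁, hy₁⟩ := ih (z - dX x') (w - g x' + dY y') (fun i hi => by
          rw [map_sub, Finsupp.sub_apply, coefX k x' tx i hi, cx]
          split_ifs with h
          · rw [(hxy i hi).1, sub_self]
          · rw [(ns i hi h).1, map_zero, sub_zero]) (fun i hi => by
          rw [map_add, map_sub, Finsupp.add_apply, Finsupp.sub_apply, coefg, coefY k y' ty i hi,
            cx, cy]
          split_ifs with h
          · rw [(hxy i hi).2]; abel
          · rw [(ns i hi h).2, map_zero, map_zero, sub_zero, add_zero])
        (by rw [map_sub, dz, dX_dX, sub_zero])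
        (by rw [map_sub, map_add, map_sub, dY_dY, hzw, hg, add_zero])
      refine ⟨x' + x₁, y' + y₁, by rw [map_add, hx₁]; abel, ?_⟩
      rw [map_add, map_add, hy₁]; abel
  intro z w dz hzw
  let k := ((coef X b z).support ∪ (coef Y b w).support).sup wt + 1
  refine main k z w (fun i hi => ?_) (fun i hi => ?_) dz hzw
  · by_contra h
    have := Finset.le_sup (f := wt) (Finset.mem_union_left (coef Y b w).support
      (Finsupp.mem_support_iff.2 h))
    omega
  · by_contra h
    have := Finset.le_sup (f := wt) (Finset.mem_union_right (coef X b z).support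
      (Finsupp.mem_support_iff.2 h))
    omega

end Semifree

namespace DGMod

variable {K : Type u} [Field K] {B : CDGA K} (M : DGMod B)

/-! ### Right multiplication -/

/-- Right multiplication on a DG-module, `rmul b x = (-1)^(|x||b|) b • x`. -/
noncomputable def rmul : B.carrier →ₗ[K] Module.End K M.carrier :=
  (DirectSum.toModule K ℕ _ fun n =>
    LinearMap.mulRight K ((M.sign : Module.End K M.carrier) ^ n) ∘ₗ
      (Algebra.lsmul K K M.carrier).toLinearMap ∘ₗ (B.gr n).subtype) ∘ₗ
    (DirectSum.decomposeLinearEquiv B.gr).toLinearMap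

theorem sign_pow {k : ℕ} {x : M.carrier} (hx : x ∈ M.gr k) (n : ℕ) :
    ((M.sign : Module.End K M.carrier) ^ n) x = (-1 : K) ^ (k * n) • x := by
  induction n with
  | zero => simp
  | succ n ih =>
    rw [pow_succ', Module.End.mul_apply, ih, map_smul, M.sign_of_mem hx, smul_smul, ← pow_add]
    rfl

variable {M} in
theorem rmul_of_mem {n k : ℕ} {b : B.carrier} {x : M.carrier} (hb : b ∈ B.gr n)
    (hx : x ∈ M.gr k) : M.rmul b x = (-1 : K) ^ (k * n) • (b • x) := by
  rw [rmul, LinearMap.comp_apply, LinearEquiv.coe_coe, DirectSum.decomposeLinearEquiv_apply,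
    DirectSum.decompose_of_mem _ hb, ← DirectSum.lof_eq_of K, DirectSum.toModule_lof]
  change b • (((M.sign : Module.End K M.carrier) ^ n) x) = _
  rw [M.sign_pow hx, smul_comm]

variable {M} in
theorem rmul_mem {n k : ℕ} {b : B.carrier} {x : M.carrier} (hb : b ∈ B.gr n)
    (hx : x ∈ M.gr k) : M.rmul b x ∈ M.gr (k + n) := by
  rw [rmul_of_mem hb hx, add_comm]
  exact Submodule.smul_mem _ _ (M.smul_mem hb hx)

theorem induction_homogeneous {p : M.carrier → Prop} (h0 : p 0)
    (hadd : ∀ x y, p x → p y → p (x + y)) (h : ∀ n, ∀ x ∈ M.gr n, p x) (x : M.carrier) : p x := by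
  induction x using DirectSum.Decomposition.inductionOn M.gr with
  | zero => exact h0
  | @homogeneous n x => exact h n x x.2
  | add x y hx hy => exact hadd x y hx hy

end DGMod

theorem GCAlg.induction_homogeneous {K : Type u} [Field K] (A : GCAlg K) {p : A.carrier → Prop}
    (h0 : p 0) (hadd : ∀ x y, p x → p y → p (x + y)) (h : ∀ n, ∀ x ∈ A.gr n, p x)
    (x : A.carrier) : p x := by
  induction x using DirectSum.Decomposition.inductionOn A.gr with
  | zero => exact h0
  | @homogeneous n x => exact h n x x.2
  | add x y hx hy => exact hadd x y hx hy

namespace DGMod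

variable {K : Type u} [Field K] {B : CDGA K} (M : DGMod B)

/-- One of the bimodule identities behind associativity of the square-zero extension; after
exchanging `b` and `c` the two signs differ by an even exponent. -/
theorem rmul_smul (b c : B.carrier) (x : M.carrier) : M.rmul c (b • x) = b • M.rmul c x := by
  refine M.induction_homogeneous (p := fun x => M.rmul c (b • x) = b • M.rmul c x) ?_ ?_ ?_ x
  · simp
  · intro x y hx hy; rw [smul_add, map_add, map_add, smul_add, hx, hy]
  intro k x hx
  refine B.induction_homogeneous (p := fun b => M.rmul c (b • x) = b • M.rmul c x) ?_ ?_ ?_ b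
  · simp
  · intro b b' h h'; rw [add_smul, map_add, add_smul, h, h']
  intro m b hb
  refine B.induction_homogeneous (p := fun c => M.rmul c (b • x) = b • M.rmul c x) ?_ ?_ ?_ c
  · simp
  · intro b b' h h'
    rw [map_add, LinearMap.add_apply, LinearMap.add_apply, smul_add, h, h']
  intro n c hc
  rw [rmul_of_mem hc (M.smul_mem hb hx), rmul_of_mem hc hx, smul_comm b, smul_smul c,
    B.comm hc hb, smul_assoc, smul_smul, mul_smul b c x]
  congr 1
  rw [← pow_add]
  apply neg_one_pow_congr'
  have : (m + k) * n + n * m = k * n + 2 * (n * m) := by ring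
  omega

theorem rmul_rmul (b c : B.carrier) (x : M.carrier) :
    M.rmul c (M.rmul b x) = M.rmul (b * c) x := by
  refine M.induction_homogeneous (p := fun x => M.rmul c (M.rmul b x) = M.rmul (b * c) x)
    ?_ ?_ ?_ x
  · simp
  · intro x y hx hy; rw [map_add, map_add, map_add, hx, hy]
  intro k x hx
  refine B.induction_homogeneous (p := fun b => M.rmul c (M.rmul b x) = M.rmul (b * c) x)
    ?_ ?_ ?_ b
  · simp
  · intro b b' h h'
    rw [map_add, LinearMap.add_apply, map_add, add_mul, map_add, LinearMap.add_apply, h, h']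
  intro m b hb
  refine B.induction_homogeneous (p := fun c => M.rmul c (M.rmul b x) = M.rmul (b * c) x)
    ?_ ?_ ?_ c
  · simp
  · intro c c' h h'
    rw [map_add, LinearMap.add_apply, mul_add, map_add, LinearMap.add_apply, h, h']
  intro n c hc
  rw [rmul_of_mem hc (rmul_mem hb hx), rmul_of_mem hb hx, rmul_of_mem (B.mul_mem hb hc) hx,
    smul_comm c, smul_smul c, B.comm hc hb, smul_assoc, smul_smul, smul_smul]
  congr 1
  rw [← pow_add, ← pow_add]
  apply neg_one_pow_congr'
  have : (k + m) * n + (k * m + n * m) = k * (m + n) + 2 * (n * m) := by ring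
  omega

theorem rmul_one (x : M.carrier) : M.rmul 1 x = x := by
  refine M.induction_homogeneous (p := fun x => M.rmul 1 x = x) ?_ ?_ ?_ x
  · simp
  · intro x y hx hy; rw [map_add, hx, hy]
  intro k x hx
  rw [rmul_of_mem B.one_mem hx]; simp

theorem d_smul (b : B.carrier) (x : M.carrier) :
    M.d (b • x) = B.d b • x + B.sign b • M.d x := by
  refine B.induction_homogeneous
    (p := fun b => M.d (b • x) = B.d b • x + B.sign b • M.d x) ?_ ?_ ?_ b
  · simp
  · intro b b' h h'
    rw [add_smul, map_add, h, h', map_add, map_add, add_smul, add_smul]; abel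
  intro m b hb
  rw [M.leibniz x hb, B.sign_of_mem hb, smul_assoc]

/-- The sign `(-1) ^ k` comes from moving `d` past `x`, now written on the left. With this form the
Leibniz rule of the square-zero extension can be checked term by term. -/
theorem d_rmul {k : ℕ} {x : M.carrier} (hx : x ∈ M.gr k) (b : B.carrier) :
    M.d (M.rmul b x) = M.rmul b (M.d x) + (-1 : K) ^ k • M.rmul (B.d b) x := by
  refine B.induction_homogeneous (p := fun b =>
    M.d (M.rmul b x) = M.rmul b (M.d x) + (-1 : K) ^ k • M.rmul (B.d b) x) ?_ ?_ ?_ b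
  · simp
  · intro b b' h h'
    simp only [map_add, LinearMap.add_apply, smul_add, h, h']; abel
  intro n b hb
  have h1 : M.rmul b (M.d x) = (-1 : K) ^ (k * n + n) • (b • M.d x) := by
    rcases k with _ | k
    · rw [M.d_zero hx]; simp
    · rw [rmul_of_mem hb (M.d_mem hx)]
      congr 1
      apply neg_one_pow_congr'
      have : (k + 1) * n + n = k * n + 2 * n := by ring
      omega
  have h2 : M.rmul (B.d b) x = (-1 : K) ^ (k * n + k) • (B.d b • x) := by
    rcases n with _ | n
    · rw [B.d_zero hb]; simp
    · rw [rmul_of_mem (B.d_mem hb) hx]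
      congr 1
      apply neg_one_pow_congr'
      have : k * (n + 1) + k = k * n + 2 * k := by ring
      omega
  rw [rmul_of_mem hb hx, map_smul, M.leibniz x hb, h1, h2, smul_add, smul_smul, smul_smul,
    ← pow_add, ← pow_add, add_comm]
  congr 2
  apply neg_one_pow_congr'
  omega

theorem Hom.map_rmul {M N : DGMod B} (φ : Hom M N) (b : B.carrier) (x : M.carrier) :
    φ.toLin (M.rmul b x) = N.rmul b (φ.toLin x) := by
  refine M.induction_homogeneous
    (p := fun x => φ.toLin (M.rmul b x) = N.rmul b (φ.toLin x)) ?_ ?_ ?_ x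
  · simp
  · intro x y hx hy; simp only [map_add, hx, hy]
  intro k x hx
  refine B.induction_homogeneous
    (p := fun b => φ.toLin (M.rmul b x) = N.rmul b (φ.toLin x)) ?_ ?_ ?_ b
  · simp
  · intro b b' h h'; simp only [map_add, LinearMap.add_apply, h, h']
  intro n b hb
  rw [rmul_of_mem hb hx, rmul_of_mem hb (φ.map_gr hx), _root_.map_smul, φ.map_smul]

/-! ### Square-zero extensions -/

/-- The underlying type of the square-zero extension. -/
def SquareZero : Type u := B.carrier × M.carrier

namespace SquareZero

variable {M}

noncomputable instance : AddCommGroup (SquareZero M) :=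
  inferInstanceAs (AddCommGroup (B.carrier × M.carrier))

noncomputable instance : Module K (SquareZero M) :=
  inferInstanceAs (Module K (B.carrier × M.carrier))

/-- The projection onto the base. -/
noncomputable def fst : SquareZero M →ₗ[K] B.carrier := LinearMap.fst K B.carrier M.carrier

/-- The projection onto the module. -/
noncomputable def snd : SquareZero M →ₗ[K] M.carrier := LinearMap.snd K B.carrier M.carrier

/-- The element with given components. -/
def mk (b : B.carrier) (m : M.carrier) : SquareZero M := (b, m)

@[simp] theorem fst_mk (b : B.carrier) (m : M.carrier) : fst (mk b m) = b := rfl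

@[simp] theorem snd_mk (b : B.carrier) (m : M.carrier) : snd (mk b m) = m := rfl

@[ext]
theorem ext {x y : SquareZero M} (h : fst x = fst y) (h' : snd x = snd y) : x = y := Prod.ext h h'

-- All Koszul signs are absorbed in the right multiplication, so the product has the shape of the
-- square-zero extension by a bimodule.
noncomputable instance : Mul (SquareZero M) :=
  ⟨fun x y => mk (fst x * fst y) (fst x • snd y + M.rmul (fst y) (snd x))⟩

noncomputable instance : One (SquareZero M) := ⟨mk 1 0⟩

@[simp] theorem fst_one : fst (1 : SquareZero M) = 1 := rfl

@[simp] theorem snd_one : snd (1 : SquareZero M) = 0 := rfl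

@[simp] theorem fst_mul (x y : SquareZero M) : fst (x * y) = fst x * fst y := rfl

@[simp] theorem snd_mul (x y : SquareZero M) :
    snd (x * y) = fst x • snd y + M.rmul (fst y) (snd x) := rfl

noncomputable instance : Ring (SquareZero M) where
  __ := (inferInstance : AddCommGroup (SquareZero M))
  __ := (inferInstance : Mul (SquareZero M))
  __ := (inferInstance : One (SquareZero M))
  left_distrib x y z := by
    ext
    · simp only [fst_mul, map_add, mul_add]
    · simp only [snd_mul, map_add, smul_add, LinearMap.add_apply]; abel
  right_distrib x y z := by
    ext
    · simp only [fst_mul, map_add, add_mul]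
    · simp only [snd_mul, map_add, add_smul]; abel
  zero_mul x := by
    ext
    · simp only [fst_mul, map_zero, zero_mul]
    · simp only [snd_mul, map_zero, zero_smul, add_zero]
  mul_zero x := by
    ext
    · simp only [fst_mul, map_zero, mul_zero]
    · simp only [snd_mul, map_zero, smul_zero, LinearMap.zero_apply, add_zero]
  mul_assoc x y z := by
    ext
    · simp only [fst_mul, mul_assoc]
    · simp only [snd_mul, fst_mul, map_add, smul_add, mul_smul, rmul_smul, rmul_rmul]; abel
  one_mul x := by
    ext
    · simp only [fst_mul, fst_one, one_mul]
    · simp only [snd_mul, fst_one, snd_one, one_smul, map_zero, add_zero]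
  mul_one x := by
    ext
    · simp only [fst_mul, fst_one, mul_one]
    · simp only [snd_mul, fst_one, snd_one, smul_zero, rmul_one, zero_add]

noncomputable instance : Algebra K (SquareZero M) :=
  Algebra.ofModule (fun c x y => by
      ext
      · simp only [fst_mul, _root_.map_smul, smul_mul_assoc]
      · simp only [snd_mul, _root_.map_smul, smul_add, smul_assoc])
    (fun c x y => by
      ext
      · simp only [fst_mul, _root_.map_smul, mul_smul_comm]
      · simp only [snd_mul, _root_.map_smul, smul_add, LinearMap.smul_apply, smul_comm (fst x) c])

variable (M) in
/-- The grading. -/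
noncomputable def gr (n : ℕ) : Submodule K (SquareZero M) :=
  (B.gr n).comap fst ⊓ (M.gr n).comap snd

theorem mem_gr {n : ℕ} {x : SquareZero M} :
    x ∈ gr M n ↔ fst x ∈ B.gr n ∧ snd x ∈ M.gr n := Iff.rfl

/-- Pairs of linear maps. -/
noncomputable def map {N : DGMod B} (f : B.carrier →ₗ[K] B.carrier)
    (g : M.carrier →ₗ[K] N.carrier) : SquareZero M →ₗ[K] SquareZero N where
  toFun x := mk (f (fst x)) (g (snd x))
  map_add' x y := by ext <;> simp
  map_smul' c x := by ext <;> simp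

@[simp] theorem fst_map {N : DGMod B} (f : B.carrier →ₗ[K] B.carrier)
    (g : M.carrier →ₗ[K] N.carrier) (x : SquareZero M) : fst (map f g x) = f (fst x) := rfl

@[simp] theorem snd_map {N : DGMod B} (f : B.carrier →ₗ[K] B.carrier)
    (g : M.carrier →ₗ[K] N.carrier) (x : SquareZero M) : snd (map f g x) = g (snd x) := rfl

noncomputable instance : DirectSum.Decomposition (gr M) :=
  decompositionOfProj (gr M) (fun n => map (component B.gr n) (component M.gr n))
    (fun n x => mem_gr.2 ⟨component_mem _ _ _, component_mem _ _ _⟩)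
    (fun n x hx => ext (component_of_mem (mem_gr.1 hx).1) (component_of_mem (mem_gr.1 hx).2))
    (fun m n h x hx => ext (component_of_mem_ne (mem_gr.1 hx).1 h)
      (component_of_mem_ne (mem_gr.1 hx).2 h))
    (fun x => by
      obtain ⟨N, hN⟩ := exists_sum_range_component B.gr (fst x)
      obtain ⟨N', hN'⟩ := exists_sum_range_component M.gr (snd x)
      refine ⟨Finset.range (max N N'), ext ?_ ?_⟩
      · rw [map_sum]
        exact hN _ (le_max_left N N')
      · rw [map_sum]
        exact hN' _ (le_max_right N N'))

noncomputable instance : GradedAlgebra (gr M) where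
  one_mem := mem_gr.2 ⟨B.one_mem, zero_mem _⟩
  mul_mem m n x y hx hy := by
    rw [mem_gr] at *
    exact ⟨B.mul_mem hx.1 hy.1, add_mem (M.smul_mem hx.1 hy.2) (rmul_mem hy.1 hx.2)⟩

end SquareZero

open SquareZero

/-- The square-zero extension `B ⊕ M`. -/
noncomputable abbrev squareZero : CDGA K where
  carrier := SquareZero M
  gr := SquareZero.gr M
  comm {m n x y} hx hy := by
    rw [mem_gr] at hx hy
    ext
    · rw [_root_.map_smul]
      exact B.comm hx.1 hy.1
    · rw [_root_.map_smul, snd_mul, snd_mul, rmul_of_mem hy.1 hx.2,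
        rmul_of_mem hx.1 hy.2, smul_add, smul_smul, mul_comm n m, neg_one_pow_mul_self', one_smul,
        add_comm]
  d := SquareZero.map B.d M.d
  d_mem hx := mem_gr.2 ⟨B.d_mem (mem_gr.1 hx).1, M.d_mem (mem_gr.1 hx).2⟩
  d_zero hx := SquareZero.ext (B.d_zero (mem_gr.1 hx).1) (M.d_zero (mem_gr.1 hx).2)
  d_d x := SquareZero.ext (B.d_d _) (M.d_d _)
  leibniz {m x} y hx := by
    rw [mem_gr] at hx
    ext
    · simp only [fst_map, fst_mul, map_add, _root_.map_smul]
      exact B.leibniz _ hx.1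
    · simp only [snd_map, snd_mul, map_add, _root_.map_smul, fst_map]
      rw [M.leibniz _ hx.1, M.d_rmul hx.2, smul_add ((-1 : K) ^ m) (fst x • M.d (snd y))]
      abel

/-- The projection `B ⊕ M → B`. -/
noncomputable def squareZeroFst : squareZero M ⟶ B :=
  CDGA.Hom.mk ⟨AlgHom.ofLinearMap (SquareZero.fst (M := M)) rfl (fun _ _ => rfl),
    fun hx => (mem_gr.1 hx).1⟩ (fun _ => rfl)

variable {M} in
/-- Functoriality of the square-zero extension. -/
noncomputable def squareZeroMap {N : DGMod B} (φ : Hom M N) : squareZero M ⟶ squareZero N :=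
  CDGA.Hom.mk ⟨AlgHom.ofLinearMap (SquareZero.map LinearMap.id φ.toLin)
    (SquareZero.ext rfl (map_zero φ.toLin))
    (fun x y => SquareZero.ext rfl (by
      simp only [snd_map, snd_mul, map_add, fst_map, φ.map_smul, φ.map_rmul, LinearMap.id_apply])),
    fun hx => mem_gr.2 ⟨(mem_gr.1 hx).1, φ.map_gr (mem_gr.1 hx).2⟩⟩
    (fun x => SquareZero.ext rfl (φ.map_d _))

theorem snd_squareZeroMap {M N : DGMod B} (φ : Hom M N) (x : SquareZero M) :
    snd ((squareZeroMap φ).toAlgHom x) = φ.toLin (snd x) := rfl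

end DGMod

namespace DGMod

open SquareZero

variable {K : Type u} [Field K] {B Y : CDGA K} (q : Y ⟶ B)

/-! ### The universal derivation -/

variable (Y) in
/-- The element `a δ(b)` of the module of Kähler differentials. -/
noncomputable def kaehlerMk : Y.carrier →ₗ[K] Y.carrier →ₗ[K] (kaehler Y).carrier :=
  LinearMap.mk₂ K
    (fun a b => (quotMk (free Y Y.toDGVect) (kaehlerRel Y) (a ⊗ₜ[K] b) : (kaehler Y).carrier))
    (fun a a' b => (congrArg _ (TensorProduct.add_tmul a a' b)).trans (map_add _ _ _))
    (fun c a b => (congrArg _ (TensorProduct.smul_tmul' c a b).symm).trans (_root_.map_smul _ _ _))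
    (fun a b b' => (congrArg _ (TensorProduct.tmul_add a b b')).trans (map_add _ _ _))
    (fun c a b => (congrArg _ (TensorProduct.tmul_smul c a b)).trans (_root_.map_smul _ _ _))

/-- The element `b ⊗ x` of an extension of scalars. -/
noncomputable def baseChangeMk (M : DGMod Y) :
    B.carrier →ₗ[K] M.carrier →ₗ[K] (baseChange q M).carrier :=
  LinearMap.mk₂ K (fun b x => (quotMk (free B M.toDGVect) (baseChangeRel q M) (b ⊗ₜ[K] x) :
      (baseChange q M).carrier))
    (fun a a' b => (congrArg _ (TensorProduct.add_tmul a a' b)).trans (map_add _ _ _))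
    (fun c a b => (congrArg _ (TensorProduct.smul_tmul' c a b).symm).trans (_root_.map_smul _ _ _))
    (fun a b b' => (congrArg _ (TensorProduct.tmul_add a b b')).trans (map_add _ _ _))
    (fun c a b => (congrArg _ (TensorProduct.tmul_smul c a b)).trans (_root_.map_smul _ _ _))

theorem smul_kaehlerMk (a b c : Y.carrier) : a • kaehlerMk Y b c = kaehlerMk Y (a * b) c := rfl

theorem kaehlerMk_mem {m n : ℕ} {a b : Y.carrier} (ha : a ∈ Y.gr m) (hb : b ∈ Y.gr n) :
    kaehlerMk Y a b ∈ (kaehler Y).gr (m + n) :=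
  ⟨_, tmul_mem_freeGr (B := Y) (V := Y.toDGVect) ha hb, rfl⟩

theorem d_kaehlerMk {m : ℕ} {a : Y.carrier} (ha : a ∈ Y.gr m) (b : Y.carrier) :
    (kaehler Y).d (kaehlerMk Y a b) =
      kaehlerMk Y (Y.d a) b + (-1 : K) ^ m • kaehlerMk Y a (Y.d b) := by
  have h := quotD_mk (kaehlerRel_isDGRel Y) (a ⊗ₜ[K] b)
  have h' : (free Y Y.toDGVect).d (a ⊗ₜ[K] b) = _ := freeD_tmul Y Y.toDGVect ha b
  rw [h', map_add, _root_.map_smul] at h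
  exact h

theorem kaehlerMk_one_mul {m n : ℕ} {a b : Y.carrier} (ha : a ∈ Y.gr m) (hb : b ∈ Y.gr n) :
    kaehlerMk Y 1 (a * b) = kaehlerMk Y a b + (-1 : K) ^ (m * n) • kaehlerMk Y b a := by
  have h : quotMk (free Y Y.toDGVect) (kaehlerRel Y) ((1 : Y.carrier) ⊗ₜ[K] (a * b) - a ⊗ₜ[K] b
      - (-1 : K) ^ (m * n) • (b ⊗ₜ[K] a)) = 0 :=
    (quotMk_eq_zero _ _).2 (Submodule.subset_span ⟨m, n, a, b, ha, hb, rfl⟩)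
  rw [map_sub, map_sub, sub_sub, sub_eq_zero, _root_.map_smul] at h
  exact h

theorem kaehler_gr_induction {n : ℕ} {p : (kaehler Y).carrier → Prop} (h0 : p 0)
    (hadd : ∀ s t, p s → p t → p (s + t)) (hsmul : ∀ (c : K) s, p s → p (c • s))
    (h : ∀ i j, i + j = n → ∀ a ∈ Y.gr i, ∀ b ∈ Y.gr j, p (kaehlerMk Y a b))
    {t : (kaehler Y).carrier} (ht : t ∈ (kaehler Y).gr n) : p t := by
  obtain ⟨t, ht, rfl⟩ := ht
  refine Submodule.span_induction (p := fun t _ => p (quotMk _ (kaehlerRel Y) t)) ?_ ?_ ?_ ?_ ht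
  · rintro _ ⟨i, j, hij, a, ha, b, hb, rfl⟩
    exact h i j hij a ha b hb
  · rw [map_zero]; exact h0
  · intro s t _ _ hs ht
    rw [map_add]; exact hadd _ _ hs ht
  · intro c t _ ht
    rw [_root_.map_smul]; exact hsmul _ _ ht

theorem smul_baseChangeMk (M : DGMod Y) (b c : B.carrier) (x : M.carrier) :
    b • baseChangeMk q M c x = baseChangeMk q M (b * c) x := rfl

theorem baseChangeMk_mem (M : DGMod Y) {m n : ℕ} {b : B.carrier} {x : M.carrier}
    (hb : b ∈ B.gr m) (hx : x ∈ M.gr n) : baseChangeMk q M b x ∈ (baseChange q M).gr (m + n) :=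
  ⟨_, tmul_mem_freeGr (V := M.toDGVect) hb hx, rfl⟩

theorem d_baseChangeMk (M : DGMod Y) {m : ℕ} {b : B.carrier} (hb : b ∈ B.gr m) (x : M.carrier) :
    (baseChange q M).d (baseChangeMk q M b x) =
      baseChangeMk q M (B.d b) x + (-1 : K) ^ m • baseChangeMk q M b (M.d x) := by
  have h := quotD_mk (baseChangeRel_isDGRel q M) (b ⊗ₜ[K] x)
  have h' : (free B M.toDGVect).d (b ⊗ₜ[K] x) = _ := freeD_tmul B M.toDGVect hb x
  rw [h', map_add, _root_.map_smul] at h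
  exact h

theorem baseChange_gr_induction (M : DGMod Y) {n : ℕ} {p : (baseChange q M).carrier → Prop}
    (h0 : p 0) (hadd : ∀ s t, p s → p t → p (s + t)) (hsmul : ∀ (c : K) s, p s → p (c • s))
    (h : ∀ i j, i + j = n → ∀ b ∈ B.gr i, ∀ x ∈ M.gr j, p (baseChangeMk q M b x))
    {t : (baseChange q M).carrier} (ht : t ∈ (baseChange q M).gr n) : p t := by
  obtain ⟨t, ht, rfl⟩ := ht
  refine Submodule.span_induction (p := fun t _ => p (quotMk _ (baseChangeRel q M) t)) ?_ ?_ ?_ ?_ ht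
  · rintro _ ⟨i, j, hij, a, ha, b, hb, rfl⟩
    exact h i j hij a ha b hb
  · rw [map_zero]; exact h0
  · intro s t _ _ hs ht
    rw [map_add]; exact hadd _ _ hs ht
  · intro c t _ ht
    rw [_root_.map_smul]; exact hsmul _ _ ht

theorem baseChangeMk_smul (M : DGMod Y) (b : B.carrier) (a : Y.carrier) (t : M.carrier) :
    baseChangeMk q M b (a • t) = (b * q.toAlgHom a) • baseChangeMk q M 1 t := by
  suffices h : baseChangeMk q M 1 (a • t) = q.toAlgHom a • baseChangeMk q M 1 t by
    have h' := congrArg (b • ·) h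
    simp only [smul_baseChangeMk, mul_one] at h'
    rw [h', smul_baseChangeMk, mul_one]
  rw [smul_baseChangeMk, mul_one]
  refine M.induction_homogeneous (p := fun t =>
    baseChangeMk q M 1 (a • t) = baseChangeMk q M (q.toAlgHom a) t) ?_ ?_ ?_ t
  · simp
  · intro s t hs ht
    rw [smul_add, map_add, map_add, hs, ht]
  intro n t ht
  refine Y.induction_homogeneous (p := fun a =>
    baseChangeMk q M 1 (a • t) = baseChangeMk q M (q.toAlgHom a) t) ?_ ?_ ?_ a
  · simp
  · intro a b ha hb
    rw [add_smul, map_add, map_add, map_add, LinearMap.add_apply, ha, hb]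
  intro m a ha
  have h : quotMk (free B M.toDGVect) (baseChangeRel q M)
      (q.toAlgHom a ⊗ₜ[K] t - (1 : B.carrier) ⊗ₜ[K] (a • t)) = 0 :=
    (quotMk_eq_zero _ _).2 (Submodule.subset_span ⟨m, n, a, t, ha, ht, rfl⟩)
  rw [map_sub, sub_eq_zero] at h
  exact h.symm

/-- The element `1 ⊗ δ y`. -/
noncomputable def delta : Y.carrier →ₗ[K] (baseChange q (kaehler Y)).carrier :=
  baseChangeMk q (kaehler Y) 1 ∘ₗ kaehlerMk Y 1

theorem delta_apply (y : Y.carrier) :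
    delta q y = baseChangeMk q (kaehler Y) 1 (kaehlerMk Y 1 y) := rfl

theorem delta_mem {n : ℕ} {y : Y.carrier} (hy : y ∈ Y.gr n) :
    delta q y ∈ (baseChange q (kaehler Y)).gr n := by
  have := baseChangeMk_mem q (kaehler Y) B.one_mem (kaehlerMk_mem Y.one_mem hy)
  rwa [zero_add, zero_add] at this

theorem delta_d (y : Y.carrier) :
    delta q (Y.d y) = (baseChange q (kaehler Y)).d (delta q y) := by
  rw [delta_apply, delta_apply, d_baseChangeMk q _ B.one_mem, d_kaehlerMk Y.one_mem, B.d_one,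
    Y.d_one]
  simp

theorem baseChangeMk_kaehlerMk (b : B.carrier) (a y : Y.carrier) :
    baseChangeMk q (kaehler Y) b (kaehlerMk Y a y) = (b * q.toAlgHom a) • delta q y := by
  rw [← mul_one a, ← smul_kaehlerMk, baseChangeMk_smul, mul_one, delta_apply]

/-- The graded Leibniz rule, arranged as a left plus a right multiplication so that it coincides
with the second component of a product in the square-zero extension. -/
theorem delta_mul (a b : Y.carrier) : delta q (a * b) = q.toAlgHom a • delta q b +
    (baseChange q (kaehler Y)).rmul (q.toAlgHom b) (delta q a) := by
  refine Y.induction_homogeneous (p := fun a => delta q (a * b) = q.toAlgHom a • delta q b +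
    (baseChange q (kaehler Y)).rmul (q.toAlgHom b) (delta q a)) ?_ ?_ ?_ a
  · simp
  · intro a a' ha ha'
    simp only [add_mul, map_add, ha, ha', add_smul]; abel
  intro m a ha
  refine Y.induction_homogeneous (p := fun b => delta q (a * b) = q.toAlgHom a • delta q b +
    (baseChange q (kaehler Y)).rmul (q.toAlgHom b) (delta q a)) ?_ ?_ ?_ b
  · simp
  · intro b b' hb hb'
    simp only [mul_add, map_add, hb, hb', smul_add, LinearMap.add_apply]; abel
  intro n b hb
  rw [rmul_of_mem (q.map_gr hb) (delta_mem q ha), delta_apply, kaehlerMk_one_mul ha hb, map_add,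
    _root_.map_smul, baseChangeMk_kaehlerMk, baseChangeMk_kaehlerMk, one_mul, one_mul]

/-- The morphism to the square-zero extension given by the universal derivation. -/
noncomputable def univ : Y ⟶ squareZero (baseChange q (kaehler Y)) :=
  CDGA.Hom.mk ⟨AlgHom.ofLinearMap
      { toFun := fun y => SquareZero.mk (q.toAlgHom y) (delta q y)
        map_add' := fun x y => by ext <;> simp
        map_smul' := fun c x => by ext <;> simp }
      (by
        refine SquareZero.ext (map_one q.toAlgHom) ?_
        have h := delta_mul q 1 1
        rw [mul_one, map_one q.toAlgHom, one_smul, rmul_one] at h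
        exact left_eq_add.1 h)
      (fun x y => SquareZero.ext (map_mul q.toAlgHom x y) (delta_mul q x y)),
    fun hy => mem_gr.2 ⟨q.map_gr hy, delta_mem q hy⟩⟩
    (fun y => SquareZero.ext (q.map_d y) (delta_d q y))

theorem univ_fst : univ q ≫ squareZeroFst _ = q := CDGA.hom_ext fun _ => rfl

variable {q}

theorem baseChange_kaehler_gr_induction {n : ℕ} {p : (baseChange q (kaehler Y)).carrier → Prop}
    (h0 : p 0) (hadd : ∀ s t, p s → p t → p (s + t)) (hsmul : ∀ (c : K) s, p s → p (c • s))
    (h : ∀ i j, i + j = n → ∀ b ∈ B.gr i, ∀ y ∈ Y.gr j, p (b • delta q y))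
    {t : (baseChange q (kaehler Y)).carrier} (ht : t ∈ (baseChange q (kaehler Y)).gr n) : p t := by
  refine baseChange_gr_induction q (kaehler Y) h0 hadd hsmul ?_ ht
  intro i j hij b hb x hx
  refine kaehler_gr_induction (p := fun x => p (baseChangeMk q (kaehler Y) b x)) ?_ ?_ ?_ ?_ hx
  · rwa [map_zero]
  · intro s t hs ht
    rw [map_add]; exact hadd _ _ hs ht
  · intro c t ht
    rw [_root_.map_smul]; exact hsmul _ _ ht
  · intro k l hkl a ha y hy
    rw [baseChangeMk_kaehlerMk]
    exact h (i + k) l (by omega) _ (B.mul_mem hb (q.map_gr ha)) y hy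

theorem baseChange_kaehler_induction {p : (baseChange q (kaehler Y)).carrier → Prop} (h0 : p 0)
    (hadd : ∀ s t, p s → p t → p (s + t)) (hsmul : ∀ (c : K) s, p s → p (c • s))
    (h : ∀ m n, ∀ b ∈ B.gr m, ∀ y ∈ Y.gr n, p (b • delta q y))
    (t : (baseChange q (kaehler Y)).carrier) : p t :=
  induction_homogeneous _ h0 hadd (fun _ _ hx => baseChange_kaehler_gr_induction h0 hadd hsmul
    (fun i j _ b hb y hy => h i j b hb y hy) hx) t

theorem hom_ext_delta {M : DGMod B} {φ ψ : Hom (baseChange q (kaehler Y)) M}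
    (h : ∀ y, φ.toLin (delta q y) = ψ.toLin (delta q y))
    (t : (baseChange q (kaehler Y)).carrier) : φ.toLin t = ψ.toLin t := by
  induction t using baseChange_kaehler_induction with
  | h0 => simp
  | hadd s t hs ht => rw [map_add, map_add, hs, ht]
  | hsmul c t ht => rw [_root_.map_smul, _root_.map_smul, ht]
  | h m n b hb y hy => rw [φ.map_smul, ψ.map_smul, h]

section OfHom

variable {M : DGMod B} (g : GCAlg.Hom Y.toGCAlg (squareZero M).toGCAlg)
  (hg : ∀ y, fst (g.toAlgHom y) = q.toAlgHom y)

/-- The derivation underlying a morphism to a square-zero extension. -/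
noncomputable def der : Y.carrier →ₗ[K] M.carrier := SquareZero.snd ∘ₗ g.toAlgHom.toLinearMap

theorem der_mem {n : ℕ} {y : Y.carrier} (hy : y ∈ Y.gr n) : der g y ∈ M.gr n :=
  (mem_gr.1 (g.map_gr hy)).2

theorem der_mul (hg : ∀ y, fst (g.toAlgHom y) = q.toAlgHom y) (a b : Y.carrier) : der g (a * b) = q.toAlgHom a • der g b +
    M.rmul (q.toAlgHom b) (der g a) := by
  rw [← hg, ← hg]
  exact congrArg SquareZero.snd (map_mul g.toAlgHom a b)

/-- The semilinear map `a ⊗ a' ↦ q(a) • g(a')`. -/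
noncomputable def kaehlerLift :
    (free Y Y.toDGVect).carrier →ₛₗ[(q.toAlgHom : Y.carrier →+* B.carrier)] M.carrier where
  toFun := TensorProduct.lift (((Algebra.lsmul K K M.carrier).toLinearMap ∘ₗ
    q.toAlgHom.toLinearMap).compl₂ (der g))
  map_add' := map_add _
  map_smul' a t := by
    induction t using TensorProduct.induction_on with
    | zero => simp
    | add s t hs ht => rw [smul_add, map_add, map_add, smul_add, hs, ht]
    | tmul b c =>
      change q.toAlgHom (a * b) • der g c = q.toAlgHom a • q.toAlgHom b • der g c
      rw [map_mul, mul_smul]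

/-- The semilinear map on Kähler differentials corresponding to a derivation. -/
noncomputable def kaehlerDesc :
    (kaehler Y).carrier →ₛₗ[(q.toAlgHom : Y.carrier →+* B.carrier)] M.carrier :=
  Submodule.liftQ (Submodule.span Y.carrier (kaehlerRel Y)) (kaehlerLift (q := q) g) (by
    rw [Submodule.span_le]
    rintro _ ⟨m, n, a, b, ha, hb, rfl⟩
    change kaehlerLift (q := q) g _ = 0
    rw [map_sub, map_sub]
    change q.toAlgHom 1 • der g (a * b) - q.toAlgHom a • der g b -
      TensorProduct.lift _ ((-1 : K) ^ (m * n) • (b ⊗ₜ[K] a)) = 0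
    rw [_root_.map_smul]
    change q.toAlgHom 1 • der g (a * b) - q.toAlgHom a • der g b -
      (-1 : K) ^ (m * n) • (q.toAlgHom b • der g a) = 0
    rw [map_one, one_smul, der_mul g hg, rmul_of_mem (q.map_gr hb) (der_mem g ha)]
    abel)

/-- The `K`-linear map underlying `kaehlerDesc`. -/
noncomputable def kaehlerDescLin : (kaehler Y).carrier →ₗ[K] M.carrier where
  toFun := kaehlerDesc g hg
  map_add' := map_add _
  map_smul' c t := by
    rw [← algebraMap_smul Y.carrier c t, LinearMap.map_smulₛₗ]
    change q.toAlgHom (algebraMap K _ c) • _ = _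
    rw [AlgHom.commutes, algebraMap_smul]; rfl

theorem kaehlerDescLin_smul (a : Y.carrier) (t : (kaehler Y).carrier) :
    kaehlerDescLin g hg (a • t) = q.toAlgHom a • kaehlerDescLin g hg t :=
  LinearMap.map_smulₛₗ (kaehlerDesc g hg) a t

/-- The `B`-linear map corresponding to a derivation. -/
noncomputable def ofHomLin : (baseChange q (kaehler Y)).carrier →ₗ[B.carrier] M.carrier :=
  Submodule.liftQ (Submodule.span B.carrier (baseChangeRel q (kaehler Y)))
    (TensorProduct.AlgebraTensorModule.lift
      ((LinearMap.toSpanSingleton B.carrier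
        ((kaehler Y).carrier →ₗ[K] M.carrier) (kaehlerDescLin g hg)))) (by
    rw [Submodule.span_le]
    rintro _ ⟨m, n, a, t, ha, ht, rfl⟩
    change TensorProduct.AlgebraTensorModule.lift _ _ = 0
    rw [map_sub]
    change q.toAlgHom a • kaehlerDescLin g hg t - (1 : B.carrier) • kaehlerDescLin g hg (a • t) = 0
    rw [kaehlerDescLin_smul, one_smul, sub_self])

/-- Only the graded algebra structure of `g` has been used, so a derivation that ignores the
differentials still induces a `B`-linear map. Injectivity for semifree extensions relies on this
generality. -/
theorem ofHomLin_delta (y : Y.carrier) : ofHomLin g hg (delta q y) = der g y := by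
  change (1 : B.carrier) • (q.toAlgHom 1 • der g y) = der g y
  rw [map_one, one_smul, one_smul]

theorem ofHomLin_smul (c : K) (t : (baseChange q (kaehler Y)).carrier) :
    ofHomLin g hg (c • t) = c • ofHomLin g hg t := by
  rw [← algebraMap_smul B.carrier c t, ← algebraMap_smul B.carrier c (ofHomLin g hg t)]
  exact _root_.map_smul (ofHomLin g hg) _ _

theorem ofHomLin_smul_delta (b : B.carrier) (y : Y.carrier) :
    ofHomLin g hg (b • delta q y) = b • der g y := by
  rw [← ofHomLin_delta g hg]
  exact _root_.map_smul (ofHomLin g hg) _ _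

theorem ofHomLin_mem {n : ℕ} {t : (baseChange q (kaehler Y)).carrier}
    (ht : t ∈ (baseChange q (kaehler Y)).gr n) : ofHomLin g hg t ∈ M.gr n := by
  refine baseChange_kaehler_gr_induction (p := fun t => ofHomLin g hg t ∈ M.gr n) ?_ ?_ ?_ ?_ ht
  · rw [map_zero]; exact zero_mem _
  · intro s t hs ht
    rw [map_add]; exact add_mem hs ht
  · intro c t ht
    rw [ofHomLin_smul]; exact Submodule.smul_mem _ _ ht
  · rintro i j rfl b hb y hy
    rw [ofHomLin_smul_delta]
    exact M.smul_mem hb (der_mem g hy)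

end OfHom

section OfHom

variable {M : DGMod B} (g : Y ⟶ squareZero M) (hg : g ≫ M.squareZeroFst = q)

variable {g} in
theorem fst_of_comp_eq (hg : g ≫ M.squareZeroFst = q) (y : Y.carrier) :
    fst ((CDGA.Hom.toHom g).toAlgHom y) = q.toAlgHom y := CDGA.congr_toAlgHom hg y

/-- The morphism of DG-modules corresponding to a derivation. -/
noncomputable def ofHom : Hom (baseChange q (kaehler Y)) M where
  toLin :=
    { toFun := ofHomLin (CDGA.Hom.toHom g) (fst_of_comp_eq hg)
      map_add' := map_add _
      map_smul' := ofHomLin_smul _ _ }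
  map_gr {n t} ht := ofHomLin_mem _ _ ht
  map_d t := by
    change ofHomLin (CDGA.Hom.toHom g) (fst_of_comp_eq hg) _ = M.d (ofHomLin (CDGA.Hom.toHom g) (fst_of_comp_eq hg) t)
    induction t using baseChange_kaehler_induction with
    | h0 => simp
    | hadd s t hs ht => simp only [map_add, hs, ht]
    | hsmul c t ht => rw [_root_.map_smul, ofHomLin_smul, ht, ofHomLin_smul, _root_.map_smul]
    | h m n b hb y hy =>
      rw [DGMod.leibniz _ _ hb, map_add, ofHomLin_smul, ofHomLin_smul_delta, ofHomLin_smul_delta,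
        M.leibniz _ hb, ← delta_d, ofHomLin_smul_delta]
      exact congrArg (fun z => B.d b • der (CDGA.Hom.toHom g) y + (-1 : K) ^ m • b • z)
        (congrArg SquareZero.snd (g.map_d y))
  map_smul b t := _root_.map_smul (ofHomLin (CDGA.Hom.toHom g) (fst_of_comp_eq hg)) b t

theorem ofHom_delta (y : Y.carrier) :
    (ofHom g hg).toLin (delta q y) = SquareZero.snd (g.toAlgHom y) :=
  ofHomLin_delta _ (fst_of_comp_eq hg) y

end OfHom

theorem cotangentMap_delta {X : CDGA K} {i : X ⟶ Y} {r : X ⟶ B} (h : i ≫ q = r) (x : X.carrier) :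
    (cotangentMap h).toLin (delta r x) = delta q (i.toAlgHom x) := by
  change baseChangeMk q (kaehler Y) 1 (kaehlerMk Y (i.toAlgHom 1) (i.toAlgHom x)) = _
  rw [map_one i.toAlgHom]; rfl

end DGMod

namespace DGMod

variable {K : Type u} [Field K] {B : CDGA K}

/-- The composition of morphisms of DG-modules. -/
def Hom.comp {M N P : DGMod B} (g : Hom N P) (f : Hom M N) : Hom M P where
  toHom := g.toHom.comp f.toHom
  map_smul b x := (congrArg g.toLin (f.map_smul b x)).trans (g.map_smul b _)

theorem Hom.comp_apply {M N P : DGMod B} (g : Hom N P) (f : Hom M N) (x : M.carrier) :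
    (g.comp f).toLin x = g.toLin (f.toLin x) := rfl

/-- The identity morphism. -/
def Hom.id (M : DGMod B) : Hom M M where
  toHom := DGVect.Hom.id M.toDGVect
  map_smul _ _ := rfl

/-- The zero morphism. -/
def Hom.zero (M N : DGMod B) : Hom M N where
  toLin := 0
  map_gr _ := zero_mem _
  map_d _ := (map_zero N.d).symm
  map_smul b _ := (smul_zero b).symm

/-! ### Path objects -/

/-- The elements without component in degree zero. -/
noncomputable def pos (M : DGMod B) : Submodule K M.carrier := LinearMap.ker (component M.gr 0)

theorem mem_pos {M : DGMod B} {x : M.carrier} : x ∈ M.pos ↔ component M.gr 0 x = 0 := Iff.rfl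

theorem mem_pos_of_mem {M : DGMod B} {n : ℕ} {x : M.carrier} (hx : x ∈ M.gr n) (hn : n ≠ 0) :
    x ∈ M.pos := component_of_mem_ne hx hn

theorem eq_zero_of_mem_pos {M : DGMod B} {x : M.carrier} (hx : x ∈ M.pos) (h : x ∈ M.gr 0) :
    x = 0 := (component_of_mem h).symm.trans hx

/-- Indices add up and are nonnegative, so index 0 of a product sees only index 0 of the factors.
Consequently `pos` is stable under `B`. -/
theorem component_zero_smul (M : DGMod B) (b : B.carrier) (x : M.carrier) :
    component M.gr 0 (b • x) = component B.gr 0 b • component M.gr 0 x := by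
  refine M.induction_homogeneous (p := fun x =>
    component M.gr 0 (b • x) = component B.gr 0 b • component M.gr 0 x) ?_ ?_ ?_ x
  · simp
  · intro x y hx hy; simp only [smul_add, map_add, hx, hy]
  intro n x hx
  refine B.induction_homogeneous (p := fun b =>
    component M.gr 0 (b • x) = component B.gr 0 b • component M.gr 0 x) ?_ ?_ ?_ b
  · simp
  · intro b c hb hc; simp only [add_smul, map_add, hb, hc]
  intro m b hb
  by_cases hm : m = 0
  · by_cases hn : n = 0
    · subst hm hn
      rw [component_of_mem hb, component_of_mem hx, component_of_mem]
      exact M.smul_mem hb hx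
    · rw [component_of_mem_ne hx hn, smul_zero,
        component_of_mem_ne (M.smul_mem hb hx) (by omega)]
  · rw [component_of_mem_ne hb hm, zero_smul, component_of_mem_ne (M.smul_mem hb hx) (by omega)]

theorem smul_mem_pos {M : DGMod B} (b : B.carrier) {x : M.carrier} (hx : x ∈ M.pos) :
    b • x ∈ M.pos := by
  rw [mem_pos, component_zero_smul, mem_pos.1 hx, smul_zero]

theorem component_mem_pos {M : DGMod B} (n : ℕ) {x : M.carrier} (hx : x ∈ M.pos) :
    component M.gr n x ∈ M.pos := by
  by_cases hn : n = 0
  · subst hn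
    rw [mem_pos.1 hx]; exact zero_mem _
  · exact mem_pos_of_mem (component_mem _ _ _) hn

variable (M : DGMod B)

/-- The underlying type of the path object of `M`: pairs consisting of an element `h` of `M` (a
homotopy) and of `x - d h`, where `x` is the end of the homotopy. -/
def Path : Type u := M.pos × M.pos

namespace Path

variable {M}

noncomputable instance : AddCommGroup (Path M) := inferInstanceAs (AddCommGroup (M.pos × M.pos))

noncomputable instance : Module K (Path M) := inferInstanceAs (Module K (M.pos × M.pos))

/-- The defect. -/
noncomputable def mid : Path M →ₗ[K] M.carrier := M.pos.subtype ∘ₗ LinearMap.fst K M.pos M.pos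

/-- The homotopy. -/
noncomputable def hty : Path M →ₗ[K] M.carrier := M.pos.subtype ∘ₗ LinearMap.snd K M.pos M.pos

theorem mid_mem (x : Path M) : mid x ∈ M.pos := x.1.2

theorem hty_mem (x : Path M) : hty x ∈ M.pos := x.2.2

/-- The element with given components. -/
def mk (m h : M.carrier) (hm : m ∈ M.pos) (hh : h ∈ M.pos) : Path M := (⟨m, hm⟩, ⟨h, hh⟩)

section

variable (m h : M.carrier) (hm : m ∈ M.pos) (hh : h ∈ M.pos)

@[simp] theorem mid_mk : mid (mk m h hm hh) = m := rfl

@[simp] theorem hty_mk : hty (mk m h hm hh) = h := rfl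

end

@[ext]
theorem ext {x y : Path M} (h : mid x = mid y) (h' : hty x = hty y) : x = y :=
  Prod.ext (Subtype.ext h) (Subtype.ext h')

/-- In terms of the end `x = mid + d hty`, the action is `b • x` on ends and `sign b • h` on
homotopies, the sign coming from the shift by one. The term with `sign (d b)` results from
expressing this through the defect `x - d h`. -/
noncomputable instance : SMul B.carrier (Path M) :=
  ⟨fun b x => mk (b • mid x + B.sign (B.d b) • hty x) (B.sign b • hty x)
    (add_mem (smul_mem_pos _ (mid_mem x)) (smul_mem_pos _ (hty_mem x)))
    (smul_mem_pos _ (hty_mem x))⟩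

@[simp] theorem mid_smul (b : B.carrier) (x : Path M) :
    mid (b • x) = b • mid x + B.sign (B.d b) • hty x := rfl

@[simp] theorem hty_smul (b : B.carrier) (x : Path M) : hty (b • x) = B.sign b • hty x := rfl

noncomputable instance : Module B.carrier (Path M) where
  one_smul x := by
    ext
    · rw [mid_smul, B.d_one]; simp
    · rw [hty_smul, map_one B.sign, one_smul]
  mul_smul a b x := by
    ext
    · simp only [mid_smul, hty_smul, B.d_mul, map_add, map_mul, B.sign_sign, mul_smul, add_smul,
        smul_add]
      abel
    · simp [mul_smul]
  smul_zero a := by ext <;> simp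
  smul_add a x y := by
    ext
    · simp only [mid_smul, map_add, smul_add]; abel
    · simp
  add_smul a b x := by
    ext
    · simp only [mid_smul, map_add, add_smul]; abel
    · simp [add_smul]
  zero_smul x := by ext <;> simp

noncomputable instance : IsScalarTower K B.carrier (Path M) where
  smul_assoc c b x := by ext <;> simp

variable (M) in
/-- The grading. -/
noncomputable def gr (n : ℕ) : Submodule K (Path M) :=
  (M.gr n).comap mid ⊓ (M.gr (n + 1)).comap hty

theorem mem_gr {n : ℕ} {x : Path M} :
    x ∈ gr M n ↔ mid x ∈ M.gr n ∧ hty x ∈ M.gr (n + 1) := Iff.rfl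

variable (M) in
/-- The projections onto the homogeneous components. -/
noncomputable def proj (n : ℕ) : Path M →ₗ[K] Path M where
  toFun x := mk (component M.gr n (mid x)) (component M.gr (n + 1) (hty x))
    (component_mem_pos _ (mid_mem x)) (component_mem_pos _ (hty_mem x))
  map_add' x y := by ext <;> simp
  map_smul' c x := by ext <;> simp

noncomputable instance : DirectSum.Decomposition (gr M) :=
  decompositionOfProj (gr M) (proj M)
    (fun n x => mem_gr.2 ⟨component_mem _ _ _, component_mem _ _ _⟩)
    (fun n x hx => ext (component_of_mem (mem_gr.1 hx).1) (component_of_mem (mem_gr.1 hx).2))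
    (fun m n h x hx => ext (component_of_mem_ne (mem_gr.1 hx).1 h)
      (component_of_mem_ne (mem_gr.1 hx).2 (by omega)))
    (fun x => by
      obtain ⟨N₂, h₂⟩ := exists_sum_range_component M.gr (mid x)
      obtain ⟨N₃, h₃⟩ := exists_sum_range_component M.gr (hty x)
      refine ⟨Finset.range (max N₂ N₃), ext ?_ ?_⟩
      · rw [map_sum]
        exact h₂ _ (le_max_left _ _)
      · rw [map_sum]
        have h := h₃ (max N₂ N₃ + 1) ((le_max_right _ _).trans (Nat.le_succ _))
        -- Index `n` of the path object corresponds to index `n + 1` of the homotopy, so the sum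
        -- misses index 0, where an element of `pos` has no component.
        rw [Finset.sum_range_succ', mem_pos.1 (hty_mem x), add_zero] at h
        exact h)

end Path

open DGMod.Path

/-- The path object of `M`. -/
noncomputable abbrev path : DGMod B where
  carrier := Path M
  gr := Path.gr M
  d :=
    { toFun := fun x => Path.mk 0 (mid x) (zero_mem _) (mid_mem x)
      map_add' := fun x y => by ext <;> simp
      map_smul' := fun c x => by ext <;> simp }
  d_mem hx := mem_gr.2 ⟨zero_mem _, (mem_gr.1 hx).1⟩
  -- This is where the truncation to `pos` is needed: the differential moves the defect to the
  -- homotopy slot, so it can vanish in index 0 only if the defect has no part there.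
  d_zero {x} hx := Path.ext rfl (eq_zero_of_mem_pos (mid_mem x) (mem_gr.1 hx).1)
  d_d x := Path.ext rfl rfl
  smul_mem {m n b x} hb hx := by
    rw [mem_gr] at *
    refine ⟨add_mem (M.smul_mem hb hx.1) ?_, ?_⟩
    · rcases m with _ | m
      · rw [B.d_zero hb]; simp
      · have := M.smul_mem (B.sign_mem (B.d_mem hb)) hx.2
        rwa [show m + (n + 1) = m + 1 + n by ring] at this
    · have := M.smul_mem (B.sign_mem hb) hx.2
      rwa [← add_assoc] at this
  leibniz {m b} x hb := by
    have h1 : B.sign b = (-1 : K) ^ m • b := B.sign_of_mem hb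
    have h2 : B.sign (B.d b) = - (-1 : K) ^ m • B.d b := by
      rw [← neg_eq_iff_eq_neg.2 (B.d_sign b), h1, _root_.map_smul, neg_smul]
    ext
    · simp [h2, smul_smul, neg_one_pow_mul_self', B.d_d]
    · simp [h1, h2, smul_smul, neg_one_pow_mul_self', add_comm]

/-- The end of the homotopy. -/
noncomputable def pathEnd : Hom (path M) M where
  toLin := mid + M.d ∘ₗ hty
  map_gr {n x} hx := add_mem (mem_gr.1 hx).1 (M.d_mem (mem_gr.1 hx).2)
  map_d x := by
    change 0 + M.d (mid x) = M.d (mid x + M.d (hty x))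
    rw [map_add, M.d_d, zero_add, add_zero]
  map_smul b x := by
    change (b • mid x + B.sign (B.d b) • hty x) + M.d (B.sign b • hty x) =
      b • (mid x + M.d (hty x))
    rw [M.d_smul, B.d_sign, B.sign_sign, neg_smul, smul_add]
    abel

theorem pathEnd_apply (x : Path M) : (pathEnd M).toLin x = mid x + M.d (hty x) := rfl

/-- Elements of strictly negative degree lie in `pos`, so each is the end of the path with itself as
defect and zero homotopy. The truncation costs surjectivity only in degree zero, which fibrations do
not require. -/
theorem isFibration_squareZeroMap_pathEnd : CDGA.IsFibration (squareZeroMap (pathEnd M)) := by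
  intro n hn y hy
  rw [SquareZero.mem_gr] at hy
  have hx := mem_pos_of_mem hy.2 hn.ne'
  refine ⟨SquareZero.mk (SquareZero.fst y) (Path.mk (SquareZero.snd y) 0 hx (zero_mem _)),
    SquareZero.mem_gr.2 ⟨hy.1, mem_gr.2 ⟨hy.2, zero_mem _⟩⟩, SquareZero.ext rfl ?_⟩
  rw [snd_squareZeroMap, SquareZero.snd_mk, pathEnd_apply]
  simp

/-- The inclusion `B → B ⊕ M`. -/
noncomputable def zeroSection : B ⟶ squareZero M :=
  CDGA.Hom.mk ⟨AlgHom.ofLinearMap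
      { toFun := fun b => SquareZero.mk b 0
        map_add' := fun x y => by ext <;> simp
        map_smul' := fun c x => by ext <;> simp } rfl
      (fun x y => SquareZero.ext rfl (by simp)),
    fun hx => SquareZero.mem_gr.2 ⟨hx, zero_mem _⟩⟩
    (fun x => SquareZero.ext rfl (map_zero M.d).symm)

/-! ### Cokernels -/

variable {M}

section Coker

variable {P Q : DGMod B} (φ : Hom P Q)

/-- The images of the homogeneous elements. -/
def cokerRel : Set Q.carrier := {y | ∃ n, ∃ x ∈ P.gr n, φ.toLin x = y}

theorem cokerRel_isDGRel : IsDGRel Q (cokerRel φ) where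
  homogeneous := by
    rintro _ ⟨n, x, hx, rfl⟩
    exact ⟨n, φ.map_gr hx⟩
  d_mem := by
    rintro _ ⟨n, x, hx, rfl⟩
    rcases n with _ | n
    · rw [Q.d_zero (φ.map_gr hx)]; exact zero_mem _
    · exact Submodule.subset_span ⟨n, P.d x, P.d_mem hx, φ.map_d x⟩

/-- The cokernel of a morphism. -/
noncomputable def coker : DGMod B := quot (cokerRel_isDGRel φ)

/-- The projection onto the cokernel. -/
noncomputable def cokerMk : Hom Q (coker φ) where
  toLin := quotMk Q (cokerRel φ)
  map_gr hx := ⟨_, hx, rfl⟩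
  map_d _ := rfl
  map_smul _ _ := rfl

theorem cokerMk_comp (x : P.carrier) : (cokerMk φ).toLin (φ.toLin x) = 0 := by
  refine P.induction_homogeneous (p := fun x => (cokerMk φ).toLin (φ.toLin x) = 0) ?_ ?_ ?_ x
  · simp
  · intro x y hx hy; rw [map_add, map_add, hx, hy, add_zero]
  · intro n x hx
    exact (quotMk_eq_zero _ _).2 (Submodule.subset_span ⟨n, x, hx, rfl⟩)

theorem exists_of_cokerMk_eq_zero {y : Q.carrier} (hy : (cokerMk φ).toLin y = 0) :
    ∃ x, φ.toLin x = y := by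
  have h : y ∈ Submodule.span B.carrier (cokerRel φ) := (quotMk_eq_zero _ _).1 hy
  refine Submodule.span_induction (p := fun y _ => ∃ x, φ.toLin x = y) ?_ ?_ ?_ ?_ h
  · rintro _ ⟨n, x, hx, rfl⟩
    exact ⟨x, rfl⟩
  · exact ⟨0, map_zero _⟩
  · rintro _ _ _ _ ⟨x, rfl⟩ ⟨y, rfl⟩
    exact ⟨x + y, map_add _ _ _⟩
  · rintro b _ _ ⟨x, rfl⟩
    exact ⟨b • x, φ.map_smul b x⟩

theorem exists_mem_of_cokerMk_eq_zero {n : ℕ} {y : Q.carrier} (hn : y ∈ Q.gr n)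
    (hy : (cokerMk φ).toLin y = 0) : ∃ x ∈ P.gr n, φ.toLin x = y := by
  obtain ⟨x, rfl⟩ := exists_of_cokerMk_eq_zero φ hy
  refine ⟨component P.gr n x, component_mem _ _ _, ?_⟩
  refine Eq.trans ?_ (component_of_mem hn)
  exact φ.toHom.map_component n x

variable {φ}

/-- An injective morphism with acyclic cokernel is a quasi-isomorphism. -/
theorem isWeakEquiv_of_coker (hφ : Function.Injective φ.toLin)
    (h : ∀ n, ∀ c ∈ (coker φ).gr n, (coker φ).d c = 0 →
      ∃ e ∈ (coker φ).gr (n + 1), (coker φ).d e = c) : φ.IsWeakEquiv := by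
  -- Acyclicity of the cokernel lifted to `Q`: an element whose differential comes from `P` itself
  -- comes from `P` modulo a boundary.
  have key : ∀ n, ∀ y ∈ Q.gr n, (cokerMk φ).toLin (Q.d y) = 0 →
      ∃ e ∈ Q.gr (n + 1), ∃ x ∈ P.gr n, y = φ.toLin x + Q.d e := by
    intro n y hy dy
    obtain ⟨_, ⟨e, he, rfl⟩, h'⟩ := h n _ ((cokerMk φ).map_gr hy)
      (((cokerMk φ).map_d y).symm.trans dy)
    obtain ⟨x, hx, hxy⟩ := exists_mem_of_cokerMk_eq_zero φ (sub_mem hy (Q.d_mem he)) (by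
      rw [map_sub, ← h', sub_eq_zero]; rfl)
    exact ⟨e, he, x, hx, by rw [hxy, sub_add_cancel]⟩
  refine (DGVect.Hom.isQuasiIso_iff _).2 ⟨fun n x hx _ y hy hxy => ?_, fun n y hy dy => ?_⟩
  · obtain ⟨e, he, z, hz, rfl⟩ := key (n + 1) y hy (by
      rw [hxy]; exact cokerMk_comp φ x)
    refine ⟨z, hz, hφ ?_⟩
    rw [φ.map_d, ← add_zero (Q.d _), ← Q.d_d e, ← map_add]
    exact hxy
  · obtain ⟨e, he, z, hz, rfl⟩ := key n y hy (by rw [dy, map_zero])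
    refine ⟨z, hz, hφ ?_, -e, neg_mem he, ?_⟩
    · rwa [map_add, Q.d_d, add_zero, ← φ.map_d, ← map_zero φ.toLin] at dy
    · rw [map_neg, add_neg_cancel_right]

end Coker

end DGMod

/-! ### Cotangent maps of semifree extensions -/

open DGMod CDGA

namespace DGMod

variable {K : Type u} [Field K] {B X Y : CDGA K} {i : X ⟶ Y} {q : Y ⟶ B} {r : X ⟶ B}

/-- The cokernel carries the universal derivation of `Y` that vanishes on `X`. Lifting it to the
path object gives a `B`-linear map that vanishes on the image of the differentials of `X` and whose
end is the projection to the cokernel. Its homotopy component provides primitives of cocycles. -/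
theorem coker_cotangentMap_acyclic (h : i ≫ q = r)
    (lift : ∀ ⦃M N : DGMod B⦄ (ψ : Hom M N), IsFibration (squareZeroMap ψ) →
      ∀ u : Y ⟶ squareZero N, u ≫ squareZeroFst N = q → i ≫ u = r ≫ zeroSection N →
      ∃ l : Y ⟶ squareZero M, i ≫ l = r ≫ zeroSection M ∧ l ≫ squareZeroMap ψ = u)
    {n : ℕ} {c : (coker (cotangentMap h)).carrier} (hc : c ∈ (coker (cotangentMap h)).gr n)
    (dc : (coker (cotangentMap h)).d c = 0) :
    ∃ e ∈ (coker (cotangentMap h)).gr (n + 1), (coker (cotangentMap h)).d e = c := by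
  let φ := cotangentMap h
  obtain ⟨l, hl, hl'⟩ := lift (pathEnd (coker φ)) (isFibration_squareZeroMap_pathEnd _)
    (univ q ≫ squareZeroMap (cokerMk φ)) (univ_fst q) (CDGA.hom_ext fun x =>
      SquareZero.ext (CDGA.congr_toAlgHom h x)
        ((congrArg (cokerMk φ).toLin (cotangentMap_delta h x).symm).trans (cokerMk_comp φ _)))
  have hq : l ≫ squareZeroFst _ = q :=
    (congrArg (· ≫ squareZeroFst _) hl').trans (univ_fst q)
  have h1 : ∀ x, (pathEnd _).toLin ((ofHom l hq).toLin x) = (cokerMk φ).toLin x := by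
    refine hom_ext_delta (φ := (pathEnd _).comp (ofHom l hq)) (ψ := cokerMk φ) (fun y => ?_)
    rw [Hom.comp_apply, ofHom_delta]
    exact congrArg SquareZero.snd (CDGA.congr_toAlgHom hl' y)
  have h2 : ∀ x, (ofHom l hq).toLin (φ.toLin x) = 0 := by
    refine hom_ext_delta (φ := (ofHom l hq).comp φ) (ψ := Hom.zero _ _) (fun x => ?_)
    rw [Hom.comp_apply, cotangentMap_delta, ofHom_delta]
    exact congrArg SquareZero.snd (CDGA.congr_toAlgHom hl x)
  obtain ⟨y, hy, rfl⟩ := hc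
  obtain ⟨x, hx⟩ := exists_of_cokerMk_eq_zero φ (y := _) (((cokerMk φ).map_d y).trans dc)
  have h3 : (path _).d ((ofHom l hq).toLin y) = 0 := by
    rw [← (ofHom l hq).map_d, ← hx, h2]
  -- Since `c` is a cocycle, `d y` comes from the differentials of `X`, where the lifted map is
  -- zero; so the path attached to `y` is closed. A closed path has zero defect, hence its end is
  -- `d` of its homotopy.
  have h4 : Path.mid ((ofHom l hq).toLin y) = 0 := congrArg Path.hty h3
  refine ⟨Path.hty ((ofHom l hq).toLin y), (Path.mem_gr.1 ((ofHom l hq).map_gr hy)).2, ?_⟩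
  have h5 := h1 y
  rw [pathEnd_apply, h4, zero_add] at h5
  exact h5

/-- The morphism induced on cotangent modules by a semifree extension is injective. -/
theorem cotangentMap_injective (D : Semifree X) {q : D.ext ⟶ B} (h : D.inclusion ≫ q = r) :
    Function.Injective (cotangentMap h).toLin := by
  let P := baseChange r (kaehler X)
  -- The universal derivation of `X` is extended by zero on the free generators. The extension need
  -- not commute with the differentials, but it induces a `B`-linear left inverse, which is enough.
  have hc : ∀ j, SquareZero.mk (q.toAlgHom (PolyExt.gen X D.deg j)) 0 ∈
      (squareZero P).gr (D.deg j) := fun j =>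
    SquareZero.mem_gr.2 ⟨q.map_gr (PolyExt.gen_mem j), zero_mem _⟩
  let g : GCAlg.Hom D.ext.toGCAlg (squareZero P).toGCAlg :=
    PolyExt.liftHom (CDGA.Hom.toHom (univ r)) _ hc
  have hg : ∀ y, SquareZero.fst (g.toAlgHom y) = q.toAlgHom y := by
    refine DFunLike.congr_fun (PolyExt.algHom_ext
      (f := (squareZeroFst P).toAlgHom.comp g.toAlgHom) (g := q.toAlgHom) ?_ ?_)
    · intro x
      exact (congrArg SquareZero.fst
        (PolyExt.liftHom_incl (CDGA.Hom.toHom (univ r)) _ hc x)).trans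
        (CDGA.congr_toAlgHom h x).symm
    · intro j
      exact congrArg SquareZero.fst (PolyExt.liftHom_gen (CDGA.Hom.toHom (univ r)) _ hc j)
  have hg' : ∀ t, ofHomLin g hg ((cotangentMap h).toLin t) = t := by
    intro t
    induction t using baseChange_kaehler_induction with
    | h0 => simp
    | hadd s t hs ht => rw [map_add, map_add, hs, ht]
    | hsmul c t ht => rw [_root_.map_smul, ofHomLin_smul, ht]
    | h m n b hb x hx =>
      rw [(cotangentMap h).map_smul, cotangentMap_delta, ofHomLin_smul_delta]
      exact congrArg (fun z => b • SquareZero.snd z)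
        (PolyExt.liftHom_incl (CDGA.Hom.toHom (univ r)) _ hc x)
  exact Function.LeftInverse.injective hg'

end DGMod

/-! ### Lifting out of cofibrant objects and comparison of cotangent modules -/

open CDGA

namespace CDGA

variable {K : Type u} [Field K]

theorem fromUnit_comp {X Y : CDGA K} (f : X ⟶ Y) : fromUnit X ≫ f = fromUnit Y :=
  CDGA.hom_ext fun c => f.toAlgHom.commutes c

/-- Morphisms out of `X` lift along trivial fibrations. -/
def LiftsTrivialFibrations (X : CDGA K) : Prop :=
  ∀ ⦃E F : CDGA K⦄ (p : E ⟶ F), IsTrivialFibration p → ∀ u : X ⟶ F, ∃ l : X ⟶ E, l ≫ p = u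

/-- The base field is initial, so the lifting square commutes automatically. Cofibrancy of `R` and
`S` enters the main argument only through this property. -/
theorem IsCofibrant.liftsTrivialFibrations {X : CDGA K} (hX : IsCofibrant X) :
    LiftsTrivialFibrations X := by
  intro E F p hp u
  have := IsCofibration.hasLiftingProperty hX hp
  have sq : CommSq (fromUnit E) (fromUnit X) p u := ⟨by rw [fromUnit_comp, fromUnit_comp]⟩
  exact ⟨sq.lift, sq.fac_right⟩

theorem LiftsTrivialFibrations.ext {X : CDGA K} (hX : LiftsTrivialFibrations X) (D : Semifree X) :
    LiftsTrivialFibrations D.ext := by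
  intro E F p hp u
  obtain ⟨v, hv⟩ := hX p hp (D.inclusion ≫ u)
  have := D.hasLiftingProperty hp
  have sq : CommSq v D.inclusion p u := ⟨hv⟩
  exact ⟨sq.lift, sq.fac_right⟩

theorem LiftsFibrations.of_isPushout {A B X Y : CDGA K} {a : A ⟶ B} {x : A ⟶ X} {b : B ⟶ Y}
    {j : X ⟶ Y} (h : IsPushout x a j b) (ha : LiftsFibrations a) : LiftsFibrations j :=
  fun _ _ p hp => have := ha p hp; h.hasLiftingProperty p

end CDGA

namespace DGMod

variable {K : Type u} [Field K] {B X Y Z : CDGA K}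

theorem cotangentMap_comp {i : X ⟶ Y} {j : Y ⟶ Z} {k : X ⟶ Z} {p : X ⟶ B} {q : Y ⟶ B} {r : Z ⟶ B}
    (hk : i ≫ j = k) (h : i ≫ q = p) (h' : j ≫ r = q) (h'' : k ≫ r = p) :
    (cotangentMap h').toHom.comp (cotangentMap h).toHom = (cotangentMap h'').toHom := by
  refine DGVect.Hom.cohomologyMap_of_toLin_eq (LinearMap.ext fun t => ?_)
  refine hom_ext_delta (φ := (cotangentMap h').comp (cotangentMap h)) (ψ := cotangentMap h'')
    (fun x => ?_) t
  rw [Hom.comp_apply, cotangentMap_delta, cotangentMap_delta, cotangentMap_delta, ← hk]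
  rfl

/-- The endomorphism is a variable with a proof that it is the identity, so that composites can be
inserted without rewriting inside the dependent argument of `cotangentMap`. -/
theorem cotangentMap_id_isWeakEquiv {q : X ⟶ B} {k : X ⟶ X} (hk : k = 𝟙 X) (h : k ≫ q = q) :
    (cotangentMap h).IsWeakEquiv := by
  subst hk
  have : (cotangentMap h).toHom = DGVect.Hom.id _ := by
    refine DGVect.Hom.cohomologyMap_of_toLin_eq (LinearMap.ext fun t => ?_)
    refine hom_ext_delta (φ := cotangentMap h) (ψ := Hom.id _) (fun x => ?_) t
    rw [cotangentMap_delta]; rfl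
  change DGVect.Hom.IsQuasiIso _
  rw [this]
  exact DGVect.Hom.isQuasiIso_id _

/-- A semifree extension whose push-out to `B` is an acyclic cofibration induces a
quasi-isomorphism on cotangent modules. -/
theorem cotangentMap_inclusion_isWeakEquiv (D : Semifree X) {q : D.ext ⟶ B} {r : X ⟶ B}
    (h : D.inclusion ≫ q = r) {j : B ⟶ Y} {k : D.ext ⟶ Y} (hY : IsPushout r D.inclusion j k)
    (hj : LiftsFibrations j) : (cotangentMap h).IsWeakEquiv := by
  refine isWeakEquiv_of_coker (cotangentMap_injective D h) fun n c hc dc =>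
    coker_cotangentMap_acyclic h ?_ hc dc
  -- A morphism to `B ⊕ N` that is the zero section on `X` factors through the push-out, where it
  -- restricts to the zero section on `B`. The lifting problem thus becomes one for `j`.
  intro M N ψ hψ u hu hu'
  have := hj _ hψ
  have sq : CommSq (zeroSection M) j (squareZeroMap ψ) (hY.desc (zeroSection N) u hu'.symm) :=
    ⟨by
      rw [hY.inl_desc]
      exact CDGA.hom_ext fun b => SquareZero.ext rfl (map_zero ψ.toLin)⟩
  refine ⟨k ≫ sq.lift, ?_, ?_⟩
  · rw [← Category.assoc, ← hY.w, Category.assoc, sq.fac_left]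
  · rw [Category.assoc, sq.fac_right, hY.inr_desc]

/-- Trivial fibrations between objects that lift against trivial fibrations induce
quasi-isomorphisms on cotangent modules. -/
theorem cotangentMap_isWeakEquiv_of_isTrivialFibration [CharZero K] {π : Y ⟶ X}
    (hπ : IsTrivialFibration π) (hX : LiftsTrivialFibrations X)
    (hY : LiftsTrivialFibrations Y) {q : X ⟶ B} {q' : Y ⟶ B}
    (h : π ≫ q = q') : (cotangentMap h).IsWeakEquiv := by
  -- The section `s` is a weak equivalence, so in its factorization the semifree part is acyclic and
  -- falls under the case already settled. Composed with `ρ ≫ π` this part is the identity, so `ρ ≫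
  -- π` is settled too.
  obtain ⟨s, hs⟩ := hX π hπ (𝟙 X)
  obtain ⟨D, ρ, hρs, hρ⟩ := exists_trivialFibration_factorization s
  obtain ⟨t, ht⟩ := hY ρ hρ (𝟙 Y)
  have hD : IsWeakEquiv D.inclusion := hρ.2.of_comp_left (by
    rw [hρs]
    exact hπ.2.of_comp_left (by rw [hs]; exact isWeakEquiv_id X))
  have hDq : D.inclusion ≫ ρ ≫ q' = q := by
    rw [← Category.assoc, hρs, ← h, ← Category.assoc, hs, Category.id_comp]
  have h1 : (cotangentMap hDq).IsWeakEquiv := cotangentMap_inclusion_isWeakEquiv D hDq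
    (D.isPushout_push q) (LiftsFibrations.of_isPushout (D.isPushout_push q) (D.liftsFibrations hD))
  have h2 : (ρ ≫ π) ≫ q = ρ ≫ q' := by rw [Category.assoc, h]
  have h3 : (cotangentMap h2).IsWeakEquiv := by
    refine DGVect.Hom.IsQuasiIso.of_comp_right h1 ?_
    have e : D.inclusion ≫ ρ ≫ π = 𝟙 X := by rw [← Category.assoc, hρs, hs]
    rw [cotangentMap_comp rfl hDq h2 (by rw [e, Category.id_comp])]
    exact cotangentMap_id_isWeakEquiv e _
  have h4 : t ≫ ρ ≫ q' = q' := by rw [← Category.assoc, ht, Category.id_comp]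
  -- Two out of six: `t ≫ ρ` is an identity and `ρ ≫ π` induces a quasi-isomorphism, so the middle
  -- map `ρ` does as well, and then `π`.
  have h5 : (cotangentMap (i := ρ) (q := q') rfl).IsWeakEquiv := by
    refine DGVect.Hom.IsQuasiIso.of_comp_of_comp (f := (cotangentMap h4).toHom)
      (h := (cotangentMap h).toHom) ?_ ?_
    · rw [cotangentMap_comp rfl h4 rfl (by rw [ht, Category.id_comp])]
      exact cotangentMap_id_isWeakEquiv ht _
    · rw [cotangentMap_comp rfl rfl h h2]
      exact h3
  refine DGVect.Hom.IsQuasiIso.of_comp_right h5 ?_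
  rw [cotangentMap_comp rfl rfl h h2]
  exact h3

end DGMod

/-- If `f : A → B` is flat and `B ⊗_A B → B` is a weak equivalence, then the push-out along `f` of
a semifree extension `A → A'` with a weak equivalence `A' → B` under `A` is a weak equivalence. -/
theorem Semifree.push_inclusion_isWeakEquiv {K : Type u} [Field K] [CharZero K] {A B BB : CDGA K}
    {f : A ⟶ B} (hf : CDGA.IsFlat f) {inl inr : B ⟶ BB} (hBB : IsPushout f f inl inr)
    (hmul : CDGA.IsWeakEquiv (hBB.desc (𝟙 B) (𝟙 B) rfl)) (E : Semifree A) {e : E.ext ⟶ B}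
    (he : E.inclusion ≫ e = f) (hw : IsWeakEquiv e) : IsWeakEquiv (E.push f).inclusion := by
  -- Flatness concerns trivial fibrations, while `e` is only a weak equivalence. Enlarging `E` by a
  -- disk extension turns it into a trivial fibration `g`, and push-outs of the enlargement remain
  -- weak equivalences.
  obtain ⟨I, dg, g, hg, hfib⟩ := exists_fibration_factorization e
  let F := disk E.ext dg
  have hF : LiftsFibrations F.inclusion := fun _ _ p hp => disk_hasLiftingProperty _ dg hp
  have hgt : IsTrivialFibration g :=
    ⟨hfib, (disk_isWeakEquiv E.ext dg).of_comp_right (by rwa [hg])⟩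
  have hx : (E.inclusion ≫ F.inclusion) ≫ g = f := by rw [Category.assoc, hg, he]
  let m := E.pushMap f
  have hP : IsPushout (E.inclusion ≫ F.inclusion) f (F.pushMap m)
      ((E.push f).inclusion ≫ (F.push m).inclusion) :=
    (E.isPushout_push f).flip.paste_horiz (F.isPushout_push m).flip
  -- Applied to the degenerate pull-back square of `g` along an identity, flatness says that the
  -- push-out of `g`, with target `B ⊗_A B`, is again a trivial fibration.
  have hT := (hf (𝟙 _) g g (𝟙 B) IsPullback.of_id_fst hgt _ _ f f (Category.comp_id _) hx hx
    (Category.comp_id f) _ _ _ _ _ _ _ _ hP hP hBB hBB).2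
  have h1 : IsWeakEquiv (F.push m).inclusion :=
    (LiftsFibrations.of_isPushout (F.isPushout_push m) hF).isWeakEquiv
  -- The inclusion of `B` is a section of the composite weak equivalence through `B ⊗_A B` to `B`,
  -- so it is a weak equivalence by two out of three.
  refine ((h1.comp hT.2).comp hmul).of_comp_left ?_
  have h2 : (E.push f).inclusion ≫ ((F.push m).inclusion ≫ pushoutMap hP hBB g hx) ≫
      hBB.desc (𝟙 B) (𝟙 B) rfl = 𝟙 B := by
    have h3 : ((E.push f).inclusion ≫ (F.push m).inclusion) ≫ pushoutMap hP hBB g hx = inr :=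
      hP.inr_desc _ _ _
    rw [← Category.assoc, ← Category.assoc, h3, hBB.inr_desc]
  rw [h2]
  exact isWeakEquiv_id B

theorem proposition7p9 {K : Type u} [Field K] [CharZero K] {A B R S BB : CDGA K}
    (f : A ⟶ B) (hf : CDGA.IsFlat f)
    (inl inr : B ⟶ BB) (hBB : IsPushout f f inl inr)
    (hmul : CDGA.IsWeakEquiv (hBB.desc (𝟙 B) (𝟙 B) rfl))
    (i : R ⟶ S) (p : R ⟶ A) (q : S ⟶ B) (comm : i ≫ q = p ≫ f)
    (hp : CDGA.IsCofibrantReplacement p) (hq : CDGA.IsCofibrantReplacement q) :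
    (DGMod.cotangentMap comm).IsWeakEquiv := by
  obtain ⟨D, π, hπi, hπ⟩ := exists_trivialFibration_factorization i
  have hD : D.inclusion ≫ π ≫ q = p ≫ f := by rw [← Category.assoc, hπi, comm]
  -- `E` is a semifree model of `B` over `A` itself: it receives a weak equivalence from `D`, and
  -- `D` maps to `B` by a weak equivalence that factors through it.
  let E := D.push p
  let e : E.ext ⟶ B := (D.isPushout_push p).desc f (π ≫ q) hD.symm
  have he : E.inclusion ≫ e = f := (D.isPushout_push p).inl_desc _ _ _
  have hw : CDGA.IsWeakEquiv e := by
    refine (D.pushMap_isWeakEquiv hp.2).of_comp_right ?_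
    rw [(D.isPushout_push p).inr_desc]
    exact hπ.2.comp hq.2
  -- By pasting, the push-out of `R → D` to `B` is the push-out of `A → E` along `f`, to which the
  -- hypotheses on `f` apply.
  have h1 : (DGMod.cotangentMap hD).IsWeakEquiv :=
    DGMod.cotangentMap_inclusion_isWeakEquiv D hD
      ((D.isPushout_push p).paste_horiz (E.isPushout_push f))
      ((E.push f).liftsFibrations (E.push_inclusion_isWeakEquiv hf hBB hmul he hw))
  have h2 : (DGMod.cotangentMap (i := π) (q := q) rfl).IsWeakEquiv :=
    DGMod.cotangentMap_isWeakEquiv_of_isTrivialFibration hπ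
      hq.1.liftsTrivialFibrations (hp.1.liftsTrivialFibrations.ext D) rfl
  have h3 := DGVect.Hom.IsQuasiIso.comp h2 h1
  rwa [DGMod.cotangentMap_comp hπi hD rfl comm] at h3
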